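/- Let $k\ge 2$ be a fixed integer. There is a randomized algorithm that detects $2k$-cycles in time $\widetilde{O}(m^{2k/(k+1)})$. Precisely: for every integer $a\ge 0$ there are a randomized word-RAM program $P$ and constants $C,c,c_0$ (all depending only on $k$ and $a$) such that the following holds for every simple undirected graph $G$ with vertex set $\{0,\dots,n-1\}$, $n\ge 1$, and with $m\ge n$ edges, every list of the edges of $G$ (each edge once, in any order and orientation), and every word length $w\ge c_0\log_2 n$. Given $n$, $m$ and the edge list as input, 1. $P$ halts, for every outcome of its coin tosses, after at most $C\,m^{2k/(k+1)}(\log_2 m)^{c}$ steps; and 2. with probability at least $1-n^{-a}$ over its coin tosses, $P$ answers correctly whether $G$ contains a (not necessarily induced) cycle $C_{2k}$ of length $2k$ as a subgraph. Here a word-RAM program is a finite structured program (assignments, sequencing, conditionals, while-loops) over finitely many registers and random-access arrays of $w$-bit words, initially zero apart from the input; each word operation ($+,-,\times$, integer division, remainder, comparison), memory access, assignment, branching and fair coin toss costs one step. -/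

import Mathlib

/-! ## A randomized word RAM

Programs are finite structured programs.  A machine has scalar variables (registers) and
random-access arrays, all of whose cells hold `w`-bit words, that is, numbers below `2 ^ w`.
Every arithmetic operation, comparison, array access, assignment, branching and coin toss
costs one step.  A program mentions only finitely many registers and arrays. -/

namespace WordRAM

/-- The word operations.  Comparisons return `0` or `1`. -/
inductive BinOp where
  | add | sub | mul | div | mod | lt | eq

/-- The value of a word operation on `w`-bit words: results are reduced modulo `2 ^ w`.
Subtraction is truncated at `0`, and `x / 0 = 0`, `x % 0 = x`. -/
def BinOp.eval (w : ℕ) : BinOp → ℕ → ℕ → ℕ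
  | .add, x, y => (x + y) % 2 ^ w
  | .sub, x, y => (x - y) % 2 ^ w
  | .mul, x, y => (x * y) % 2 ^ w
  | .div, x, y => (x / y) % 2 ^ w
  | .mod, x, y => (x % y) % 2 ^ w
  | .lt, x, y => (if x < y then 1 else 0) % 2 ^ w
  | .eq, x, y => (if x = y then 1 else 0) % 2 ^ w

/-- Expressions: literals, registers, array cells `a[e]`, and word operations. -/
inductive Expr where
  | lit (c : ℕ)
  | reg (x : ℕ)
  | read (a : ℕ) (e : Expr)
  | bin (op : BinOp) (e₁ e₂ : Expr)

/-- A machine state: the registers, the arrays (array `a` has the cells `arr a 0, arr a 1, …`),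
and the number of coins tossed so far. -/
structure State where
  reg : ℕ → ℕ
  arr : ℕ → ℕ → ℕ
  coins : ℕ

/-- The value of an expression in a state. -/
def Expr.eval (w : ℕ) (s : State) : Expr → ℕ
  | .lit c => c % 2 ^ w
  | .reg x => s.reg x
  | .read a e => s.arr a (e.eval w s)
  | .bin op e₁ e₂ => op.eval w (e₁.eval w s) (e₂.eval w s)

/-- The number of steps taken to evaluate an expression: one for each node. -/
def Expr.cost : Expr → ℕ
  | .lit _ => 1
  | .reg _ => 1
  | .read _ e => e.cost + 1
  | .bin _ e₁ e₂ => e₁.cost + e₂.cost + 1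

/-- Programs. -/
inductive Cmd where
  /-- do nothing -/
  | skip
  /-- `x := e` -/
  | assign (x : ℕ) (e : Expr)
  /-- `a[i] := e` -/
  | store (a : ℕ) (i e : Expr)
  /-- `x :=` the outcome (`0` or `1`) of a fair coin toss -/
  | toss (x : ℕ)
  /-- `c₁; c₂` -/
  | seq (c₁ c₂ : Cmd)
  /-- `if e ≠ 0 then c₁ else c₂` -/
  | ite (e : Expr) (c₁ c₂ : Cmd)
  /-- `while e ≠ 0 do c` -/
  | loop (e : Expr) (c : Cmd)

/-- Write the value `v` to the register `x`. -/
def State.setReg (s : State) (x v : ℕ) : State :=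
  { s with reg := Function.update s.reg x v }

/-- Write the value `v` to the cell `i` of the array `a`. -/
def State.setArr (s : State) (a i v : ℕ) : State :=
  { s with arr := Function.update s.arr a (Function.update (s.arr a) i v) }

/-- `Exec w ω P s t s'`: with word length `w` and coin tosses `ω 0, ω 1, …`, the program `P`,
started in the state `s`, halts after exactly `t` steps in the state `s'`. -/
inductive Exec (w : ℕ) (ω : ℕ → Bool) : Cmd → State → ℕ → State → Prop where
  | skip (s : State) : Exec w ω .skip s 1 s
  | assign (s : State) (x : ℕ) (e : Expr) :
      Exec w ω (.assign x e) s (e.cost + 1) (s.setReg x (e.eval w s))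
  | store (s : State) (a : ℕ) (i e : Expr) :
      Exec w ω (.store a i e) s (i.cost + e.cost + 1) (s.setArr a (i.eval w s) (e.eval w s))
  | toss (s : State) (x : ℕ) :
      Exec w ω (.toss x) s 1 { s.setReg x (ω s.coins).toNat with coins := s.coins + 1 }
  | seq {c₁ c₂ : Cmd} {s s₁ s₂ : State} {t₁ t₂ : ℕ}
      (h₁ : Exec w ω c₁ s t₁ s₁) (h₂ : Exec w ω c₂ s₁ t₂ s₂) :
      Exec w ω (.seq c₁ c₂) s (t₁ + t₂) s₂
  | iteTrue {e : Expr} {c₁ c₂ : Cmd} {s s' : State} {t : ℕ}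
      (he : e.eval w s ≠ 0) (h : Exec w ω c₁ s t s') :
      Exec w ω (.ite e c₁ c₂) s (e.cost + 1 + t) s'
  | iteFalse {e : Expr} {c₁ c₂ : Cmd} {s s' : State} {t : ℕ}
      (he : e.eval w s = 0) (h : Exec w ω c₂ s t s') :
      Exec w ω (.ite e c₁ c₂) s (e.cost + 1 + t) s'
  | loopExit {e : Expr} {c : Cmd} {s : State} (he : e.eval w s = 0) :
      Exec w ω (.loop e c) s (e.cost + 1) s
  | loopStep {e : Expr} {c : Cmd} {s s₁ s₂ : State} {t₁ t₂ : ℕ}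
      (he : e.eval w s ≠ 0) (h₁ : Exec w ω c s t₁ s₁) (h₂ : Exec w ω (.loop e c) s₁ t₂ s₂) :
      Exec w ω (.loop e c) s (e.cost + 1 + t₁ + t₂) s₂

/-- For given coin tosses, the running time and the final state of a halting program are
uniquely determined. -/
theorem Exec.deterministic {w : ℕ} {ω : ℕ → Bool} {P : Cmd} {s s₁ : State} {t₁ : ℕ}
    (h : Exec w ω P s t₁ s₁) :
    ∀ {t₂ : ℕ} {s₂ : State}, Exec w ω P s t₂ s₂ → t₁ = t₂ ∧ s₁ = s₂ := by
  induction h with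
  | skip s => intro _ _ h; cases h; exact ⟨rfl, rfl⟩
  | assign s x e => intro _ _ h; cases h; exact ⟨rfl, rfl⟩
  | store s a i e => intro _ _ h; cases h; exact ⟨rfl, rfl⟩
  | toss s x => intro _ _ h; cases h; exact ⟨rfl, rfl⟩
  | seq _ _ ih₁ ih₂ =>
    intro _ _ h
    cases h with
    | seq k₁ k₂ =>
      obtain ⟨rfl, rfl⟩ := ih₁ k₁
      obtain ⟨rfl, rfl⟩ := ih₂ k₂
      exact ⟨rfl, rfl⟩
  | iteTrue he _ ih =>
    intro _ _ h
    cases h with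
    | iteTrue _ k => obtain ⟨rfl, rfl⟩ := ih k; exact ⟨rfl, rfl⟩
    | iteFalse he' _ => exact absurd he' he
  | iteFalse he _ ih =>
    intro _ _ h
    cases h with
    | iteTrue he' _ => exact absurd he he'
    | iteFalse _ k => obtain ⟨rfl, rfl⟩ := ih k; exact ⟨rfl, rfl⟩
  | loopExit he =>
    intro _ _ h
    cases h with
    | loopExit _ => exact ⟨rfl, rfl⟩
    | loopStep he' _ _ => exact absurd he he'
  | loopStep he _ _ ih₁ ih₂ =>
    intro _ _ h
    cases h with
    | loopExit he' => exact absurd he' he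
    | loopStep _ k₁ k₂ =>
      obtain ⟨rfl, rfl⟩ := ih₁ k₁
      obtain ⟨rfl, rfl⟩ := ih₂ k₂
      exact ⟨rfl, rfl⟩

/-- The output convention of a decision program: it answers "yes" if register `0` is
nonzero, and "no" otherwise. -/
def State.Accepts (s : State) : Prop := s.reg 0 ≠ 0

/-- The law of an infinite sequence of independent fair coin tosses. -/
noncomputable def coinMeasure : MeasureTheory.Measure (ℕ → Bool) :=
  MeasureTheory.Measure.infinitePi fun _ => (PMF.uniformOfFintype Bool).toMeasure

/-- `L` lists every edge of `G` exactly once, in any order and with either orientation. -/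
def IsEdgeList {n : ℕ} (G : SimpleGraph (Fin n)) (L : List (Fin n × Fin n)) : Prop :=
  (L.map fun p => s(p.1, p.2)).Nodup ∧ ∀ e, e ∈ (L.map fun p => s(p.1, p.2)) ↔ e ∈ G.edgeSet

/-- The initial state on the input `L`, a list of edges on the vertex set `{0, …, n - 1}`:
register `0` holds the number of vertices, register `1` the number of edges, the `i`-th edge
joins the vertices in the `i`-th cells of the arrays `0` and `1`, and the rest is zero. -/
def input {n : ℕ} (L : List (Fin n × Fin n)) : State where
  reg := fun x => if x = 0 then n else if x = 1 then L.length else 0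
  arr := fun a i =>
    if a = 0 then (L.map fun p => (p.1 : ℕ)).getD i 0
    else if a = 1 then (L.map fun p => (p.2 : ℕ)).getD i 0
    else 0
  coins := 0

end WordRAM

set_option linter.unusedSectionVars false

/-! The algorithm is colour coding with degree-capped searches and a shared budget. In each round
every vertex gets a random colour below 2^b. From every vertex v of colour 0, two searches follow
edges leading to the next colour, one for the colouring and one for its reversal modulo 2k
(`dualColour`). Both use only vertices of degree at most deg v and do not continue beyond colour k.
If both touch a vertex of colour k, the two chains close up to a 2k-cycle, since its vertices have
distinct colours (`Meets.isContained`). Conversely, a 2k-cycle coloured 0, …, 2k-1 in order from a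
vertex of maximum degree on it is found, because the cap cuts nothing off
(`meets_of_coloured_cycle`). This colouring has probability at least 2^(-2kb) in each round, so
O(log n) independent rounds all miss it with probability at most n^(-a) (`exists_bad_event`).

Let D be the least positive integer with m ≤ D^(k+1). Scanned edges are paid from a budget of order
m D^(k-1) (log n)^k, and the program also answers yes when the budget runs out. Since m D^(k-1) is
of order m^(2k/(k+1)), the budget yields the time bound for every outcome of the tosses. Without a
2k-cycle the searches of all rounds together cost less than the budget (`sum_scanCost_le`), so the
only possible error is to miss a cycle.

For the cost bound, at most 2m/D^2 ≤ 2D^(k-1) sources have degree above D^2, and each costs at most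
2m. For a light source v, the cap gives deg u ≤ √(deg v) √(deg u) for every u reached. The total is
then at most the sum of ⟨z, M^i z⟩ over i < k, where z is about √deg and M is the adjacency operator
between light vertices of opposite colour parity. As ‖z‖^2 = O(m), it suffices that M has norm O(D
log n).

The norm bound comes from an edge count: disjoint sets A, B of light vertices span O(D √(|A||B|))
edges (`pairs_sq_le`), and a dyadic decomposition turns this into an operator bound at the price of
a logarithm (`bilinear_sq_le`). If there were more edges, some part would have minimum degrees p, q
on its two sides with pq ≥ (4cD)^2, where c = 2k+4. Breadth-first layers in it grow alternately by
the factors p/(2c) and q/(2c), and k layers already force more than D^(k+1) ≥ m edges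
(`pow_le_pairs_of_min_degree`). They grow because consecutive layers of a tree of depth at most k
span few edges when there is no 2k-cycle (`pairs_layers_le`, an argument of Bondy–Simonovits type).
-/

namespace EvenCycle
open Finset

/-! ### Cycles as cyclic sequences of vertices. -/

section Cycles
variable {V : Type*} {G : SimpleGraph V}

/-- A cyclic sequence of `N` distinct vertices, consecutive ones adjacent, is a cycle. -/
theorem cycle_of_seq {N : ℕ} (hN : 3 ≤ N) (f : ℕ → V)
    (hinj : ∀ i < N, ∀ j < N, f i = f j → i = j)
    (hadj : ∀ i, i + 1 < N → G.Adj (f i) (f (i + 1))) (hlast : G.Adj (f (N - 1)) (f 0)) :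
    (SimpleGraph.cycleGraph N).IsContained G := by
  have key : ∀ u v : Fin N, (u - v).val = 1 → G.Adj (f u) (f v) := by
    intro u v h
    have hu := u.isLt
    have hv := v.isLt
    rw [Fin.sub_def] at h
    simp only at h
    by_cases huv : v.val ≤ u.val
    · have h1 : N - v.val + u.val = (u.val - v.val) + N := by omega
      rw [h1, Nat.add_mod_right, Nat.mod_eq_of_lt (by omega)] at h
      have h2 : u.val = v.val + 1 := by omega
      rw [h2]
      exact (hadj v.val (by omega)).symm
    · rw [Nat.mod_eq_of_lt (by omega)] at h
      have h1 : v.val = N - 1 := by omega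
      have h2 : u.val = 0 := by omega
      rw [h1, h2]
      exact hlast.symm
  refine ⟨⟨⟨fun i => f i, ?_⟩, ?_⟩⟩
  · intro u v h
    rw [SimpleGraph.cycleGraph_adj'] at h
    rcases h with h | h
    · exact key u v h
    · exact (key v u h).symm
  · intro u v h
    exact Fin.ext (hinj u u.isLt v v.isLt h)

/-- A copy of a cycle, traversed from a vertex maximizing `d`. -/
theorem seq_of_cycle {N : ℕ} (hN : 3 ≤ N)
    (h : (SimpleGraph.cycleGraph N).IsContained G) (d : V → ℕ) :
    ∃ f : ℕ → V, (∀ i < N, ∀ j < N, f i = f j → i = j) ∧ (∀ i, G.Adj (f i) (f (i + 1))) ∧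
      f N = f 0 ∧ ∀ i, d (f i) ≤ d (f 0) := by
  obtain ⟨φ⟩ := h
  have hN0 : 0 < N := by omega
  have : NeZero N := ⟨by omega⟩
  obtain ⟨j₀, -, hj₀⟩ := Finset.exists_max_image (univ : Finset (Fin N)) (fun i => d (φ i))
    ⟨⟨0, hN0⟩, mem_univ _⟩
  let ix : ℕ → Fin N := fun i => ⟨(j₀.val + i) % N, Nat.mod_lt _ hN0⟩
  refine ⟨fun i => φ (ix i), ?_, ?_, ?_, ?_⟩
  · intro i hi j hj h
    have h1 := φ.injective h
    have h2 : (j₀.val + i) % N = (j₀.val + j) % N := congrArg Fin.val h1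
    have h3 : i ≡ j [MOD N] := Nat.ModEq.add_left_cancel' j₀.val h2
    exact Nat.ModEq.eq_of_lt_of_lt h3 hi hj
  · intro i
    apply φ.toHom.map_rel
    rw [SimpleGraph.cycleGraph_adj']
    right
    rw [Fin.sub_def]
    simp only [ix]
    have h1 : (j₀.val + (i + 1)) % N = ((j₀.val + i) % N + 1) % N := by
      rw [← add_assoc, Nat.mod_add_mod]
    rw [h1, Nat.add_mod_mod]
    have h2 := Nat.mod_lt (j₀.val + i) hN0
    have h3 : N - (j₀.val + i) % N + ((j₀.val + i) % N + 1) = 1 + N := by omega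
    rw [h3, Nat.add_mod_right, Nat.mod_eq_of_lt (by omega)]
  · simp [ix]
  · intro i
    have h0 : ix 0 = j₀ := by
      apply Fin.ext
      simp [ix, Nat.mod_eq_of_lt j₀.isLt]
    simp only [h0]
    exact hj₀ _ (mem_univ _)

end Cycles

/-! ### Pair counts, parts of large minimum degree, greedy paths. -/

section Bipartite
variable {V : Type*}

/-- The number of pairs in `A × B` related by `r`. -/
def pairs (r : V → V → Prop) [DecidableRel r] (A B : Finset V) : ℕ :=
  ∑ a ∈ A, #{b ∈ B | r a b}

theorem pairs_eq_sum_right (r : V → V → Prop) [DecidableRel r] (A B : Finset V) :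
    pairs r A B = ∑ b ∈ B, #{a ∈ A | r a b} := by
  unfold pairs
  exact Finset.sum_card_bipartiteAbove_eq_sum_card_bipartiteBelow r

theorem pairs_mono (r : V → V → Prop) [DecidableRel r] {A A' B B' : Finset V} (hA : A ⊆ A')
    (hB : B ⊆ B') : pairs r A B ≤ pairs r A' B' := by
  unfold pairs
  calc ∑ a ∈ A, #{b ∈ B | r a b} ≤ ∑ a ∈ A, #{b ∈ B' | r a b} :=
        Finset.sum_le_sum fun a _ => Finset.card_le_card (Finset.filter_subset_filter _ hB)
    _ ≤ _ := Finset.sum_le_sum_of_subset hA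

/-- A relation with `e > α |A| + β |B|` pairs between `A` and `B` contains a nonempty part in
which the degrees are at least `α` and `β`, respectively. -/
theorem exists_min_degree_part [DecidableEq V] (r : V → V → Prop) [DecidableRel r]
    (A B : Finset V) (α β : ℝ) (hα : 0 ≤ α) (hβ : 0 ≤ β)
    (h : α * #A + β * #B < pairs r A B) :
    ∃ A' ⊆ A, ∃ B' ⊆ B, A'.Nonempty ∧ B'.Nonempty ∧
      (∀ a ∈ A', α ≤ #{b ∈ B' | r a b}) ∧ (∀ b ∈ B', β ≤ #{a ∈ A' | r a b}) := by
  -- The required part maximizes φ over all pairs of subsets. The maximum is positive because φ (A,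
  -- B) is, and deleting a vertex cannot increase φ, which is exactly the degree condition.
  let φ : Finset V × Finset V → ℝ := fun p => pairs r p.1 p.2 - α * #p.1 - β * #p.2
  obtain ⟨⟨A', B'⟩, hmem, hmax⟩ := Finset.exists_max_image (A.powerset ×ˢ B.powerset) φ
    ⟨(A, B), by simp⟩
  rw [Finset.mem_product, Finset.mem_powerset, Finset.mem_powerset] at hmem
  obtain ⟨hA', hB'⟩ := hmem
  simp only at hA' hB'
  have hpos : 0 < φ (A', B') := by
    refine lt_of_lt_of_le ?_ (hmax (A, B) (by simp))
    simp only [φ]; linarith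
  have hp : 0 < pairs r A' B' := by
    by_contra h0
    have h0 : pairs r A' B' = 0 := by omega
    simp only [φ, h0] at hpos
    have : 0 ≤ α * #A' := by positivity
    have : 0 ≤ β * #B' := by positivity
    push_cast at hpos
    linarith
  refine ⟨A', hA', B', hB', ?_, ?_, ?_, ?_⟩
  · rw [Finset.nonempty_iff_ne_empty]; rintro rfl; simp [pairs] at hp
  · rw [Finset.nonempty_iff_ne_empty]; rintro rfl; simp [pairs] at hp
  · intro a ha
    have h1 := hmax (A'.erase a, B') (by
      simp only [mem_product, mem_powerset]
      exact ⟨(Finset.erase_subset _ _).trans hA', hB'⟩)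
    have h2 : pairs r A' B' = #{b ∈ B' | r a b} + pairs r (A'.erase a) B' := by
      unfold pairs; exact (Finset.add_sum_erase _ _ ha).symm
    have h3 : (#A' : ℝ) = #(A'.erase a) + 1 := by
      rw [← Finset.card_erase_add_one ha]; push_cast; ring
    simp only [φ, h2, h3] at h1
    push_cast at h1
    nlinarith
  · intro b hb
    have h1 := hmax (A', B'.erase b) (by
      simp only [mem_product, mem_powerset]
      exact ⟨hA', (Finset.erase_subset _ _).trans hB'⟩)
    have h2 : pairs r A' B' = #{a ∈ A' | r a b} + pairs r A' (B'.erase b) := by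
      rw [pairs_eq_sum_right, pairs_eq_sum_right]; exact (Finset.add_sum_erase _ _ hb).symm
    have h3 : (#B' : ℝ) = #(B'.erase b) + 1 := by
      rw [← Finset.card_erase_add_one hb]; push_cast; ring
    simp only [φ, h2, h3] at h1
    push_cast at h1
    nlinarith

/-- A greedy path: a relation all of whose degrees exceed `t + #S + 1` on a set closed under it
has a path of length `t` from any given vertex whose other vertices avoid `S`. -/
theorem exists_path_avoiding [DecidableEq V] (r : V → V → Prop) (nb : V → Finset V) (W S : Finset V)
    (hnb : ∀ u ∈ W, ∀ v ∈ nb u, r u v ∧ v ∈ W) {y : V} (hy : y ∈ W) (t : ℕ)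
    (hdeg : ∀ u ∈ W, t + #S + 1 ≤ #(nb u)) :
    ∃ f : ℕ → V, f 0 = y ∧ (∀ i < t, r (f i) (f (i + 1))) ∧ (∀ i ≤ t, f i ∈ W) ∧
      (∀ i ≤ t, ∀ j ≤ t, f i = f j → i = j) ∧ ∀ i ≤ t, 0 < i → f i ∉ S := by
  induction t with
  | zero =>
    exact ⟨fun _ => y, rfl, by simp, by simp [hy], by intro i hi j hj _; omega,
      by intro i hi h; omega⟩
  | succ t ih =>
    obtain ⟨f, h0, hr, hW, hinj, hS⟩ := ih (fun u hu => by have := hdeg u hu; omega)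
    -- Only the at most #S + (t + 1) vertices of `S` and of the path so far are forbidden, fewer
    -- than the degree of `f t`.
    have h1 : ∃ z ∈ nb (f t), z ∉ S ∪ (range (t + 1)).image f := by
      by_contra hcon
      push Not at hcon
      have h2 : #(nb (f t)) ≤ #(S ∪ (range (t + 1)).image f) := Finset.card_le_card hcon
      have h3 := Finset.card_union_le S ((range (t + 1)).image f)
      have h4 : #((range (t + 1)).image f) ≤ t + 1 := by
        simpa using Finset.card_image_le (s := range (t + 1)) (f := f)
      have := hdeg _ (hW t le_rfl)
      omega
    obtain ⟨z, hz, hzn⟩ := h1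
    rw [Finset.mem_union, not_or] at hzn
    have hne : ∀ i ≤ t, f i ≠ z := fun i hi h =>
      hzn.2 (Finset.mem_image.2 ⟨i, Finset.mem_range.2 (by omega), h⟩)
    refine ⟨fun i => if i ≤ t then f i else z, by simpa using h0, ?_, ?_, ?_, ?_⟩
    · intro i hi
      by_cases h : i + 1 ≤ t
      · simpa [h, show i ≤ t by omega] using hr i (by omega)
      · have : i = t := by omega
        subst this
        simpa using (hnb _ (hW i le_rfl) z hz).1
    · intro i hi
      by_cases h : i ≤ t
      · simpa [h] using hW i h
      · simpa [h] using (hnb _ (hW t le_rfl) z hz).2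
    · intro i hi j hj h
      by_cases h1 : i ≤ t <;> by_cases h2 : j ≤ t
      · simp only [h1, h2, if_true] at h; exact hinj i h1 j h2 h
      · simp only [h1, h2, if_true, if_false] at h; exact absurd h (hne i h1)
      · simp only [h1, h2, if_true, if_false] at h; exact absurd h.symm (hne j h2)
      · omega
    · intro i hi hpos
      by_cases h : i ≤ t
      · simpa [h] using hS i h hpos
      · simpa [h] using hzn.1

end Bipartite

/-! ### Few edges between consecutive layers of a tree. -/

section Layers
variable {V : Type*} {G : SimpleGraph V}

/-- Two vertices `x`, `z` of a layer `L i` whose root paths first meet after `h` steps, joined by a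
path `x, f 0, f 1, …, f (2 l - 1) = z` in the layers `i` and `i + 1`, lie on a cycle of
length `2 (l + h)`. -/
theorem cycle_of_layers {L : ℕ → Finset V} {p : V → V}
    (hp : ∀ j, ∀ u ∈ L (j + 1), p u ∈ L j ∧ G.Adj u (p u))
    (hdisj : ∀ i j u, u ∈ L i → u ∈ L j → i = j) {i l h : ℕ} (hl : 1 ≤ l) (hh : 1 ≤ h) (hhi : h ≤ i)
    {x : V} {f : ℕ → V} (hx : x ∈ L i) (hz : f (2 * l - 1) ∈ L i)
    (hxf : G.Adj x (f 0)) (hf : ∀ j < 2 * l - 1, G.Adj (f j) (f (j + 1)))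
    (hlev : ∀ j ≤ 2 * l - 1, f j ∈ L i ∨ f j ∈ L (i + 1))
    (hinj : ∀ a ≤ 2 * l - 1, ∀ b ≤ 2 * l - 1, f a = f b → a = b)
    (hfx : ∀ j ≤ 2 * l - 1, f j ≠ x)
    (hmeet : p^[h] (f (2 * l - 1)) = p^[h] x)
    (hne : p^[h - 1] (f (2 * l - 1)) ≠ p^[h - 1] x) :
    (SimpleGraph.cycleGraph (2 * (l + h))).IsContained G := by
  have hlevel : ∀ e u, u ∈ L i → e ≤ i → p^[e] u ∈ L (i - e) := by
    intro e
    induction e with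
    | zero => intro u hu _; simpa using hu
    | succ e ih =>
      intro u hu he
      rw [Function.iterate_succ_apply']
      have h1 := ih u hu (by omega)
      rw [show i - e = (i - (e + 1)) + 1 by omega] at h1
      exact (hp _ _ h1).1
  have hstep : ∀ e u, u ∈ L i → e + 1 ≤ i → G.Adj (p^[e] u) (p^[e + 1] u) := by
    intro e u hu he
    have h1 := hlevel e u hu (by omega)
    rw [show i - e = (i - (e + 1)) + 1 by omega] at h1
    rw [Function.iterate_succ_apply']
    exact (hp _ _ h1).2
  -- Root paths that have met stay together, so paths apart after h - 1 steps were apart before.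
  have hne' : ∀ e, e ≤ h - 1 → p^[e] (f (2 * l - 1)) ≠ p^[e] x := by
    intro e he heq
    apply hne
    rw [show h - 1 = (h - 1 - e) + e by omega, Function.iterate_add_apply,
      Function.iterate_add_apply, heq]
  set z := f (2 * l - 1) with hzdef
  -- Position 0 is `x`, positions 1 to 2l run through `f`, the next h climb from `z` to the common
  -- ancestor, and the remaining ones descend to `x`. Collisions are excluded by the layers, or by
  -- `hne'` when the two root paths are at the same height.
  let g : ℕ → V := fun j =>
    if j = 0 then x else if j ≤ 2 * l then f (j - 1)
    else if j ≤ 2 * l + h then p^[j - 2 * l] z else p^[2 * (l + h) - j] x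
  have g0 : g 0 = x := by simp [g]
  have g1 : ∀ j, 0 < j → j ≤ 2 * l → g j = f (j - 1) := by
    intro j h1 h2; simp [g, h2, show j ≠ 0 by omega]
  have g2 : ∀ j, 2 * l ≤ j → j ≤ 2 * l + h → g j = p^[j - 2 * l] z := by
    intro j h1 h2
    by_cases h3 : j = 2 * l
    · subst h3; rw [g1 _ (by omega) le_rfl]; simp [hzdef]
    · simp [g, h2, show j ≠ 0 by omega, show ¬ j ≤ 2 * l by omega]
  have g3 : ∀ j, 2 * l + h ≤ j → j < 2 * (l + h) → g j = p^[2 * (l + h) - j] x := by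
    intro j h1 h2
    by_cases h3 : j = 2 * l + h
    · rw [g2 _ (by omega) (by omega), h3, show 2 * l + h - 2 * l = h by omega,
        show 2 * (l + h) - (2 * l + h) = h by omega, hmeet]
    · simp [g, show j ≠ 0 by omega, show ¬ j ≤ 2 * l by omega, show ¬ j ≤ 2 * l + h by omega]
  have up : ∀ j, j ≤ 2 * l → g j ∈ L i ∨ g j ∈ L (i + 1) := by
    intro j hj
    rcases Nat.eq_zero_or_pos j with rfl | h1
    · rw [g0]; exact Or.inl hx
    · rw [g1 j h1 hj]; exact hlev _ (by omega)
  have low : ∀ j, 2 * l < j → j < 2 * (l + h) →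
      (j ≤ 2 * l + h ∧ g j = p^[j - 2 * l] z ∧ g j ∈ L (i - (j - 2 * l))) ∨
      (2 * l + h < j ∧ g j = p^[2 * (l + h) - j] x ∧ g j ∈ L (i - (2 * (l + h) - j))) := by
    intro j h1 h2
    by_cases h3 : j ≤ 2 * l + h
    · left
      have := g2 j (by omega) h3
      exact ⟨h3, this, this ▸ hlevel _ _ hz (by omega)⟩
    · right
      have := g3 j (by omega) h2
      exact ⟨by omega, this, this ▸ hlevel _ _ hx (by omega)⟩
  have ginj : ∀ a b, a < b → b < 2 * (l + h) → g a ≠ g b := by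
    intro a b hab hb heq
    by_cases hb2 : b ≤ 2 * l
    · rw [g1 b (by omega) hb2] at heq
      rcases Nat.eq_zero_or_pos a with rfl | ha
      · rw [g0] at heq; exact hfx _ (by omega) heq.symm
      · rw [g1 a ha (by omega)] at heq
        have := hinj _ (by omega) _ (by omega) heq
        omega
    · by_cases ha2 : a ≤ 2 * l
      · rcases low b (by omega) hb with ⟨_, _, h3⟩ | ⟨_, _, h3⟩ <;>
        · rw [← heq] at h3
          rcases up a ha2 with h4 | h4 <;> have := hdisj _ _ _ h3 h4 <;> omega
      · rcases low b (by omega) hb with ⟨c1, c2, c3⟩ | ⟨c1, c2, c3⟩ <;>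
        rcases low a (by omega) (by omega) with ⟨d1, d2, d3⟩ | ⟨d1, d2, d3⟩ <;>
        · rw [← heq] at c3
          have := hdisj _ _ _ c3 d3
          first
          | omega
          | (rw [c2, d2, show a - 2 * l = 2 * (l + h) - b by omega] at heq
             exact hne' _ (by omega) heq)
  refine cycle_of_seq (by omega) g ?_ ?_ ?_
  · intro a ha b hb heq
    rcases lt_trichotomy a b with h1 | h1 | h1
    · exact absurd heq (ginj a b h1 hb)
    · exact h1
    · exact absurd heq.symm (ginj b a h1 ha)
  · intro j hj
    by_cases h1 : j + 1 ≤ 2 * l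
    · rw [g1 (j + 1) (by omega) h1]
      rcases Nat.eq_zero_or_pos j with rfl | h2
      · rw [g0]; exact hxf
      · rw [g1 j h2 (by omega)]
        have := hf (j - 1) (by omega)
        rwa [show j - 1 + 1 = j + 1 - 1 by omega] at this
    · by_cases h2 : j + 1 ≤ 2 * l + h
      · rw [g2 j (by omega) (by omega), g2 (j + 1) (by omega) h2]
        have := hstep (j - 2 * l) z hz (by omega)
        rwa [show j - 2 * l + 1 = j + 1 - 2 * l by omega] at this
      · rw [g3 j (by omega) (by omega), g3 (j + 1) (by omega) hj]
        have := hstep (2 * (l + h) - (j + 1)) x hx (by omega)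
        rw [show 2 * (l + h) - (j + 1) + 1 = 2 * (l + h) - j by omega] at this
        exact this.symm
  · rw [g0]
    by_cases h1 : 2 * l + h ≤ 2 * (l + h) - 1
    · rw [g3 _ h1 (by omega)]
      have := hstep 0 x hx (by omega)
      rw [show 2 * (l + h) - (2 * (l + h) - 1) = 1 by omega]
      exact this.symm
    · have h2 : h = 0 := by omega
      omega

/-- In a graph without cycles of length `2 k`, consecutive layers of a tree of depth at most `k`
span few edges. -/
theorem pairs_layers_le [DecidableEq V] {r : V → V → Prop} [DecidableRel r]
    (hr : ∀ u v, r u v → G.Adj u v)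
    {L : ℕ → Finset V} {p : V → V} {v : V} (h0 : L 0 = {v})
    (hp : ∀ j, ∀ u ∈ L (j + 1), p u ∈ L j ∧ G.Adj u (p u))
    (hdisj : ∀ i j u, u ∈ L i → u ∈ L j → i = j) {k i : ℕ} (hik : i + 1 ≤ k)
    (hfree : ¬ (SimpleGraph.cycleGraph (2 * k)).IsContained G) :
    (pairs r (L i) (L (i + 1)) : ℝ) ≤ (2 * k + 4) * (#(L i) + #(L (i + 1))) := by
  by_contra hcon
  push Not at hcon
  obtain ⟨X, hX, Y, hY, -, hYne, hXd, hYd⟩ := exists_min_degree_part r (L i) (L (i + 1))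
    (2 * k + 4) (2 * k + 4) (by positivity) (by positivity) (by linarith)
  have hXd' : ∀ x ∈ X, 2 * k + 4 ≤ #{y ∈ Y | r x y} := fun x hx => by exact_mod_cast hXd x hx
  have hYd' : ∀ y ∈ Y, 2 * k + 4 ≤ #{x ∈ X | r x y} := fun y hy => by exact_mod_cast hYd y hy
  have hXY : ∀ u, u ∈ X → u ∈ Y → False := fun u h1 h2 => by
    have := hdisj _ _ _ (hX h1) (hY h2); omega
  have hroot : ∀ e j u, u ∈ L (j + e) → p^[e] u ∈ L j := by
    intro e
    induction e with
    | zero => intro j u hu; simpa using hu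
    | succ e ih =>
      intro j u hu
      rw [Function.iterate_succ_apply]
      exact ih j _ (hp _ _ hu).1
  -- `M h`: vertices of X with a common neighbour in Y have the same h-th ancestor. It holds for h =
  -- i, where the ancestor is the root, and fails for h = 0, as some y has two neighbours in X. For
  -- the least h, two neighbours x, x' of some y have root paths meeting after exactly h steps.
  let M : ℕ → Prop := fun h => ∀ y ∈ Y, ∀ x ∈ X, ∀ x' ∈ X, r x y → r x' y → p^[h] x = p^[h] x'
  have hMi : M i := by
    intro y _ x hx x' hx' _ _
    have h1 := hroot i 0 x (by simpa using hX hx)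
    have h2 := hroot i 0 x' (by simpa using hX hx')
    rw [h0, Finset.mem_singleton] at h1 h2
    rw [h1, h2]
  classical
  have hex : ∃ h, M h := ⟨i, hMi⟩
  obtain ⟨h, hh, hmin⟩ : ∃ h, M h ∧ ∀ h' < h, ¬ M h' :=
    ⟨Nat.find hex, Nat.find_spec hex, fun h' hh' => Nat.find_min hex hh'⟩
  have hhi : h ≤ i := by
    by_contra hlt
    exact hmin i (by omega) hMi
  have hpos : 1 ≤ h := by
    rcases Nat.eq_zero_or_pos h with h1 | h1
    · exfalso
      obtain ⟨y, hy⟩ := hYne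
      obtain ⟨x, hx, x', hx', hne⟩ := Finset.one_lt_card.1
        (show 1 < #{x ∈ X | r x y} by have := hYd' y hy; omega)
      rw [Finset.mem_filter] at hx hx'
      rw [h1] at hh
      exact hne (hh y hy x hx.1 x' hx'.1 hx.2 hx'.2)
    · exact h1
  have hnM := hmin (h - 1) (by omega)
  simp only [M] at hnM
  push Not at hnM
  obtain ⟨y, hy, x, hx, x', hx', hxy, hxy', hne⟩ := hnM
  obtain ⟨l, hl⟩ : ∃ l, k = l + h := ⟨k - h, by omega⟩
  have hl1 : 1 ≤ l := by omega
  let nb : V → Finset V := fun u => if u ∈ X then {y ∈ Y | r u y} else {x ∈ X | r x u}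
  let s : V → V → Prop := fun u v => (u ∈ X ∧ v ∈ Y ∧ r u v) ∨ (u ∈ Y ∧ v ∈ X ∧ r v u)
  have hS : #({x, x'} : Finset V) ≤ 2 := Finset.card_le_two
  -- With k = l + h, a path of 2l - 1 edges from y in X ∪ Y ends in X. The edge to x or x' and the
  -- two root paths of length h complete it to 2l + 2h = 2k edges.
  obtain ⟨f, f0, fs, fW, finj, fS⟩ := exists_path_avoiding s nb (X ∪ Y) {x, x'} (by
      intro u hu w hw
      by_cases h1 : u ∈ X
      · simp only [nb, h1, if_true, mem_filter] at hw
        exact ⟨Or.inl ⟨h1, hw⟩, Finset.mem_union_right _ hw.1⟩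
      · simp only [nb, h1, if_false, mem_filter] at hw
        have h2 : u ∈ Y := (Finset.mem_union.1 hu).resolve_left h1
        exact ⟨Or.inr ⟨h2, hw⟩, Finset.mem_union_left _ hw.1⟩)
    (Finset.mem_union_right _ hy) (2 * l - 1) (by
      intro u hu
      by_cases h1 : u ∈ X
      · simp only [nb, h1, if_true]
        have := hXd' u h1
        omega
      · simp only [nb, h1, if_false]
        have := hYd' u ((Finset.mem_union.1 hu).resolve_left h1)
        omega)
  -- Vertices of X two steps apart on the path have a common neighbour in Y, so by `M h` all of them
  -- have the h-th ancestor of x.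
  have hodd : ∀ q, 2 * q + 1 ≤ 2 * l - 1 →
      f (2 * q + 1) ∈ X ∧ f (2 * q) ∈ Y ∧ r (f (2 * q + 1)) (f (2 * q)) ∧
        p^[h] (f (2 * q + 1)) = p^[h] x := by
    intro q
    induction q with
    | zero =>
      intro hq
      have h1 := fs 0 (by omega)
      simp only [Nat.mul_zero, Nat.zero_add]
      rw [f0] at h1 ⊢
      rcases h1 with h1 | h1
      · exact absurd hy (fun h => hXY _ h1.1 h)
      · exact ⟨h1.2.1, hy, h1.2.2, hh y hy _ h1.2.1 x hx h1.2.2 hxy⟩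
    | succ q ih =>
      intro hq
      obtain ⟨a1, a2, a3, a4⟩ := ih (by omega)
      have b1 := fs (2 * q + 1) (by omega)
      have b2 := fs (2 * q + 2) (by omega)
      rw [show 2 * (q + 1) = 2 * q + 2 by ring]
      rcases b1 with b1 | b1
      · rcases b2 with b2 | b2
        · exact absurd b1.2.1 (fun h => hXY _ b2.1 h)
        · refine ⟨b2.2.1, b2.1, b2.2.2, ?_⟩
          rw [← a4]
          exact hh _ b2.1 _ b2.2.1 _ a1 b2.2.2 b1.2.2
      · exact absurd b1.1 (fun h => hXY _ a1 h)
  obtain ⟨z1, -, -, z4⟩ := hodd (l - 1) (by omega)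
  rw [show 2 * (l - 1) + 1 = 2 * l - 1 by omega] at z1 z4
  have hxx' : p^[h] x = p^[h] x' := hh y hy x hx x' hx' hxy hxy'
  -- The (h-1)-th ancestors of x and x' differ, so that of the endpoint differs from at least one of
  -- them. The cycle is closed through that one.
  obtain ⟨x₁, hx₁, hx₁y, hx₁S, hx₁z, hx₁n⟩ : ∃ x₁ ∈ X, r x₁ y ∧ x₁ ∈ ({x, x'} : Finset V) ∧
      p^[h] (f (2 * l - 1)) = p^[h] x₁ ∧ p^[h - 1] (f (2 * l - 1)) ≠ p^[h - 1] x₁ := by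
    by_cases h1 : p^[h - 1] (f (2 * l - 1)) = p^[h - 1] x
    · exact ⟨x', hx', hxy', by simp, by rw [z4, hxx'], fun h2 => hne (h1.symm.trans h2)⟩
    · exact ⟨x, hx, hxy, by simp, z4, h1⟩
  apply hfree
  rw [hl]
  refine cycle_of_layers hp hdisj hl1 hpos hhi (hX hx₁) (hX z1) ?_ ?_ ?_ finj ?_ hx₁z hx₁n
  · rw [f0]; exact hr _ _ hx₁y
  · intro j hj
    rcases fs j hj with h1 | h1
    · exact hr _ _ h1.2.2
    · exact (hr _ _ h1.2.2).symm
  · intro j hj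
    rcases Finset.mem_union.1 (fW j hj) with h1 | h1
    · exact Or.inl (hX h1)
    · exact Or.inr (hY h1)
  · intro j hj heq
    rcases Nat.eq_zero_or_pos j with rfl | h1
    · rw [f0] at heq; exact hXY y (heq ▸ hx₁) hy
    · exact fS j hj h1 (heq ▸ hx₁S)

end Layers

/-! ### Expansion of breadth-first layers. -/

section Growth
variable {V : Type*} [Fintype V] [DecidableEq V] {G : SimpleGraph V}

/-- The vertices at distance at most `j` from `v` along the relation `r`. -/
def ballWithin (r : V → V → Prop) [DecidableRel r] (v : V) : ℕ → Finset V
  | 0 => {v}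
  | j + 1 => ballWithin r v j ∪ univ.filter fun u => ∃ w ∈ ballWithin r v j, r w u

/-- The vertices at distance exactly `j` from `v` along the relation `r`. -/
def sphere (r : V → V → Prop) [DecidableRel r] (v : V) : ℕ → Finset V
  | 0 => {v}
  | j + 1 => ballWithin r v (j + 1) \ ballWithin r v j

variable {r : V → V → Prop} [DecidableRel r] {v : V}

theorem ballWithin_mono {i j : ℕ} (h : i ≤ j) : ballWithin r v i ⊆ ballWithin r v j := by
  induction j, h using Nat.le_induction with
  | base => exact subset_rfl
  | succ j _ ih => exact ih.trans Finset.subset_union_left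

theorem sphere_subset_ball (j : ℕ) : sphere r v j ⊆ ballWithin r v j := by
  cases j with
  | zero => exact subset_rfl
  | succ j => exact Finset.sdiff_subset

theorem notMem_ball_of_mem_sphere {i j : ℕ} {u : V} (hij : i < j) (h : u ∈ sphere r v j) :
    u ∉ ballWithin r v i := by
  obtain ⟨j, rfl⟩ : ∃ j', j = j' + 1 := ⟨j - 1, by omega⟩
  exact fun h' => (Finset.mem_sdiff.1 h).2 (ballWithin_mono (by omega) h')

theorem sphere_disjoint {i j : ℕ} {u : V} (hi : u ∈ sphere r v i) (hj : u ∈ sphere r v j) :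
    i = j := by
  rcases lt_trichotomy i j with h | h | h
  · exact absurd (sphere_subset_ball i hi) (notMem_ball_of_mem_sphere h hj)
  · exact h
  · exact absurd (sphere_subset_ball j hj) (notMem_ball_of_mem_sphere h hi)

theorem mem_ball_succ {j : ℕ} {u w : V} (hu : u ∈ ballWithin r v j) (h : r u w) :
    w ∈ ballWithin r v (j + 1) :=
  Finset.mem_union_right _ (by simpa using ⟨u, hu, h⟩)

theorem mem_sphere_of_mem_ball {j : ℕ} {u : V} (h : u ∈ ballWithin r v j) :
    ∃ i ≤ j, u ∈ sphere r v i := by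
  induction j with
  | zero => exact ⟨0, le_rfl, h⟩
  | succ j ih =>
    by_cases h1 : u ∈ ballWithin r v j
    · obtain ⟨i, hi, hu⟩ := ih h1
      exact ⟨i, by omega, hu⟩
    · exact ⟨j + 1, le_rfl, Finset.mem_sdiff.2 ⟨h, h1⟩⟩

theorem exists_parent {j : ℕ} {u : V} (hu : u ∈ sphere r v (j + 1)) :
    ∃ w ∈ sphere r v j, r w u := by
  have h1 := Finset.mem_sdiff.1 hu
  rcases Finset.mem_union.1 h1.1 with h2 | h2
  · exact absurd h2 h1.2
  · simp only [mem_filter, mem_univ, true_and] at h2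
    obtain ⟨w, hw, hwu⟩ := h2
    obtain ⟨i, hi, hwi⟩ := mem_sphere_of_mem_ball hw
    rcases hi.lt_or_eq with h3 | h3
    · exact absurd (ballWithin_mono (by omega) (mem_ball_succ (sphere_subset_ball i hwi) hwu)) h1.2
    · exact ⟨w, h3 ▸ hwi, hwu⟩

theorem sphere_of_adj {j : ℕ} {u w : V} (hsymm : ∀ a b, r a b → r b a)
    (hu : u ∈ sphere r v j) (h : r u w) :
    w ∈ sphere r v (j - 1) ∨ w ∈ sphere r v j ∨ w ∈ sphere r v (j + 1) := by
  obtain ⟨i, hi, hw⟩ := mem_sphere_of_mem_ball (mem_ball_succ (sphere_subset_ball j hu) h)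
  have h1 : j ≤ i + 1 := by
    by_contra hlt
    exact notMem_ball_of_mem_sphere (by omega) hu
      (mem_ball_succ (sphere_subset_ball i hw) (hsymm _ _ h))
  have h2 : i = j - 1 ∨ i = j ∨ i = j + 1 := by omega
  rcases h2 with rfl | rfl | rfl
  · exact Or.inl hw
  · exact Or.inr (Or.inl hw)
  · exact Or.inr (Or.inr hw)

theorem pairs_symm (hsymm : ∀ a b, r a b → r b a) (A B : Finset V) :
    pairs r A B = pairs r B A := by
  rw [pairs_eq_sum_right]
  unfold pairs
  refine Finset.sum_congr rfl fun b _ => ?_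
  congr 1
  ext a
  simp only [mem_filter]
  exact ⟨fun h => ⟨h.1, hsymm _ _ h.2⟩, fun h => ⟨h.1, hsymm _ _ h.2⟩⟩

/-- The expansion of the layers around a vertex of `A` in a bipartite graph without cycles of
length `2 k`, whose degrees are at least `p` on the side `A` and at least `q` on the side `B`. -/
theorem pow_le_pairs_of_min_degree {k : ℕ}
    (hfree : ¬ (SimpleGraph.cycleGraph (2 * k)).IsContained G)
    (hr : ∀ a b, r a b → G.Adj a b) (hsymm : ∀ a b, r a b → r b a) {A B : Finset V}
    (hAB : Disjoint A B) (hbip : ∀ a b, r a b → (a ∈ A ∧ b ∈ B) ∨ (a ∈ B ∧ b ∈ A))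
    {p q s : ℝ} (hp : ∀ a ∈ A, p ≤ #{b | r a b}) (hq : ∀ b ∈ B, q ≤ #{a | r b a})
    (hqc : 6 * (2 * k + 4) ≤ q) (hqp : q ≤ p) (hs : 0 ≤ s) (hpq : s ^ 2 ≤ p * q)
    (hv : v ∈ A) :
    s ^ (k + 1) ≤ (2 * (2 * k + 4)) ^ k * pairs r A B := by
  set c : ℝ := 2 * k + 4 with hc
  have hcpos : 0 < c := by positivity
  let L := sphere r v
  -- The degree bound in layer j: even layers lie in A and odd ones in B.
  let P : ℕ → ℝ := fun j => if Even j then p else q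
  have hside : ∀ j, (Even j → L j ⊆ A) ∧ (¬ Even j → L j ⊆ B) := by
    intro j
    induction j with
    | zero => exact ⟨fun _ => by simpa [L, sphere] using hv, fun h => absurd Even.zero h⟩
    | succ j ih =>
      refine ⟨fun h u hu => ?_, fun h u hu => ?_⟩
      · obtain ⟨w, hw, hwu⟩ := exists_parent hu
        have h1 : ¬ Even j := by rwa [Nat.even_add_one] at h
        rcases hbip _ _ hwu with h2 | h2
        · exact absurd (ih.2 h1 hw) (Finset.disjoint_left.1 hAB h2.1)
        · exact h2.2
      · obtain ⟨w, hw, hwu⟩ := exists_parent hu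
        have h1 : Even j := by rwa [Nat.even_add_one, not_not] at h
        rcases hbip _ _ hwu with h2 | h2
        · exact h2.2
        · exact absurd h2.1 (Finset.disjoint_left.1 hAB (ih.1 h1 hw))
  have hPdeg : ∀ j, ∀ u ∈ L j, P j ≤ #{w | r u w} := by
    intro j u hu
    by_cases h : Even j
    · simp only [P, h, if_true]; exact hp _ ((hside j).1 h hu)
    · simp only [P, h, if_false]; exact hq _ ((hside j).2 h hu)
  have hPc : ∀ j, 6 * c ≤ P j := by
    intro j
    by_cases h : Even j
    · simp only [P, h, if_true]; linarith
    · simp only [P, h, if_false]; linarith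
  have hnosame : ∀ j u w, u ∈ L j → w ∈ L j → ¬ r u w := by
    intro j u w hu hw huw
    by_cases h : Even j
    · have h1 := (hside j).1 h hu
      have h2 := (hside j).1 h hw
      rcases hbip _ _ huw with h3 | h3
      · exact Finset.disjoint_left.1 hAB h2 h3.2
      · exact Finset.disjoint_left.1 hAB h1 h3.1
    · have h1 := (hside j).2 h hu
      have h2 := (hside j).2 h hw
      rcases hbip _ _ huw with h3 | h3
      · exact Finset.disjoint_left.1 hAB h3.1 h1
      · exact Finset.disjoint_left.1 hAB h3.2 h2
  -- A single parent function must serve all layers. It exists because u lies in at most one of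
  -- them.
  have hparent : ∀ u, ∃ w, ∀ j, u ∈ L (j + 1) → w ∈ L j ∧ G.Adj u w := by
    intro u
    by_cases h : ∃ j, u ∈ L (j + 1)
    · obtain ⟨j, hj⟩ := h
      obtain ⟨w, hw, hwu⟩ := exists_parent hj
      refine ⟨w, fun j' hj' => ?_⟩
      have := sphere_disjoint hj hj'
      obtain rfl : j = j' := by omega
      exact ⟨hw, (hr _ _ hwu).symm⟩
    · exact ⟨u, fun j hj => absurd ⟨j, hj⟩ h⟩
  choose par hpar using hparent
  have hfew : ∀ i, i + 1 ≤ k → (pairs r (L i) (L (i + 1)) : ℝ) ≤ c * (#(L i) + #(L (i + 1))) :=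
    fun i hi => pairs_layers_le hr (L := L) (p := par) (v := v) rfl (fun j u hu => hpar u j hu)
      (fun i j u => sphere_disjoint) hi hfree
  have hdeg1 : ∀ j, P j * #(L j) ≤ ∑ u ∈ L j, (#{w | r u w} : ℝ) := by
    intro j
    rw [mul_comm, ← nsmul_eq_mul]
    exact Finset.card_nsmul_le_sum _ _ _ (hPdeg j)
  have hsplit : ∀ j, ∑ u ∈ L (j + 1), #{w | r u w} ≤
      pairs r (L (j + 1)) (L (j + 2)) + pairs r (L j) (L (j + 1)) := by
    intro j
    rw [pairs_symm hsymm (L j)]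
    unfold pairs
    rw [← Finset.sum_add_distrib]
    refine Finset.sum_le_sum fun u hu => ?_
    refine le_trans (Finset.card_le_card ?_) (Finset.card_union_le _ _)
    intro w hw
    simp only [mem_filter, mem_univ, true_and] at hw
    rcases sphere_of_adj hsymm hu hw with h | h | h
    · exact Finset.mem_union_right _ (Finset.mem_filter.2 ⟨h, hw⟩)
    · exact absurd hw (hnosame _ _ _ hu h)
    · exact Finset.mem_union_left _ (Finset.mem_filter.2 ⟨h, hw⟩)
  have hsplit0 : ∑ u ∈ L 0, #{w | r u w} ≤ pairs r (L 0) (L 1) := by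
    unfold pairs
    refine Finset.sum_le_sum fun u hu => Finset.card_le_card ?_
    intro w hw
    simp only [mem_filter, mem_univ, true_and] at hw
    rcases sphere_of_adj hsymm hu hw with h | h | h
    · exact absurd hw (hnosame _ _ _ hu h)
    · exact absurd hw (hnosame _ _ _ hu h)
    · exact Finset.mem_filter.2 ⟨h, hw⟩
  -- The edges at L j go to L (j-1) and L (j+1), hence P j |L j| ≤ c (|L (j-1)| + 2 |L j| + |L
  -- (j+1)|). By induction and 6c ≤ P (j-1), |L (j-1)| ≤ |L j| / 3. As c |L j| ≤ P j |L j| / 6, the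
  -- terms other than c |L (j+1)| use up less than half of the left-hand side.
  have hgrow : ∀ j, j + 1 ≤ k → P j * #(L j) ≤ 2 * c * #(L (j + 1)) := by
    intro j
    induction j with
    | zero =>
      intro hj
      have h1 := hdeg1 0
      have h2 : (∑ u ∈ L 0, (#{w | r u w} : ℝ)) ≤ pairs r (L 0) (L 1) := by exact_mod_cast hsplit0
      have h3 := hfew 0 hj
      have h4 := mul_le_mul_of_nonneg_right (hPc 0) (Nat.cast_nonneg (α := ℝ) #(L 0))
      have h5 : (0 : ℝ) ≤ c * #(L 0) := by positivity
      simp only [Nat.zero_add] at *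
      nlinarith
    | succ j ih =>
      intro hj
      have h0 := ih (by omega)
      have h1 := hdeg1 (j + 1)
      have h2 : (∑ u ∈ L (j + 1), (#{w | r u w} : ℝ)) ≤
          pairs r (L (j + 1)) (L (j + 2)) + pairs r (L j) (L (j + 1)) := by
        exact_mod_cast hsplit j
      have h3 := hfew (j + 1) hj
      have h3' := hfew j (by omega)
      have h4 := mul_le_mul_of_nonneg_right (hPc (j + 1)) (Nat.cast_nonneg (α := ℝ) #(L (j + 1)))
      have h5 := mul_le_mul_of_nonneg_right (hPc j) (Nat.cast_nonneg (α := ℝ) #(L j))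
      have h6 : (0 : ℝ) ≤ c * #(L (j + 1)) := by positivity
      have h7 : (0 : ℝ) ≤ c * #(L j) := by positivity
      rw [show j + 1 + 1 = j + 2 by ring] at *
      nlinarith
  have hP0 : ∀ j, 0 ≤ P j := fun j => le_trans (by positivity) (hPc j)
  have hprod : ∀ j, j ≤ k → ∏ i ∈ range j, P i ≤ (2 * c) ^ j * #(L j) := by
    intro j
    induction j with
    | zero => intro _; simp [L, sphere]
    | succ j ih =>
      intro hj
      rw [Finset.prod_range_succ]
      calc (∏ i ∈ range j, P i) * P j ≤ ((2 * c) ^ j * #(L j)) * P j :=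
            mul_le_mul_of_nonneg_right (ih (by omega)) (hP0 j)
        _ = (2 * c) ^ j * (P j * #(L j)) := by ring
        _ ≤ (2 * c) ^ j * (2 * c * #(L (j + 1))) :=
            mul_le_mul_of_nonneg_left (hgrow j hj) (by positivity)
        _ = _ := by ring
  have hq0 : 0 ≤ q := le_trans (by positivity) hqc
  have hps : s ≤ p := by nlinarith
  -- The factors come in pairs p, q with pq ≥ s^2. An unpaired last factor is p, and s ≤ p because q
  -- ≤ p; this is why the source must lie on the side of larger degree.
  have hsprod : ∀ j, s ^ (2 * j) ≤ ∏ i ∈ range (2 * j), P i ∧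
      s ^ (2 * j + 1) ≤ ∏ i ∈ range (2 * j + 1), P i := by
    intro j
    induction j with
    | zero => simpa [P] using hps
    | succ j ih =>
      have e1 : s ^ (2 * (j + 1)) ≤ ∏ i ∈ range (2 * (j + 1)), P i := by
        rw [show 2 * (j + 1) = 2 * j + 1 + 1 by ring, Finset.prod_range_succ,
          Finset.prod_range_succ]
        have h1 : P (2 * j) = p := by simp [P]
        have h2 : P (2 * j + 1) = q := by simp [P]
        rw [h1, h2, mul_assoc, show s ^ (2 * j + 1 + 1) = s ^ (2 * j) * s ^ 2 by ring]
        exact mul_le_mul ih.1 hpq (by positivity) (Finset.prod_nonneg fun i _ => hP0 i)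
      refine ⟨e1, ?_⟩
      rw [Finset.prod_range_succ, pow_succ]
      have h1 : P (2 * (j + 1)) = p := by simp [P]
      rw [h1]
      exact mul_le_mul e1 hps hs (Finset.prod_nonneg fun i _ => hP0 i)
  have hsprod' : s ^ (k + 1) ≤ ∏ i ∈ range (k + 1), P i := by
    rcases Nat.even_or_odd' (k + 1) with ⟨j, hj | hj⟩
    · rw [hj]; exact (hsprod j).1
    · rw [hj]; exact (hsprod j).2
  have hlast : P k * #(L k) ≤ pairs r A B := by
    refine (hdeg1 k).trans ?_
    have : ∑ u ∈ L k, #{w | r u w} ≤ pairs r A B := by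
      by_cases h : Even k
      · refine le_trans ?_ (pairs_mono r ((hside k).1 h) subset_rfl)
        unfold pairs
        refine Finset.sum_le_sum fun u hu => Finset.card_le_card fun w hw => ?_
        simp only [mem_filter, mem_univ, true_and] at hw ⊢
        rcases hbip _ _ hw with h1 | h1
        · exact ⟨h1.2, hw⟩
        · exact absurd h1.1 (Finset.disjoint_left.1 hAB ((hside k).1 h hu))
      · rw [pairs_symm hsymm]
        refine le_trans ?_ (pairs_mono r ((hside k).2 h) subset_rfl)
        unfold pairs
        refine Finset.sum_le_sum fun u hu => Finset.card_le_card fun w hw => ?_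
        simp only [mem_filter, mem_univ, true_and] at hw ⊢
        rcases hbip _ _ hw with h1 | h1
        · exact absurd ((hside k).2 h hu) (Finset.disjoint_left.1 hAB h1.1)
        · exact ⟨h1.2, hw⟩
    exact_mod_cast this
  calc s ^ (k + 1) ≤ (∏ i ∈ range k, P i) * P k := by rw [← Finset.prod_range_succ]; exact hsprod'
    _ ≤ ((2 * c) ^ k * #(L k)) * P k := mul_le_mul_of_nonneg_right (hprod k le_rfl) (hP0 k)
    _ = (2 * c) ^ k * (P k * #(L k)) := by ring
    _ ≤ _ := mul_le_mul_of_nonneg_left hlast (by positivity)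

end Growth

/-! ### Edges between two sets under a degree cap. -/

section Extremal
variable {V : Type*} [Fintype V] [DecidableEq V] {G : SimpleGraph V}

/-- The number of edges between two disjoint sets in a graph without cycles of length `2 k` that
has at most `D ^ (k + 1)` edges and degrees at most `D ^ 2`. -/
theorem pairs_sq_le {k D : ℕ} (hD : 1 ≤ D)
    (hfree : ¬ (SimpleGraph.cycleGraph (2 * k)).IsContained G)
    {r : V → V → Prop} [DecidableRel r] (hr : ∀ a b, r a b → G.Adj a b) {A B : Finset V}
    (hAB : Disjoint A B) (hA : ∀ a ∈ A, #{b ∈ B | r a b} ≤ D ^ 2)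
    (hB : ∀ b ∈ B, #{a ∈ A | r a b} ≤ D ^ 2) (he : pairs r A B ≤ D ^ (k + 1)) :
    (pairs r A B : ℝ) ^ 2 ≤ (16 * (2 * k + 4) * D) ^ 2 * (#A * #B) := by
  by_contra hcon
  push Not at hcon
  set c : ℝ := 2 * k + 4 with hc
  have hc4 : 4 ≤ c := by rw [hc]; have : (0 : ℝ) ≤ k := by positivity
                         linarith
  set e : ℝ := (pairs r A B : ℝ) with he_def
  have hD1 : (1 : ℝ) ≤ D := by exact_mod_cast hD
  have he0 : 0 < e := by
    rcases (Nat.cast_nonneg (α := ℝ) (pairs r A B)).lt_or_eq with h | h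
    · exact h
    · rw [he_def, ← h] at hcon
      have h0 : (0 : ℝ) ≤ (16 * c * D) ^ 2 * (#A * #B) := by positivity
      rw [zero_pow two_ne_zero] at hcon
      exact absurd hcon (not_lt.2 h0)
  have heA : e ≤ #A * (D : ℝ) ^ 2 := by
    have : pairs r A B ≤ #A * D ^ 2 := Finset.sum_le_card_nsmul _ _ _ hA
    rw [he_def]; exact_mod_cast this
  have heB : e ≤ #B * (D : ℝ) ^ 2 := by
    have : pairs r A B ≤ #B * D ^ 2 := by
      rw [pairs_eq_sum_right]; exact Finset.sum_le_card_nsmul _ _ _ hB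
    rw [he_def]; exact_mod_cast this
  have hA0 : (0 : ℝ) < #A := by
    by_contra h
    have : (#A : ℝ) = 0 := le_antisymm (not_lt.1 h) (by positivity)
    rw [this] at heA; linarith
  have hB0 : (0 : ℝ) < #B := by
    by_contra h
    have : (#B : ℝ) = 0 := le_antisymm (not_lt.1 h) (by positivity)
    rw [this] at heB; linarith
  set α := e / #A with hα
  set β := e / #B with hβ
  have hα0 : 0 < α := by positivity
  have hβ0 : 0 < β := by positivity
  have hαD : α ≤ (D : ℝ) ^ 2 := by rw [hα, div_le_iff₀ hA0]; linarith
  have hβD : β ≤ (D : ℝ) ^ 2 := by rw [hβ, div_le_iff₀ hB0]; linarith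
  have hprod : (16 * c * D) ^ 2 < α * β := by
    rw [hα, hβ, div_mul_div_comm, lt_div_iff₀ (by positivity)]
    linarith
  -- The cap D^2 on one average degree makes the other exceed (16c)^2, which supplies the lower
  -- bound 6c needed for the expansion.
  have hbig : ∀ x y : ℝ, 0 < x → y ≤ (D : ℝ) ^ 2 → (16 * c * D) ^ 2 < x * y →
      6 * c ≤ x / 4 := by
    intro x y hx hy hxy
    have h1 : (16 * c * D) ^ 2 < x * (D : ℝ) ^ 2 := hxy.trans_le (mul_le_mul_of_nonneg_left hy hx.le)
    have h2 : (16 * c) ^ 2 < x := by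
      rw [mul_pow] at h1
      exact lt_of_mul_lt_mul_right h1 (by positivity)
    nlinarith
  have hα6 := hbig α β hα0 hβD hprod
  have hβ6 := hbig β α hβ0 hαD (by rwa [mul_comm β])
  -- Both α |A| and β |B| equal e, so a quarter of each average degree uses up only e / 2 pairs.
  obtain ⟨A', hA', B', hB', ⟨a₀, ha₀⟩, ⟨b₀, hb₀⟩, hAd, hBd⟩ := exists_min_degree_part r A B
    (α / 4) (β / 4) (by positivity) (by positivity) (by
      have h1 : α * #A = e := by rw [hα]; field_simp
      have h2 : β * #B = e := by rw [hβ]; field_simp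
      rw [← he_def]
      linarith)
  have hAB' : Disjoint A' B' := Finset.disjoint_of_subset_left hA'
    (Finset.disjoint_of_subset_right hB' hAB)
  let H : V → V → Prop := fun u w => (u ∈ A' ∧ w ∈ B' ∧ r u w) ∨ (u ∈ B' ∧ w ∈ A' ∧ r w u)
  have hHG : ∀ a b, H a b → G.Adj a b := by
    rintro a b (h | h)
    · exact hr _ _ h.2.2
    · exact (hr _ _ h.2.2).symm
  have hHs : ∀ a b, H a b → H b a := by
    rintro a b (h | h)
    · exact Or.inr ⟨h.2.1, h.1, h.2.2⟩
    · exact Or.inl ⟨h.2.1, h.1, h.2.2⟩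
  have hHb : ∀ a b, H a b → (a ∈ A' ∧ b ∈ B') ∨ (a ∈ B' ∧ b ∈ A') := by
    rintro a b (h | h)
    · exact Or.inl ⟨h.1, h.2.1⟩
    · exact Or.inr ⟨h.1, h.2.1⟩
  have hHA : ∀ a ∈ A', α / 4 ≤ #{b | H a b} := by
    intro a ha
    refine (hAd a ha).trans ?_
    exact_mod_cast Finset.card_le_card fun b hb => by
      rw [Finset.mem_filter] at hb
      exact Finset.mem_filter.2 ⟨mem_univ _, Or.inl ⟨ha, hb⟩⟩
  have hHB : ∀ b ∈ B', β / 4 ≤ #{a | H b a} := by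
    intro b hb
    refine (hBd b hb).trans ?_
    exact_mod_cast Finset.card_le_card fun a ha => by
      rw [Finset.mem_filter] at ha
      exact Finset.mem_filter.2 ⟨mem_univ _, Or.inr ⟨hb, ha⟩⟩
  have hHe : pairs H A' B' ≤ D ^ (k + 1) := by
    refine le_trans ?_ ((pairs_mono r hA' hB').trans he)
    refine Finset.sum_le_sum fun a ha => Finset.card_le_card fun b hb => ?_
    rw [Finset.mem_filter] at hb ⊢
    rcases hb.2 with h | h
    · exact ⟨hb.1, h.2.2⟩
    · exact absurd h.1 (Finset.disjoint_left.1 hAB' ha)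
  have hs : (4 * c * D) ^ 2 ≤ α / 4 * (β / 4) := by nlinarith
  -- The layers are grown from the side with the larger minimum degree.
  have hfin : (4 * c * D) ^ (k + 1) ≤ (2 * c) ^ k * pairs H A' B' := by
    rcases le_total β α with h | h
    · exact pow_le_pairs_of_min_degree hfree hHG hHs hAB' hHb hHA hHB hβ6 (by linarith)
        (by positivity) hs ha₀
    · rw [pairs_symm hHs]
      exact pow_le_pairs_of_min_degree hfree hHG hHs hAB'.symm (fun a b hab => (hHb a b hab).symm)
        hHB hHA hα6 (by linarith) (by positivity) (by rwa [mul_comm (β / 4)]) hb₀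
  have hHe' : (pairs H A' B' : ℝ) ≤ (D : ℝ) ^ (k + 1) := by exact_mod_cast hHe
  have h1 : (2 * c) ^ k * (pairs H A' B' : ℝ) ≤ (2 * c) ^ k * (D : ℝ) ^ (k + 1) :=
    mul_le_mul_of_nonneg_left hHe' (by positivity)
  have h2 : (2 * c) ^ k * (D : ℝ) ^ (k + 1) < (4 * c * D) ^ (k + 1) := by
    rw [mul_pow (4 * c)]
    refine mul_lt_mul_of_pos_right ?_ (by positivity)
    calc (2 * c) ^ k ≤ (4 * c) ^ k := pow_le_pow_left₀ (by positivity) (by linarith) k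
      _ < (4 * c) ^ (k + 1) := pow_lt_pow_right₀ (by linarith) (by omega)
  linarith

end Extremal

/-! ### From edge counts to an operator norm by dyadic levels. -/

section Dyadic

/-- For x > 0 the sum is 2^(⌊log₂ x⌋ + 1) - 1. It serves as a layer-cake upper bound for integer
weights. -/
theorem le_sum_two_pow {J x : ℕ} (hx : x < 2 ^ J) :
    x ≤ ∑ j ∈ range J, if 2 ^ j ≤ x then 2 ^ j else 0 := by
  induction J with
  | zero => simp at hx; simp [hx]
  | succ J ih =>
    rw [Finset.sum_range_succ]
    by_cases h : 2 ^ J ≤ x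
    · have h1 : ∑ j ∈ range J, (if 2 ^ j ≤ x then 2 ^ j else 0) = ∑ j ∈ range J, 2 ^ j :=
        Finset.sum_congr rfl fun j hj => if_pos
          ((Nat.pow_le_pow_right two_pos (Finset.mem_range.1 hj).le).trans h)
      have h2 := Nat.geomSum_eq (le_refl 2) J
      have h3 := Nat.one_le_two_pow (n := J)
      rw [h1, if_pos h, h2]
      simp only [pow_succ] at hx
      simp
      omega
    · exact (ih (by omega)).trans (Nat.le_add_right _ _)

/-- A geometric sum whose last term is at most x^2. Replacing a weight by its dyadic levels
therefore costs only a constant in the square norm. -/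
theorem sum_four_pow_le (J x : ℕ) :
    3 * ∑ j ∈ range J, (if 2 ^ j ≤ x then 4 ^ j else 0) ≤ 4 * x ^ 2 := by
  induction J with
  | zero => simp
  | succ J ih =>
    rw [Finset.sum_range_succ]
    by_cases h : 2 ^ J ≤ x
    · have h1 : ∑ j ∈ range J, (if 2 ^ j ≤ x then 4 ^ j else 0) ≤ ∑ j ∈ range J, 4 ^ j :=
        Finset.sum_le_sum fun j _ => by split_ifs <;> simp
      have h2 : 3 * ∑ j ∈ range J, 4 ^ j ≤ 4 ^ J := by
        clear ih h h1
        induction J with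
        | zero => simp
        | succ J ih => rw [Finset.sum_range_succ, pow_succ]; omega
      have h3 : 4 ^ J ≤ x ^ 2 := by
        calc 4 ^ J = (2 ^ J) ^ 2 := by rw [← pow_mul, mul_comm, pow_mul]; norm_num
          _ ≤ _ := Nat.pow_le_pow_left h 2
      rw [if_pos h]
      omega
    · rw [if_neg h]; omega

end Dyadic

section Norm
variable {V : Type*} [Fintype V]

/-- Cauchy–Schwarz over the J levels, followed by exchanging the sums over levels and points and
applying `sum_four_pow_le`. -/
theorem sum_two_pow_sqrt_le (J : ℕ) (x : V → ℕ) :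
    (∑ j ∈ range J, (2 : ℝ) ^ j * √(#{b | 2 ^ j ≤ x b} : ℝ)) ^ 2 ≤
      2 * J * ∑ b, (x b : ℝ) ^ 2 := by
  have h1 := Finset.sum_mul_sq_le_sq_mul_sq (range J) (fun _ => (1 : ℝ))
    (fun j => (2 : ℝ) ^ j * √(#{b | 2 ^ j ≤ x b} : ℝ))
  simp only [one_mul, one_pow, Finset.sum_const, card_range, nsmul_eq_mul, mul_one] at h1
  refine h1.trans ?_
  rw [mul_comm 2, mul_assoc]
  refine mul_le_mul_of_nonneg_left ?_ (by positivity)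
  have h2 : ∑ j ∈ range J, ((2 : ℝ) ^ j * √(#{b | 2 ^ j ≤ x b} : ℝ)) ^ 2 =
      ((∑ b, ∑ j ∈ range J, if 2 ^ j ≤ x b then 4 ^ j else 0 : ℕ) : ℝ) := by
    rw [Finset.sum_comm]
    push_cast
    refine Finset.sum_congr rfl fun j _ => ?_
    rw [mul_pow, Real.sq_sqrt (by positivity), ← pow_mul, mul_comm j, pow_mul,
      Finset.card_filter]
    push_cast
    rw [Finset.mul_sum]
    refine Finset.sum_congr rfl fun b _ => ?_
    split_ifs <;> norm_num
  rw [h2, Finset.mul_sum]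
  push_cast
  refine Finset.sum_le_sum fun b _ => ?_
  have h3 := sum_four_pow_le J (x b)
  have h4 : (3 : ℝ) * ∑ j ∈ range J, (if 2 ^ j ≤ x b then 4 ^ j else 0) ≤ 4 * (x b : ℝ) ^ 2 := by
    exact_mod_cast h3
  nlinarith [sq_nonneg (x b : ℝ)]

/-- A bound for the number of pairs between arbitrary sets bounds the bilinear form of a
relation, up to a logarithmic factor. -/
theorem bilinear_sq_le {r : V → V → Prop} [DecidableRel r] {Λ : ℝ}
    (hr : ∀ A B : Finset V, (pairs r A B : ℝ) ≤ Λ * (√(#A : ℝ) * √(#B : ℝ)))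
    {J : ℕ} {x y : V → ℕ} (hx : ∀ b, x b < 2 ^ J) (hy : ∀ a, y a < 2 ^ J) :
    (∑ a, (y a : ℝ) * ∑ b with r a b, (x b : ℝ)) ^ 2 ≤
      (2 * J * Λ) ^ 2 * ((∑ a, (y a : ℝ) ^ 2) * ∑ b, (x b : ℝ) ^ 2) := by
  let S : (V → ℕ) → ℝ := fun x => ∑ j ∈ range J, (2 : ℝ) ^ j * √(#{b | 2 ^ j ≤ x b} : ℝ)
  -- Both weights are replaced by sums over their superlevel sets, which turns the form into pair
  -- counts between such sets.
  have hbound : ∑ a, y a * ∑ b with r a b, x b ≤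
      ∑ i ∈ range J, ∑ j ∈ range J, 2 ^ i * 2 ^ j *
        pairs r {a | 2 ^ i ≤ y a} {b | 2 ^ j ≤ x b} := by
    calc ∑ a, y a * ∑ b with r a b, x b
        ≤ ∑ a, (∑ i ∈ range J, if 2 ^ i ≤ y a then 2 ^ i else 0) *
            ∑ b with r a b, ∑ j ∈ range J, if 2 ^ j ≤ x b then 2 ^ j else 0 :=
          Finset.sum_le_sum fun a _ => Nat.mul_le_mul (le_sum_two_pow (hy a))
            (Finset.sum_le_sum fun b _ => le_sum_two_pow (hx b))
      _ = _ := by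
          simp_rw [Finset.sum_mul]
          rw [Finset.sum_comm]
          refine Finset.sum_congr rfl fun i _ => ?_
          have h1 : ∀ j, 2 ^ i * 2 ^ j * pairs r {a | 2 ^ i ≤ y a} {b | 2 ^ j ≤ x b} =
              ∑ a, (if 2 ^ i ≤ y a then 2 ^ i else 0) *
                ∑ b with r a b, if 2 ^ j ≤ x b then 2 ^ j else 0 := by
            intro j
            unfold pairs
            rw [Finset.sum_filter, Finset.mul_sum]
            refine Finset.sum_congr rfl fun a _ => ?_
            split_ifs with h
            · rw [mul_assoc, Finset.filter_filter, ← Finset.sum_filter, Finset.filter_filter,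
                Finset.sum_const, smul_eq_mul, mul_comm (2 ^ j)]
              simp_rw [and_comm]
            · simp
          simp_rw [h1]
          rw [Finset.sum_comm]
          refine Finset.sum_congr rfl fun a _ => ?_
          rw [← Finset.mul_sum, Finset.sum_comm]
  have hbound' : ∑ a, (y a : ℝ) * ∑ b with r a b, (x b : ℝ) ≤ Λ * (S y * S x) := by
    calc ∑ a, (y a : ℝ) * ∑ b with r a b, (x b : ℝ)
        ≤ ∑ i ∈ range J, ∑ j ∈ range J, (2 : ℝ) ^ i * 2 ^ j *
            pairs r {a | 2 ^ i ≤ y a} {b | 2 ^ j ≤ x b} := by exact_mod_cast hbound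
      _ ≤ ∑ i ∈ range J, ∑ j ∈ range J, (2 : ℝ) ^ i * 2 ^ j *
            (Λ * (√(#{a | 2 ^ i ≤ y a} : ℝ) * √(#{b | 2 ^ j ≤ x b} : ℝ))) :=
          Finset.sum_le_sum fun i _ => Finset.sum_le_sum fun j _ =>
            mul_le_mul_of_nonneg_left (hr _ _) (by positivity)
      _ = _ := by
          simp only [S]
          rw [Finset.sum_mul_sum, Finset.mul_sum]
          refine Finset.sum_congr rfl fun i _ => ?_
          rw [Finset.mul_sum]
          exact Finset.sum_congr rfl fun j _ => by ring
  have h0 : 0 ≤ ∑ a, (y a : ℝ) * ∑ b with r a b, (x b : ℝ) := by positivity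
  calc (∑ a, (y a : ℝ) * ∑ b with r a b, (x b : ℝ)) ^ 2 ≤ (Λ * (S y * S x)) ^ 2 :=
        pow_le_pow_left₀ h0 hbound' 2
    _ = Λ ^ 2 * (S y ^ 2 * S x ^ 2) := by ring
    _ ≤ Λ ^ 2 * ((2 * J * ∑ a, (y a : ℝ) ^ 2) * (2 * J * ∑ b, (x b : ℝ) ^ 2)) :=
        mul_le_mul_of_nonneg_left (mul_le_mul (sum_two_pow_sqrt_le J y) (sum_two_pow_sqrt_le J x)
          (sq_nonneg _) (by positivity)) (sq_nonneg _)
    _ = _ := by ring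

/-- The weighted number of walks of length `i` along `r` from `a`, with weight `z` at the end. -/
def walkSum (r : V → V → Prop) [DecidableRel r] (z : V → ℕ) : ℕ → V → ℕ
  | 0, a => z a
  | i + 1, a => ∑ b with r a b, walkSum r z i b

/-- This crude bound serves only to limit the number of dyadic levels. -/
theorem walkSum_le (r : V → V → Prop) [DecidableRel r] {z : V → ℕ} {B : ℕ} (hz : ∀ a, z a ≤ B)
    (i : ℕ) (a : V) : walkSum r z i a ≤ Fintype.card V ^ i * B := by
  induction i generalizing a with
  | zero => simpa [walkSum] using hz a
  | succ i ih =>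
    calc walkSum r z (i + 1) a ≤ ∑ _b : V, Fintype.card V ^ i * B :=
          (Finset.sum_le_sum_of_subset (Finset.filter_subset _ _)).trans
            (Finset.sum_le_sum fun b _ => ih b)
      _ = _ := by simp [pow_succ]; ring

/-- Writing M for the operator of `r`, the bilinear bound for M^(i+1) z and M^i z gives ‖M^(i+1)
z‖^2 ≤ 2JΛ ‖M^(i+1) z‖ ‖M^i z‖. Cancelling one factor and iterating bounds ‖M^i z‖, and
Cauchy–Schwarz against z concludes. -/
theorem sum_walkSum_le {r : V → V → Prop} [DecidableRel r] {Λ : ℝ} (hΛ : 0 ≤ Λ)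
    (hr : ∀ A B : Finset V, (pairs r A B : ℝ) ≤ Λ * (√(#A : ℝ) * √(#B : ℝ)))
    {z : V → ℕ} {J k : ℕ} (hJ : ∀ i < k, ∀ a, walkSum r z i a < 2 ^ J) {i : ℕ} (hi : i < k) :
    (∑ a, (z a : ℝ) * walkSum r z i a) ≤ (2 * J * Λ) ^ i * ∑ a, (z a : ℝ) ^ 2 := by
  have hnorm : ∀ i < k, ∑ a, (walkSum r z i a : ℝ) ^ 2 ≤
      ((2 * J * Λ) ^ 2) ^ i * ∑ a, (z a : ℝ) ^ 2 := by
    intro i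
    induction i with
    | zero => intro _; simp [walkSum]
    | succ i ih =>
      intro hi
      have h1 := bilinear_sq_le hr (hJ i (by omega)) (hJ (i + 1) hi)
      have h2 : ∑ a, (walkSum r z (i + 1) a : ℝ) * ∑ b with r a b, (walkSum r z i b : ℝ) =
          ∑ a, (walkSum r z (i + 1) a : ℝ) ^ 2 := by
        refine Finset.sum_congr rfl fun a _ => ?_
        rw [sq]
        congr 1
        simp [walkSum]
      rw [h2] at h1
      set N := ∑ a, (walkSum r z (i + 1) a : ℝ) ^ 2 with hN
      have hN0 : 0 ≤ N := by positivity
      have h3 : N ≤ (2 * J * Λ) ^ 2 * ∑ b, (walkSum r z i b : ℝ) ^ 2 := by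
        rcases hN0.lt_or_eq with h | h
        · have h4 : N * N ≤ N * ((2 * J * Λ) ^ 2 * ∑ b, (walkSum r z i b : ℝ) ^ 2) := by
            linarith [h1]
          exact le_of_mul_le_mul_left h4 h
        · rw [← h]; positivity
      calc N ≤ _ := h3
        _ ≤ (2 * J * Λ) ^ 2 * (((2 * J * Λ) ^ 2) ^ i * ∑ a, (z a : ℝ) ^ 2) :=
            mul_le_mul_of_nonneg_left (ih (by omega)) (sq_nonneg _)
        _ = _ := by ring
  have h1 := Finset.sum_mul_sq_le_sq_mul_sq univ (fun a => (z a : ℝ)) (fun a => (walkSum r z i a : ℝ))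
  have h2 : (∑ a, (z a : ℝ) * walkSum r z i a) ^ 2 ≤
      ((2 * J * Λ) ^ i * ∑ a, (z a : ℝ) ^ 2) ^ 2 := by
    refine h1.trans ?_
    calc _ ≤ (∑ a, (z a : ℝ) ^ 2) * (((2 * J * Λ) ^ 2) ^ i * ∑ a, (z a : ℝ) ^ 2) :=
          mul_le_mul_of_nonneg_left (hnorm i hi) (by positivity)
      _ = _ := by rw [← pow_mul, mul_comm 2 i, pow_mul]; ring
  exact le_of_sq_le_sq h2 (by positivity)

end Norm

/-! ### The total cost of degree-capped searches. -/

section Scans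
variable {V : Type*} [Fintype V] [DecidableEq V] (G : SimpleGraph V) [DecidableRel G.Adj]

/-- An edge from `a` to `b` that leads to the next colour and to a vertex of degree at most `t`. -/
def Advance (col : V → ℕ) (t : ℕ) (a b : V) : Prop :=
  G.Adj a b ∧ col b = col a + 1 ∧ G.degree b ≤ t

/-- `u` can be reached from `v` along edges leading to the next colour, through vertices whose
degrees are at most that of `v` and whose colours are less than `k`. -/
def Reach (col : V → ℕ) (k : ℕ) (v u : V) : Prop :=
  Relation.ReflTransGen (fun a b => Advance G col (G.degree v) a b ∧ col b < k) v u

open Classical in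
/-- The sum of the degrees of the vertices reachable from `v`. -/
noncomputable def scanCost (col : V → ℕ) (k : ℕ) (v : V) : ℕ :=
  ∑ u with Reach G col k v u, G.degree u

/-- Adjacency of vertices of degree at most `D ^ 2` whose colours have different parity. -/
def LightAdj (col : V → ℕ) (D : ℕ) (a b : V) : Prop :=
  G.Adj a b ∧ col a % 2 ≠ col b % 2 ∧ G.degree a ≤ D ^ 2 ∧ G.degree b ≤ D ^ 2

instance (col : V → ℕ) (D : ℕ) : DecidableRel (LightAdj G col D) := fun _ _ =>
  inferInstanceAs (Decidable (_ ∧ _))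

variable {G}

theorem sum_biUnion_le_sum {ι : Type*} [DecidableEq ι] (s : Finset ι) (t : ι → Finset V)
    (f : V → ℕ) : ∑ u ∈ s.biUnion t, f u ≤ ∑ i ∈ s, ∑ u ∈ t i, f u := by
  induction s using Finset.induction_on with
  | empty => simp
  | insert i s hi ih =>
    rw [Finset.biUnion_insert, Finset.sum_insert hi]
    have h1 := Finset.sum_union_inter (s₁ := t i) (s₂ := s.biUnion t) (f := f)
    omega

/-- Disjointness prevents an edge from being counted in both orientations. -/
theorem pairs_le_card_edges (r : V → V → Prop) [DecidableRel r] (hr : ∀ a b, r a b → G.Adj a b)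
    {A B : Finset V} (hAB : Disjoint A B) : pairs r A B ≤ #G.edgeFinset := by
  have h1 : pairs r A B = #((A ×ˢ B).filter fun p => r p.1 p.2) := by
    rw [Finset.card_filter, Finset.sum_product]
    exact Finset.sum_congr rfl fun a _ => Finset.card_filter _ _
  rw [h1]
  refine Finset.card_le_card_of_injOn (fun p => s(p.1, p.2)) ?_ ?_
  · intro p hp
    simp only [coe_filter, mem_product, Set.mem_ofPred_eq] at hp
    simpa using hr _ _ hp.2
  · intro p hp q hq h
    simp only [coe_filter, mem_product, Set.mem_ofPred_eq] at hp hq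
    simp only [Sym2.eq_iff] at h
    rcases h with h | h
    · exact Prod.ext h.1 h.2
    · exact absurd (h.1 ▸ hp.1.1) (Finset.disjoint_right.1 hAB hq.1.2)

/-- `pairs_sq_le` needs disjoint sets, while superlevel sets may overlap. Light edges join opposite
colour parities, so splitting A and B by parity gives two disjoint pairs, whence the factor 2. -/
theorem pairs_light_le {k D : ℕ} (hD : 1 ≤ D)
    (hfree : ¬ (SimpleGraph.cycleGraph (2 * k)).IsContained G) (hm : #G.edgeFinset ≤ D ^ (k + 1))
    (col : V → ℕ) (A B : Finset V) :
    (pairs (LightAdj G col D) A B : ℝ) ≤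
      (2 * (16 * (2 * k + 4) * D)) * (√(#A : ℝ) * √(#B : ℝ)) := by
  set r := LightAdj G col D with hr
  have hrG : ∀ a b, r a b → G.Adj a b := fun a b h => h.1
  have hd : ∀ (X : Finset V) a, #{b ∈ X | r a b} ≤ D ^ 2 := by
    intro X a
    by_cases ha : G.degree a ≤ D ^ 2
    · refine le_trans (Finset.card_le_card ?_) ha
      intro b hb
      simpa using (Finset.mem_filter.1 hb).2.1
    · rw [Finset.card_eq_zero.2]
      · positivity
      · exact Finset.filter_eq_empty_iff.2 fun b _ h => ha h.2.2.1
  have hd' : ∀ (X : Finset V) b, #{a ∈ X | r a b} ≤ D ^ 2 := by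
    intro X b
    refine le_trans (Finset.card_le_card ?_) (hd X b)
    intro a ha
    rw [Finset.mem_filter] at ha ⊢
    exact ⟨ha.1, ha.2.1.symm, ha.2.2.1.symm, ha.2.2.2.2, ha.2.2.2.1⟩
  have hone : ∀ X Y : Finset V, Disjoint X Y → X ⊆ A → Y ⊆ B → (pairs r X Y : ℝ) ≤
      (16 * (2 * k + 4) * D) * (√(#A : ℝ) * √(#B : ℝ)) := by
    intro X Y hXY hX hY
    have h1 := pairs_sq_le hD hfree hrG hXY (fun a _ => hd Y a) (fun b _ => hd' X b)
      ((pairs_le_card_edges r hrG hXY).trans hm)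
    have hXA : (#X : ℝ) ≤ #A := by exact_mod_cast Finset.card_le_card hX
    have hYB : (#Y : ℝ) ≤ #B := by exact_mod_cast Finset.card_le_card hY
    refine le_of_sq_le_sq (h1.trans ?_) (by positivity)
    rw [mul_pow _ (√(#A : ℝ) * √(#B : ℝ)), mul_pow (√(#A : ℝ)), Real.sq_sqrt (by positivity),
      Real.sq_sqrt (by positivity)]
    exact mul_le_mul_of_nonneg_left (mul_le_mul hXA hYB (by positivity) (by positivity))
      (by positivity)
  have hsplit : pairs r A B ≤ pairs r {a ∈ A | col a % 2 = 0} {b ∈ B | ¬ col b % 2 = 0} +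
      pairs r {a ∈ A | ¬ col a % 2 = 0} {b ∈ B | col b % 2 = 0} := by
    unfold pairs
    rw [← Finset.sum_filter_add_sum_filter_not A (fun a => col a % 2 = 0)]
    refine Nat.add_le_add ?_ ?_ <;>
    · refine Finset.sum_le_sum fun a ha => Finset.card_le_card fun b hb => ?_
      simp only [mem_filter] at ha hb ⊢
      have := hb.2.2.1
      refine ⟨⟨hb.1, by omega⟩, hb.2⟩
  have h1 := hone {a ∈ A | col a % 2 = 0} {b ∈ B | ¬ col b % 2 = 0}
    (Finset.disjoint_left.2 fun a ha hb => (Finset.mem_filter.1 hb).2 (Finset.mem_filter.1 ha).2)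
    (Finset.filter_subset _ _) (Finset.filter_subset _ _)
  have h2 := hone {a ∈ A | ¬ col a % 2 = 0} {b ∈ B | col b % 2 = 0}
    (Finset.disjoint_left.2 fun a ha hb => (Finset.mem_filter.1 ha).2 (Finset.mem_filter.1 hb).2)
    (Finset.filter_subset _ _) (Finset.filter_subset _ _)
  have h3 : (pairs r A B : ℝ) ≤ pairs r {a ∈ A | col a % 2 = 0} {b ∈ B | ¬ col b % 2 = 0} +
      pairs r {a ∈ A | ¬ col a % 2 = 0} {b ∈ B | col b % 2 = 0} := by exact_mod_cast hsplit
  linarith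

open Classical in
/-- The vertices reached from `a` by a walk of `i` advancing edges. -/
noncomputable def reachLayer (G : SimpleGraph V) [DecidableRel G.Adj] (col : V → ℕ) (t : ℕ) :
    ℕ → V → Finset V
  | 0, a => {a}
  | i + 1, a => (univ.filter fun b => Advance G col t a b).biUnion (reachLayer G col t i)

/-- A reached vertex counts once on the left and once for every walk to it on the right. -/
theorem sum_reachLayer_le {col : V → ℕ} {t D : ℕ} (ht : t ≤ D ^ 2) (z : V → ℕ) (i : ℕ) (a : V)
    (ha : G.degree a ≤ D ^ 2) :
    ∑ u ∈ reachLayer G col t i a, z u ≤ walkSum (LightAdj G col D) z i a := by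
  classical
  induction i generalizing a with
  | zero => simp [reachLayer, walkSum]
  | succ i ih =>
    simp only [reachLayer, walkSum]
    calc _ ≤ ∑ b with Advance G col t a b, ∑ u ∈ reachLayer G col t i b, z u :=
          sum_biUnion_le_sum _ _ _
      _ ≤ ∑ b with Advance G col t a b, walkSum (LightAdj G col D) z i b :=
          Finset.sum_le_sum fun b hb => ih b ((Finset.mem_filter.1 hb).2.2.2.trans ht)
      _ ≤ _ := by
          refine Finset.sum_le_sum_of_subset fun b hb => ?_
          simp only [mem_filter, mem_univ, true_and] at hb ⊢
          obtain ⟨h1, h2, h3⟩ := hb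
          exact ⟨h1, by omega, ha, h3.trans ht⟩

/-- Each step raises the colour by one, so the colour difference is the number of steps. -/
theorem Reach.mem_reachLayer {col : V → ℕ} {k : ℕ} {v u : V} (h : Reach G col k v u) :
    (col u < k ∨ u = v) ∧ col v ≤ col u ∧
      u ∈ reachLayer G col (G.degree v) (col u - col v) v := by
  have key : ∀ a, Relation.ReflTransGen
      (fun a b => Advance G col (G.degree v) a b ∧ col b < k) a u →
      (col u < k ∨ u = a) ∧ col a ≤ col u ∧
        u ∈ reachLayer G col (G.degree v) (col u - col a) a := by
    intro a h
    induction h using Relation.ReflTransGen.head_induction_on with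
    | refl => simp [reachLayer]
    | @head a b hab _ ih =>
      obtain ⟨⟨h1, h2, h3⟩, h4⟩ := hab
      obtain ⟨i1, i2, i3⟩ := ih
      refine ⟨Or.inl ?_, by omega, ?_⟩
      · rcases i1 with h | h
        · exact h
        · exact h ▸ h4
      · rw [show col u - col a = (col u - col b) + 1 by omega]
        simp only [reachLayer, mem_biUnion, mem_filter, mem_univ, true_and]
        exact ⟨b, ⟨h1, h2, h3⟩, i3⟩
  exact key v h

theorem Reach.degree_le {col : V → ℕ} {k : ℕ} {v u : V} (h : Reach G col k v u) :
    G.degree u ≤ G.degree v := by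
  cases h with
  | refl => exact le_rfl
  | tail _ h => exact h.1.2.2

theorem scanCost_le_two_mul_card_edges (col : V → ℕ) (k : ℕ) (v : V) :
    scanCost G col k v ≤ 2 * #G.edgeFinset := by
  classical
  rw [← G.sum_degrees_eq_twice_card_edges]
  exact Finset.sum_le_sum_of_subset (Finset.filter_subset _ _)

/-- Here the cap pays off. From deg u ≤ deg v it follows that deg u ≤ z v * z u with z = ⌊√deg⌋ + 1.
The weight splits symmetrically between the ends of the walk, so summing over v gives quadratic
forms in z, and the square norm of z is linear in the number of edges. -/
theorem scanCost_light_le {col : V → ℕ} {k D : ℕ} {v : V} (hk : 0 < k) (hv : G.degree v ≤ D ^ 2)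
    (hcol : col v = 0) :
    scanCost G col k v ≤ ∑ i ∈ range k, (Nat.sqrt (G.degree v) + 1) *
      walkSum (LightAdj G col D) (fun u => Nat.sqrt (G.degree u) + 1) i v := by
  classical
  set z : V → ℕ := fun u => Nat.sqrt (G.degree u) + 1 with hz
  have hdeg : ∀ u, Reach G col k v u → G.degree u ≤ z v * z u := by
    intro u hu
    have h1 := Nat.sqrt_le_sqrt hu.degree_le
    have h2 := (Nat.lt_succ_sqrt (G.degree u)).le
    exact h2.trans (Nat.mul_le_mul (by simp only [hz]; omega) le_rfl)
  calc scanCost G col k v ≤ ∑ u with Reach G col k v u, z v * z u :=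
        Finset.sum_le_sum fun u hu => hdeg u (Finset.mem_filter.1 hu).2
    _ ≤ ∑ u ∈ (range k).biUnion fun i => reachLayer G col (G.degree v) i v, z v * z u := by
        refine Finset.sum_le_sum_of_subset fun u hu => ?_
        obtain ⟨h1, -, h3⟩ := (Finset.mem_filter.1 hu).2.mem_reachLayer
        rw [hcol, Nat.sub_zero] at h3
        refine Finset.mem_biUnion.2 ⟨col u, Finset.mem_range.2 ?_, h3⟩
        rcases h1 with h | h
        · exact h
        · rw [h, hcol]; exact hk
    _ ≤ ∑ i ∈ range k, ∑ u ∈ reachLayer G col (G.degree v) i v, z v * z u :=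
        sum_biUnion_le_sum _ _ _
    _ ≤ _ := by
        refine Finset.sum_le_sum fun i _ => ?_
        rw [← Finset.mul_sum]
        exact Nat.mul_le_mul le_rfl (sum_reachLayer_le hv z i v hv)

/-- In a graph without cycles of length `2 k`, the total cost of the searches is small. -/
theorem sum_scanCost_le {k D len : ℕ} (hk : 1 ≤ k) (hD : 1 ≤ D) (hlen : 1 ≤ len)
    (hfree : ¬ (SimpleGraph.cycleGraph (2 * k)).IsContained G)
    (hn : Fintype.card V ≤ 2 ^ len) (hnm : Fintype.card V ≤ #G.edgeFinset)
    (hm : #G.edgeFinset ≤ D ^ (k + 1)) (col : V → ℕ) :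
    ∑ v with col v = 0, scanCost G col k v ≤
      (4 + 6 * k * (64 * (k + 2) * (2 * k + 4)) ^ (k - 1)) *
        (#G.edgeFinset * D ^ (k - 1) * len ^ (k - 1)) := by
  classical
  set m := #G.edgeFinset with hm_def
  set z : V → ℕ := fun u => Nat.sqrt (G.degree u) + 1 with hz
  have hdeg : ∑ v, G.degree v = 2 * m := G.sum_degrees_eq_twice_card_edges
  have hz2 : ∑ v, z v ^ 2 ≤ 6 * m := by
    calc ∑ v, z v ^ 2 ≤ ∑ v, (2 * G.degree v + 2) := by
          refine Finset.sum_le_sum fun v _ => ?_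
          have := Nat.sqrt_le' (G.degree v)
          simp only [hz]
          nlinarith [sq_nonneg ((Nat.sqrt (G.degree v) : ℤ) - 1)]
      _ = 4 * m + 2 * Fintype.card V := by
          rw [Finset.sum_add_distrib, ← Finset.mul_sum, hdeg]; simp; ring
      _ ≤ _ := by omega
  -- Few vertices are heavy: 2m / D^2 ≤ 2 D^(k-1), since m ≤ D^(k+1). Each search costs at most the
  -- sum of all degrees.
  have hheavy : ∑ v with ¬ G.degree v ≤ D ^ 2, scanCost G col k v ≤ 4 * (m * D ^ (k - 1)) := by
    have h1 : #{v | ¬ G.degree v ≤ D ^ 2} * D ^ 2 ≤ 2 * m := by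
      rw [← hdeg, ← smul_eq_mul]
      refine le_trans (Finset.card_nsmul_le_sum _ _ _ fun v hv => ?_)
        (Finset.sum_le_sum_of_subset (Finset.filter_subset (fun v => ¬ G.degree v ≤ D ^ 2) univ))
      exact (not_le.1 (Finset.mem_filter.1 hv).2).le
    have h2 : #{v | ¬ G.degree v ≤ D ^ 2} ≤ 2 * D ^ (k - 1) := by
      have h3 : #{v | ¬ G.degree v ≤ D ^ 2} * D ^ 2 ≤ 2 * D ^ (k - 1) * D ^ 2 := by
        rw [mul_assoc, ← pow_add, show k - 1 + 2 = k + 1 by omega]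
        omega
      exact Nat.le_of_mul_le_mul_right h3 (by positivity)
    calc _ ≤ #{v | ¬ G.degree v ≤ D ^ 2} * (2 * m) := by
          rw [← smul_eq_mul]
          exact Finset.sum_le_card_nsmul _ _ _ fun v _ => scanCost_le_two_mul_card_edges col k v
      _ ≤ 2 * D ^ (k - 1) * (2 * m) := Nat.mul_le_mul_right _ h2
      _ = _ := by ring
  -- All walk weights used are at most 2^(len * (i + 1)) with i < k, hence below 2^J.
  set J := (k + 2) * len with hJ
  set r := LightAdj G col D with hr
  have hzn : ∀ a, z a ≤ 2 ^ len := by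
    intro a
    have h1 := Nat.sqrt_le_self (G.degree a)
    have h2 := G.degree_lt_card_verts a
    simp only [hz]
    omega
  have hJ' : ∀ i < k, ∀ a, walkSum r z i a < 2 ^ J := by
    intro i hi a
    calc walkSum r z i a ≤ Fintype.card V ^ i * 2 ^ len := walkSum_le r hzn i a
      _ ≤ (2 ^ len) ^ i * 2 ^ len := Nat.mul_le_mul_right _ (Nat.pow_le_pow_left hn i)
      _ = 2 ^ (len * (i + 1)) := by rw [← pow_mul, ← pow_add]; ring
      _ < 2 ^ J := by
          refine Nat.pow_lt_pow_right one_lt_two ?_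
          rw [hJ, mul_comm]
          exact Nat.mul_lt_mul_of_pos_right (by omega) hlen
  set Λ : ℝ := 2 * (16 * (2 * k + 4) * D) with hΛ
  have hwalk : ∀ i < k, ∑ a, z a * walkSum r z i a ≤
      (64 * (k + 2) * (2 * k + 4)) ^ (k - 1) * (6 * (m * D ^ (k - 1) * len ^ (k - 1))) := by
    intro i hi
    have h1 := sum_walkSum_le (r := r) (Λ := Λ) (by positivity)
      (pairs_light_le hD hfree hm col) hJ' hi
    have h2 : (2 * J * Λ : ℝ) = ((64 * (k + 2) * (2 * k + 4) * (D * len) : ℕ) : ℝ) := by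
      rw [hJ, hΛ]; push_cast; ring
    have h3 : (∑ a, z a * walkSum r z i a) ≤
        (64 * (k + 2) * (2 * k + 4) * (D * len)) ^ i * ∑ a, z a ^ 2 := by
      rw [h2] at h1
      exact_mod_cast h1
    refine h3.trans ?_
    calc _ ≤ (64 * (k + 2) * (2 * k + 4) * (D * len)) ^ (k - 1) * (6 * m) :=
          Nat.mul_le_mul (Nat.pow_le_pow_right (by positivity) (by omega)) hz2
      _ = _ := by rw [mul_pow, mul_pow D]; ring
  have hlight : ∑ v with col v = 0 ∧ G.degree v ≤ D ^ 2, scanCost G col k v ≤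
      k * ((64 * (k + 2) * (2 * k + 4)) ^ (k - 1) * (6 * (m * D ^ (k - 1) * len ^ (k - 1)))) := by
    calc _ ≤ ∑ v with col v = 0 ∧ G.degree v ≤ D ^ 2, ∑ i ∈ range k, z v * walkSum r z i v :=
          Finset.sum_le_sum fun v hv => by
            have := (Finset.mem_filter.1 hv).2
            exact scanCost_light_le hk this.2 this.1
      _ ≤ ∑ v, ∑ i ∈ range k, z v * walkSum r z i v :=
          Finset.sum_le_sum_of_subset (Finset.filter_subset _ _)
      _ = ∑ i ∈ range k, ∑ v, z v * walkSum r z i v := Finset.sum_comm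
      _ ≤ _ := by
          have := Finset.sum_le_card_nsmul (range k) (fun i => ∑ v, z v * walkSum r z i v) _
            fun i hi => hwalk i (Finset.mem_range.1 hi)
          simpa using this
  have hlen1 : 1 ≤ len ^ (k - 1) := Nat.one_le_pow _ _ hlen
  calc ∑ v with col v = 0, scanCost G col k v
      ≤ ∑ v with col v = 0 ∧ G.degree v ≤ D ^ 2, scanCost G col k v +
        ∑ v with ¬ G.degree v ≤ D ^ 2, scanCost G col k v := by
        rw [← Finset.sum_filter_add_sum_filter_not _ (fun v => G.degree v ≤ D ^ 2),
          Finset.filter_filter, Finset.filter_filter]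
        refine Nat.add_le_add_left (Finset.sum_le_sum_of_subset fun v hv => ?_) _
        simp only [mem_filter, mem_univ, true_and] at hv ⊢
        exact hv.2
    _ ≤ k * ((64 * (k + 2) * (2 * k + 4)) ^ (k - 1) * (6 * (m * D ^ (k - 1) * len ^ (k - 1)))) +
        4 * (m * D ^ (k - 1)) := Nat.add_le_add hlight hheavy
    _ ≤ k * ((64 * (k + 2) * (2 * k + 4)) ^ (k - 1) * (6 * (m * D ^ (k - 1) * len ^ (k - 1)))) +
        4 * (m * D ^ (k - 1) * len ^ (k - 1)) :=
        Nat.add_le_add_left (Nat.mul_le_mul_left _ (Nat.le_mul_of_pos_right _ hlen1)) _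
    _ = _ := by ring

end Scans

end EvenCycle

/-! ### Program logic for the word RAM. -/

namespace WordRAM
open Finset

variable {w : ℕ} {ω : ℕ → Bool}

/-- Started in `s`, the program `c` halts with a running time and a final state satisfying `Q`. -/
def WP (w : ℕ) (ω : ℕ → Bool) (c : Cmd) (s : State) (Q : ℕ → State → Prop) : Prop :=
  ∃ t s', Exec w ω c s t s' ∧ Q t s'

theorem WP.mono {c : Cmd} {s : State} {Q Q' : ℕ → State → Prop} (h : WP w ω c s Q)
    (hQ : ∀ t s', Q t s' → Q' t s') : WP w ω c s Q' := by
  obtain ⟨t, s', he, hq⟩ := h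
  exact ⟨t, s', he, hQ t s' hq⟩

theorem wp_skip {s : State} {Q : ℕ → State → Prop} : WP w ω .skip s Q ↔ Q 1 s := by
  constructor
  · rintro ⟨t, s', h, hq⟩; cases h; exact hq
  · exact fun h => ⟨_, _, .skip s, h⟩

theorem wp_assign {x : ℕ} {e : Expr} {s : State} {Q : ℕ → State → Prop} :
    WP w ω (.assign x e) s Q ↔ Q (e.cost + 1) (s.setReg x (e.eval w s)) := by
  constructor
  · rintro ⟨t, s', h, hq⟩; cases h; exact hq
  · exact fun h => ⟨_, _, .assign s x e, h⟩

theorem wp_store {a : ℕ} {i e : Expr} {s : State} {Q : ℕ → State → Prop} :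
    WP w ω (.store a i e) s Q ↔
      Q (i.cost + e.cost + 1) (s.setArr a (i.eval w s) (e.eval w s)) := by
  constructor
  · rintro ⟨t, s', h, hq⟩; cases h; exact hq
  · exact fun h => ⟨_, _, .store s a i e, h⟩

theorem wp_toss {x : ℕ} {s : State} {Q : ℕ → State → Prop} :
    WP w ω (.toss x) s Q ↔
      Q 1 { s.setReg x (ω s.coins).toNat with coins := s.coins + 1 } := by
  constructor
  · rintro ⟨t, s', h, hq⟩; cases h; exact hq
  · exact fun h => ⟨_, _, .toss s x, h⟩

theorem wp_seq {c₁ c₂ : Cmd} {s : State} {Q : ℕ → State → Prop} :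
    WP w ω (.seq c₁ c₂) s Q ↔
      WP w ω c₁ s fun t₁ s₁ => WP w ω c₂ s₁ fun t₂ s₂ => Q (t₁ + t₂) s₂ := by
  constructor
  · rintro ⟨t, s', h, hq⟩
    cases h with
    | seq h₁ h₂ => exact ⟨_, _, h₁, _, _, h₂, hq⟩
  · rintro ⟨t₁, s₁, h₁, t₂, s₂, h₂, hq⟩
    exact ⟨_, _, .seq h₁ h₂, hq⟩

theorem wp_ite {e : Expr} {c₁ c₂ : Cmd} {s : State} {Q : ℕ → State → Prop} :
    WP w ω (.ite e c₁ c₂) s Q ↔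
      (e.eval w s ≠ 0 → WP w ω c₁ s fun t s' => Q (e.cost + 1 + t) s') ∧
      (e.eval w s = 0 → WP w ω c₂ s fun t s' => Q (e.cost + 1 + t) s') := by
  constructor
  · rintro ⟨t, s', h, hq⟩
    cases h with
    | iteTrue he h => exact ⟨fun _ => ⟨_, _, h, hq⟩, fun h0 => absurd h0 he⟩
    | iteFalse he h => exact ⟨fun h0 => absurd he h0, fun _ => ⟨_, _, h, hq⟩⟩
  · rintro ⟨h₁, h₂⟩
    by_cases he : e.eval w s = 0
    · obtain ⟨t, s', h, hq⟩ := h₂ he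
      exact ⟨_, _, .iteFalse he h, hq⟩
    · obtain ⟨t, s', h, hq⟩ := h₁ he
      exact ⟨_, _, .iteTrue he h, hq⟩

/-- Loops: `I` is an invariant, and the potential `Φ` pays for the iterations. -/
theorem wp_loop (I : State → Prop) (Φ : State → ℕ) {e : Expr} {c : Cmd} {s : State}
    (h₀ : I s)
    (hstep : ∀ s, I s → e.eval w s ≠ 0 →
      WP w ω c s fun t s' => I s' ∧ t + Φ s' + (e.cost + 1) ≤ Φ s) :
    WP w ω (.loop e c) s fun t s' =>
      I s' ∧ e.eval w s' = 0 ∧ t + Φ s' ≤ Φ s + (e.cost + 1) := by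
  -- Every iteration strictly lowers the potential, so induction on a bound for it also proves
  -- termination.
  obtain ⟨N, hN⟩ : ∃ N, Φ s ≤ N := ⟨_, le_rfl⟩
  induction N generalizing s with
  | zero =>
    by_cases he : e.eval w s = 0
    · exact ⟨_, _, .loopExit he, h₀, he, by omega⟩
    · obtain ⟨t, s', -, -, h⟩ := hstep s h₀ he
      omega
  | succ N ih =>
    by_cases he : e.eval w s = 0
    · exact ⟨_, _, .loopExit he, h₀, he, by omega⟩
    · obtain ⟨t₁, s₁, hx₁, hI₁, ht₁⟩ := hstep s h₀ he
      obtain ⟨t₂, s₂, hx₂, hI₂, he₂, ht₂⟩ := ih hI₁ (by omega)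
      exact ⟨_, _, .loopStep he hx₁ hx₂, hI₂, he₂, by omega⟩

@[simp] theorem setReg_reg (s : State) (x v y : ℕ) :
    (s.setReg x v).reg y = if y = x then v else s.reg y := by
  simp [State.setReg, Function.update_apply]

@[simp] theorem setReg_arr (s : State) (x v : ℕ) : (s.setReg x v).arr = s.arr := rfl

@[simp] theorem setReg_coins (s : State) (x v : ℕ) : (s.setReg x v).coins = s.coins := rfl

@[simp] theorem setArr_reg (s : State) (a i v : ℕ) : (s.setArr a i v).reg = s.reg := rfl

@[simp] theorem setArr_coins (s : State) (a i v : ℕ) : (s.setArr a i v).coins = s.coins := rfl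

@[simp] theorem setArr_arr (s : State) (a i v b : ℕ) :
    (s.setArr a i v).arr b = if b = a then Function.update (s.arr a) i v else s.arr b := by
  simp [State.setArr, Function.update_apply]

theorem eval_lt_mul_lt_ne_zero (hw : 1 < 2 ^ w) (s : State) (e₁ e₂ e₃ e₄ : Expr) :
    (Expr.bin .mul (.bin .lt e₁ e₂) (.bin .lt e₃ e₄)).eval w s ≠ 0 ↔
      e₁.eval w s < e₂.eval w s ∧ e₃.eval w s < e₄.eval w s := by
  by_cases h1 : e₁.eval w s < e₂.eval w s <;> by_cases h2 : e₃.eval w s < e₄.eval w s <;>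
    simp [Expr.eval, BinOp.eval, h1, h2, Nat.mod_eq_of_lt hw]

theorem bool_mod {W : ℕ} (hW : 1 < W) (p : Prop) [Decidable p] :
    (if p then 1 else 0) % W = if p then 1 else 0 := by
  split_ifs <;> simp [Nat.mod_eq_of_lt hW]

/-- The sequence of commands `c` followed by `d`. -/
infixr:60 " ;; " => Cmd.seq

end WordRAM

/-! ### The search program and its correctness. -/

namespace EvenCycle
open Finset
open WordRAM

/-- One step of a search: scan the next edge of the vertex at the head of the queue, or, if all
its edges have been scanned, remove it from the queue. -/
def searchStep (k ca mk mo : ℕ) : Cmd :=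
  -- Registers: 5 budget, 7 success flag, 8 source, 9 time stamp, 10 and 11 head and tail of the
  -- queue, 12 current vertex, 13 its next edge, 14 the neighbour. Arrays: 2 degrees, 3 neighbours,
  -- 4 colours, 5 dual colours, 6 and 7 the marks of the two searches, 8 the queue.
  .assign 12 (.read 8 (.reg 10)) ;;
  .ite (.bin .lt (.reg 13) (.read 2 (.reg 12)))
    (.assign 5 (.bin .sub (.reg 5) (.lit 1)) ;;
      -- The j-th neighbour of u is in cell j * n + u. The n^2 cells need no initialization because
      -- memory starts at zero.
      .assign 14 (.read 3 (.bin .add (.bin .mul (.reg 13) (.reg 0)) (.reg 12))) ;;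
      .assign 13 (.bin .add (.reg 13) (.lit 1)) ;;
      .ite (.bin .mul (.bin .mul
          (.bin .lt (.read 2 (.reg 14)) (.bin .add (.read 2 (.reg 8)) (.lit 1)))
          (.bin .eq (.read ca (.reg 14)) (.bin .add (.read ca (.reg 12)) (.lit 1))))
          (.bin .lt (.read mk (.reg 14)) (.reg 9)))
        (.store mk (.reg 14) (.reg 9) ;;
          -- A vertex of colour k is marked and compared with the other search, but not put into the
          -- queue.
          .ite (.bin .eq (.read ca (.reg 14)) (.lit k))
            (.ite (.bin .eq (.read mo (.reg 14)) (.reg 9)) (.assign 7 (.lit 1)) .skip)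
            (.store 8 (.reg 11) (.reg 14) ;; .assign 11 (.bin .add (.reg 11) (.lit 1))))
        .skip)
    (.assign 10 (.bin .add (.reg 10) (.lit 1)) ;; .assign 13 (.lit 0))

/-- A search from the vertex in register `8`: `ca` is the array of the colours, the vertices found
are marked in the array `mk`, and those of colour `k` are looked up in the array `mo`. -/
def search (k ca mk mo : ℕ) : Cmd :=
  .store 8 (.lit 0) (.reg 8) ;; .assign 10 (.lit 0) ;; .assign 11 (.lit 1) ;;
  .assign 13 (.lit 0) ;;
  .loop (.bin .mul (.bin .lt (.reg 10) (.reg 11)) (.bin .lt (.lit 0) (.reg 5)))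
    (searchStep k ca mk mo)

section Search
variable {n : ℕ} (G : SimpleGraph (Fin n)) [DecidableRel G.Adj]

/-- The lists `nbr u` enumerate the neighbours of the vertices. -/
structure IsNbrLists (nbr : Fin n → List (Fin n)) : Prop where
  length_eq : ∀ u, (nbr u).length = G.degree u
  mem_iff : ∀ u y, y ∈ nbr u ↔ G.Adj u y

/-- The tables of the degrees and of the neighbours. -/
structure HasTables (nbr : Fin n → List (Fin n)) (s : State) : Prop where
  n_eq : s.reg 0 = n
  deg : ∀ u : Fin n, s.arr 2 u = G.degree u
  adj : ∀ (u : Fin n) (j : ℕ) (h : j < (nbr u).length), s.arr 3 (j * n + u) = (nbr u)[j]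

/-- `y` is one advancing edge away from a vertex reachable from `v`. -/
def Touched (col : Fin n → ℕ) (k : ℕ) (v y : Fin n) : Prop :=
  ∃ u, Reach G col k v u ∧ Advance G col (G.degree v) u y

/-- The invariant of a search from `v` with time stamp `T`, started in the state `s₀`; the queue has
held the vertices `Q`, of which `h` have been removed, and `j` edges of the next one have been
scanned. -/
structure SearchInv (nbr : Fin n → List (Fin n)) (col : Fin n → ℕ) (k mk mo : ℕ) (v : Fin n)
    (T : ℕ) (s₀ s : State) (Q : List (Fin n)) (h j : ℕ) : Prop where
  frame_reg : ∀ r, r ≠ 5 → r ≠ 7 → r ≠ 10 → r ≠ 11 → r ≠ 12 → r ≠ 13 → r ≠ 14 →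
    s.reg r = s₀.reg r
  frame_arr : ∀ a, a ≠ mk → a ≠ 8 → s.arr a = s₀.arr a
  frame_coins : s.coins = s₀.coins
  head_eq : s.reg 10 = h
  head_le : h ≤ Q.length
  tail_eq : s.reg 11 = Q.length
  j_eq : s.reg 13 = j
  queue : ∀ i (hi : i < Q.length), s.arr 8 i = Q[i]
  nodup : Q.Nodup
  source_mem : v ∈ Q
  reach : ∀ u ∈ Q, Reach G col k v u
  mark_le : ∀ y : Fin n, s.arr mk y ≤ T
  touched : ∀ y : Fin n, s.arr mk y = T → Touched G col k v y
  mark_of_mem : ∀ y ∈ Q, y = v ∨ s.arr mk y = T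
  mem_of_mark : ∀ y : Fin n, s.arr mk y = T → col y < k → y ∈ Q
  closed : ∀ i (hi : i < Q.length), i < h → ∀ y, Advance G col (G.degree v) Q[i] y →
    s.arr mk y = T
  scanned_le : ∀ hh : h < Q.length, j ≤ G.degree Q[h]
  scanned : ∀ hh : h < Q.length, ∀ i < j, ∀ hi : i < (nbr Q[h]).length,
    Advance G col (G.degree v) Q[h] (nbr Q[h])[i] → s.arr mk (nbr Q[h])[i] = T
  scanned_zero : h = Q.length → j = 0
  budget : s₀.reg 5 = s.reg 5 + ((Q.take h).map fun u => G.degree u).sum + j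
  found_le : s.reg 7 ≤ 1
  found : s.reg 7 ≠ 0 ↔ s₀.reg 7 ≠ 0 ∨ ∃ y : Fin n, s.arr mk y = T ∧ col y = k ∧ s₀.arr mo y = T

end Search

section Search
variable {n : ℕ} {G : SimpleGraph (Fin n)} [DecidableRel G.Adj]
  {nbr : Fin n → List (Fin n)} {col : Fin n → ℕ} {k ca mk mo : ℕ} {v : Fin n} {T : ℕ}
  {s₀ s s' : State} {Q : List (Fin n)} {h j : ℕ}

/-- All neighbours of the head have been scanned, so the head joins the closed part and its scanned
edges move into the degree sum of the budget. -/
theorem SearchInv.pop (hnbr : IsNbrLists G nbr) (inv : SearchInv G nbr col k mk mo v T s₀ s Q h j)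
    (hlt : h < Q.length) (hj : j = G.degree Q[h])
    (hreg : ∀ r, r ≠ 10 → r ≠ 12 → r ≠ 13 → s'.reg r = s.reg r)
    (h10 : s'.reg 10 = h + 1) (h13 : s'.reg 13 = 0) (harr : s'.arr = s.arr)
    (hcoins : s'.coins = s.coins) :
    SearchInv G nbr col k mk mo v T s₀ s' Q (h + 1) 0 where
  frame_reg r h1 h2 h3 h4 h5 h6 h7 := by
    rw [hreg r h3 h5 h6]; exact inv.frame_reg r h1 h2 h3 h4 h5 h6 h7
  frame_arr a h1 h2 := by rw [harr]; exact inv.frame_arr a h1 h2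
  frame_coins := hcoins.trans inv.frame_coins
  head_eq := h10
  head_le := hlt
  tail_eq := by rw [hreg 11 (by decide) (by decide) (by decide)]; exact inv.tail_eq
  j_eq := h13
  queue := by rw [harr]; exact inv.queue
  nodup := inv.nodup
  source_mem := inv.source_mem
  reach := inv.reach
  mark_le := by rw [harr]; exact inv.mark_le
  touched := by rw [harr]; exact inv.touched
  mark_of_mem := by rw [harr]; exact inv.mark_of_mem
  mem_of_mark := by rw [harr]; exact inv.mem_of_mark
  closed i hi hih y hy := by
    rw [harr]
    rcases Nat.lt_succ_iff_lt_or_eq.1 hih with h1 | rfl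
    · exact inv.closed i hi h1 y hy
    · obtain ⟨i', hi', rfl⟩ := List.getElem_of_mem ((hnbr.mem_iff _ _).2 hy.1)
      exact inv.scanned hlt i' (by rw [hj, ← hnbr.length_eq]; exact hi') hi' hy
  scanned_le _ := Nat.zero_le _
  scanned _ i hi := absurd hi (Nat.not_lt_zero i)
  scanned_zero _ := rfl
  budget := by
    rw [hreg 5 (by decide) (by decide) (by decide), inv.budget, List.take_add_one,
      List.getElem?_eq_getElem hlt, List.map_append, List.sum_append, hj]
    simp
    ring
  found_le := by rw [hreg 7 (by decide) (by decide) (by decide)]; exact inv.found_le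
  found := by rw [hreg 7 (by decide) (by decide) (by decide), harr]; exact inv.found

theorem SearchInv.skip (inv : SearchInv G nbr col k mk mo v T s₀ s Q h j)
    (hlt : h < Q.length) (hj : j < G.degree Q[h]) (hj' : j < (nbr Q[h]).length)
    (hB : 0 < s.reg 5)
    (hy : Advance G col (G.degree v) Q[h] (nbr Q[h])[j] → s.arr mk (nbr Q[h])[j] = T)
    (hreg : ∀ r, r ≠ 5 → r ≠ 12 → r ≠ 13 → r ≠ 14 → s'.reg r = s.reg r)
    (h5 : s'.reg 5 = s.reg 5 - 1) (h13 : s'.reg 13 = j + 1) (harr : s'.arr = s.arr)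
    (hcoins : s'.coins = s.coins) :
    SearchInv G nbr col k mk mo v T s₀ s' Q h (j + 1) where
  frame_reg r h1 h2 h3 h4 h5 h6 h7 := by
    rw [hreg r h1 h5 h6 h7]; exact inv.frame_reg r h1 h2 h3 h4 h5 h6 h7
  frame_arr a h1 h2 := by rw [harr]; exact inv.frame_arr a h1 h2
  frame_coins := hcoins.trans inv.frame_coins
  head_eq := by rw [hreg 10 (by decide) (by decide) (by decide) (by decide)]; exact inv.head_eq
  head_le := inv.head_le
  tail_eq := by rw [hreg 11 (by decide) (by decide) (by decide) (by decide)]; exact inv.tail_eq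
  j_eq := h13
  queue := by rw [harr]; exact inv.queue
  nodup := inv.nodup
  source_mem := inv.source_mem
  reach := inv.reach
  mark_le := by rw [harr]; exact inv.mark_le
  touched := by rw [harr]; exact inv.touched
  mark_of_mem := by rw [harr]; exact inv.mark_of_mem
  mem_of_mark := by rw [harr]; exact inv.mem_of_mark
  closed := by rw [harr]; exact inv.closed
  scanned_le _ := hj
  scanned hh i hi hi' hadv := by
    rw [harr]
    rcases Nat.lt_succ_iff_lt_or_eq.1 hi with h1 | rfl
    · exact inv.scanned hh i h1 hi' hadv
    · exact hy hadv
  scanned_zero h0 := by omega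
  budget := by rw [h5, inv.budget]; omega
  found_le := by rw [hreg 7 (by decide) (by decide) (by decide) (by decide)]; exact inv.found_le
  found := by rw [hreg 7 (by decide) (by decide) (by decide) (by decide), harr]; exact inv.found

theorem SearchInv.mark (inv : SearchInv G nbr col k mk mo v T s₀ s Q h j)
    (hmk : 8 ≠ mk) (hlt : h < Q.length) (hj : j < G.degree Q[h]) (hj' : j < (nbr Q[h]).length)
    (hB : 0 < s.reg 5) {y : Fin n} (hy : y = (nbr Q[h])[j])
    (hadv : Advance G col (G.degree v) Q[h] y) (hcol : col y = k)
    (hreg : ∀ r, r ≠ 5 → r ≠ 7 → r ≠ 12 → r ≠ 13 → r ≠ 14 → s'.reg r = s.reg r)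
    (h5 : s'.reg 5 = s.reg 5 - 1) (h13 : s'.reg 13 = j + 1)
    (harr : ∀ a, a ≠ mk → s'.arr a = s.arr a)
    (hmkarr : s'.arr mk = Function.update (s.arr mk) y T) (hcoins : s'.coins = s.coins)
    (h7 : s'.reg 7 ≤ 1) (h7' : s'.reg 7 ≠ 0 ↔ s.reg 7 ≠ 0 ∨ s₀.arr mo y = T) :
    SearchInv G nbr col k mk mo v T s₀ s' Q h (j + 1) := by
  have hup : ∀ x : Fin n, s'.arr mk x = if x = y then T else s.arr mk x := by
    intro x
    rw [hmkarr, Function.update_apply]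
    simp [Fin.ext_iff]
  have hmono : ∀ x : Fin n, s.arr mk x = T → s'.arr mk x = T := by
    intro x hx
    rw [hup]; split_ifs
    · rfl
    · exact hx
  have hmem := inv.reach _ (List.getElem_mem hlt)
  exact {
    frame_reg := fun r h1 h2 h3 h4 h5 h6 h7 => by
      rw [hreg r h1 h2 h5 h6 h7]; exact inv.frame_reg r h1 h2 h3 h4 h5 h6 h7
    frame_arr := fun a h1 h2 => by rw [harr a h1]; exact inv.frame_arr a h1 h2
    frame_coins := hcoins.trans inv.frame_coins
    head_eq := by
      rw [hreg 10 (by decide) (by decide) (by decide) (by decide) (by decide)]; exact inv.head_eq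
    head_le := inv.head_le
    tail_eq := by
      rw [hreg 11 (by decide) (by decide) (by decide) (by decide) (by decide)]; exact inv.tail_eq
    j_eq := h13
    queue := by rw [harr 8 hmk]; exact inv.queue
    nodup := inv.nodup
    source_mem := inv.source_mem
    reach := inv.reach
    mark_le := fun x => by
      rw [hup]; split_ifs
      · exact le_rfl
      · exact inv.mark_le x
    touched := fun x hx => by
      rw [hup] at hx
      split_ifs at hx with hxy
      · exact ⟨_, hmem, hxy ▸ hadv⟩
      · exact inv.touched x hx
    mark_of_mem := fun x hx => (inv.mark_of_mem x hx).imp_right (hmono x)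
    mem_of_mark := fun x hx hxk => by
      rw [hup] at hx
      split_ifs at hx with hxy
      · rw [hxy, hcol] at hxk; exact absurd hxk (lt_irrefl _)
      · exact inv.mem_of_mark x hx hxk
    closed := fun i hi hih x hx => hmono x (inv.closed i hi hih x hx)
    scanned_le := fun _ => hj
    scanned := fun hh i hi hi' hadv' => by
      rcases Nat.lt_succ_iff_lt_or_eq.1 hi with h1 | rfl
      · exact hmono _ (inv.scanned hh i h1 hi' hadv')
      · rw [hup, if_pos hy.symm]
    scanned_zero := fun h0 => by omega
    budget := by rw [h5, inv.budget]; omega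
    found_le := h7
    found := by
      rw [h7', inv.found, or_assoc]
      refine or_congr_right ⟨?_, ?_⟩
      · rintro (⟨x, h1, h2⟩ | h1)
        · exact ⟨x, hmono x h1, h2⟩
        · exact ⟨y, by rw [hup, if_pos rfl], hcol, h1⟩
      · rintro ⟨x, h1, h2, h3⟩
        rw [hup] at h1
        split_ifs at h1 with hxy
        · exact Or.inr (hxy ▸ h3)
        · exact Or.inl ⟨x, h1, h2, h3⟩ }

/-- The new vertex is not queued already: it is not the source, as its colour is positive, and every
other queued vertex carries the stamp T. -/
theorem SearchInv.push (inv : SearchInv G nbr col k mk mo v T s₀ s Q h j) (hcolv : col v = 0)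
    (hlt : h < Q.length) (hj : j < G.degree Q[h]) (hj' : j < (nbr Q[h]).length)
    (hB : 0 < s.reg 5) {y : Fin n} (hy : y = (nbr Q[h])[j])
    (hadv : Advance G col (G.degree v) Q[h] y) (hcol : col y < k) (hnew : s.arr mk y ≠ T)
    (hreg : ∀ r, r ≠ 5 → r ≠ 11 → r ≠ 12 → r ≠ 13 → r ≠ 14 → s'.reg r = s.reg r)
    (h5 : s'.reg 5 = s.reg 5 - 1) (h11 : s'.reg 11 = Q.length + 1) (h13 : s'.reg 13 = j + 1)
    (harr : ∀ a, a ≠ mk → a ≠ 8 → s'.arr a = s.arr a)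
    (hqarr : s'.arr 8 = Function.update (s.arr 8) Q.length y)
    (hmkarr : s'.arr mk = Function.update (s.arr mk) y T) (hcoins : s'.coins = s.coins) :
    SearchInv G nbr col k mk mo v T s₀ s' (Q ++ [y]) h (j + 1) := by
  have hup : ∀ x : Fin n, s'.arr mk x = if x = y then T else s.arr mk x := by
    intro x
    rw [hmkarr, Function.update_apply]
    simp [Fin.ext_iff]
  have hmono : ∀ x : Fin n, s.arr mk x = T → s'.arr mk x = T := by
    intro x hx
    rw [hup]; split_ifs
    · rfl
    · exact hx
  have hmem := inv.reach _ (List.getElem_mem hlt)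
  have hyv : y ≠ v := by
    rintro rfl
    have := hadv.2.1
    omega
  have hyQ : y ∉ Q := fun hmem => (inv.mark_of_mem y hmem).elim hyv hnew
  have hh' : (Q ++ [y])[h]'(by simp; omega) = Q[h] := List.getElem_append_left hlt
  exact {
    frame_reg := fun r h1 h2 h3 h4 h5 h6 h7 => by
      rw [hreg r h1 h4 h5 h6 h7]; exact inv.frame_reg r h1 h2 h3 h4 h5 h6 h7
    frame_arr := fun a h1 h2 => by rw [harr a h1 h2]; exact inv.frame_arr a h1 h2
    frame_coins := hcoins.trans inv.frame_coins
    head_eq := by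
      rw [hreg 10 (by decide) (by decide) (by decide) (by decide) (by decide)]; exact inv.head_eq
    head_le := by simp; omega
    tail_eq := by simpa using h11
    j_eq := h13
    queue := fun i hi => by
      rw [hqarr, Function.update_apply]
      rcases Nat.lt_or_ge i Q.length with h1 | h1
      · rw [if_neg (by omega), List.getElem_append_left h1]; exact inv.queue i h1
      · have h2 : i = Q.length := by simp at hi; omega
        subst h2
        simp
    nodup := by
      rw [List.nodup_append]
      refine ⟨inv.nodup, by simp, ?_⟩
      rintro a ha b hb rfl
      simp only [List.mem_singleton] at hb
      exact hyQ (hb ▸ ha)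
    source_mem := List.mem_append_left _ inv.source_mem
    reach := fun u hu => by
      rcases List.mem_append.1 hu with h1 | h1
      · exact inv.reach u h1
      · rw [List.mem_singleton] at h1
        rw [h1]
        exact hmem.tail ⟨hadv, hcol⟩
    mark_le := fun x => by
      rw [hup]; split_ifs
      · exact le_rfl
      · exact inv.mark_le x
    touched := fun x hx => by
      rw [hup] at hx
      split_ifs at hx with hxy
      · exact ⟨_, hmem, hxy ▸ hadv⟩
      · exact inv.touched x hx
    mark_of_mem := fun x hx => by
      rcases List.mem_append.1 hx with h1 | h1
      · exact (inv.mark_of_mem x h1).imp_right (hmono x)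
      · rw [List.mem_singleton] at h1
        right; rw [hup, if_pos h1]
    mem_of_mark := fun x hx hxk => by
      rw [hup] at hx
      split_ifs at hx with hxy
      · exact List.mem_append_right _ (by simpa using hxy)
      · exact List.mem_append_left _ (inv.mem_of_mark x hx hxk)
    closed := fun i hi hih x hx => by
      have h1 : i < Q.length := by omega
      rw [List.getElem_append_left h1] at hx
      exact hmono x (inv.closed i h1 hih x hx)
    scanned_le := fun _ => by rw [hh']; exact hj
    scanned := fun hh i hi => by
      rw [hh']
      intro hi' hadv'
      rcases Nat.lt_succ_iff_lt_or_eq.1 hi with h1 | rfl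
      · exact hmono _ (inv.scanned hlt i h1 hi' hadv')
      · rw [hup, if_pos hy.symm]
    scanned_zero := fun h0 => by simp at h0; omega
    budget := by
      rw [h5, inv.budget, List.take_append_of_le_length hlt.le]; omega
    found_le := by
      rw [hreg 7 (by decide) (by decide) (by decide) (by decide) (by decide)]; exact inv.found_le
    found := by
      rw [hreg 7 (by decide) (by decide) (by decide) (by decide) (by decide), inv.found]
      refine or_congr_right ⟨?_, ?_⟩
      · rintro ⟨x, h1, h2⟩
        exact ⟨x, hmono x h1, h2⟩
      · rintro ⟨x, h1, h2, h3⟩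
        rw [hup] at h1
        split_ifs at h1 with hxy
        · rw [hxy] at h2; omega
        · exact ⟨x, h1, h2, h3⟩ }

theorem eval_scan_condition {W a b c d e f : ℕ} (hW : 1 < W) :
    (((if a < b then 1 else 0) * if c = d then 1 else 0) % W * if e < f then 1 else 0) % W ≠ 0 ↔
      a < b ∧ c = d ∧ e < f := by
  by_cases h1 : a < b <;> by_cases h2 : c = d <;> by_cases h3 : e < f <;>
    simp [h1, h2, h3, Nat.mod_eq_of_lt hW]

/-- In the potential 100 * (2 * budget + queue length), scanning an edge takes one from the budget
and lengthens the queue by at most one, and a removal shortens it by one. Either way at least 100 is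
released, which pays for the step and the loop test. -/
theorem searchStep_spec {w : ℕ} {ω : ℕ → Bool}
    (hnbr : IsNbrLists G nbr) (htab : HasTables G nbr s₀) (hcol : ∀ u : Fin n, s₀.arr ca u = col u)
    (hv : s₀.reg 8 = v) (hT : s₀.reg 9 = T) (hca : ca ≠ mk ∧ ca ≠ 8) (hmo : mo ≠ mk ∧ mo ≠ 8)
    (hmk : 8 ≠ mk ∧ 2 ≠ mk ∧ 3 ≠ mk) (hW : 1 < 2 ^ w) (hnW : n * n + n < 2 ^ w)
    (hcolW : ∀ u, col u + 1 < 2 ^ w) (hkW : k < 2 ^ w) (hBW : s₀.reg 5 < 2 ^ w) (hk : 0 < k)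
    (hcolv : col v = 0) (inv : SearchInv G nbr col k mk mo v T s₀ s Q h j)
    (hlt : h < Q.length) (hB : 0 < s.reg 5) :
    WP w ω (searchStep k ca mk mo) s fun t s' =>
      (∃ Q' h' j', SearchInv G nbr col k mk mo v T s₀ s' Q' h' j') ∧
      t + 100 * (2 * s'.reg 5 + (s'.reg 11 - s'.reg 10)) + 10 ≤
        100 * (2 * s.reg 5 + (s.reg 11 - s.reg 10)) := by
  have hQn : Q.length ≤ n := by simpa using inv.nodup.length_le_card
  have e0 : s.reg 0 = n := by rw [inv.frame_reg 0] <;> simp [htab.n_eq]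
  have e8 : s.reg 8 = v := by rw [inv.frame_reg 8] <;> simp [hv]
  have e9 : s.reg 9 = T := by rw [inv.frame_reg 9] <;> simp [hT]
  have e10 := inv.head_eq
  have e11 := inv.tail_eq
  have e13 := inv.j_eq
  have a2 : s.arr 2 = s₀.arr 2 := inv.frame_arr 2 hmk.2.1 (by decide)
  have a3 : s.arr 3 = s₀.arr 3 := inv.frame_arr 3 hmk.2.2 (by decide)
  have aca : s.arr ca = s₀.arr ca := inv.frame_arr ca hca.1 hca.2
  have amo : s.arr mo = s₀.arr mo := inv.frame_arr mo hmo.1 hmo.2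
  have hu : s.arr 8 h = Q[h] := inv.queue h hlt
  set u := Q[h] with hu_def
  have hdegn : ∀ x, G.degree x < n := fun x => by simpa using G.degree_lt_card_verts x
  have hB0 : s.reg 5 ≤ s₀.reg 5 := by have := inv.budget; omega
  have h1W : 1 % 2 ^ w = 1 := Nat.mod_eq_of_lt hW
  have hhn : (h + 1) % 2 ^ w = h + 1 := Nat.mod_eq_of_lt (by omega)
  unfold searchStep
  rw [wp_seq, wp_assign, wp_ite]
  simp only [Expr.eval, BinOp.eval, Expr.cost, setReg_reg, setReg_arr, e10, hu, e13, a2, htab.deg,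
    bool_mod hW, Nat.reduceEqDiff, ↓reduceIte]
  have hjdeg : j ≤ G.degree u := inv.scanned_le hlt
  refine ⟨fun hc => ?_, fun hc => ?_⟩
  · have hj : j < G.degree u := by by_contra hcon; simp [hcon] at hc
    have hj' : j < (nbr u).length := by rw [hnbr.length_eq]; exact hj
    obtain ⟨y, hy⟩ : ∃ y, y = (nbr u)[j] := ⟨_, rfl⟩
    have hadj : G.Adj u y := (hnbr.mem_iff u y).1 (hy ▸ List.getElem_mem _)
    have hyarr : s₀.arr 3 (j * n + u) = y := hy ▸ htab.adj u j hj'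
    have hjn : j * n + n ≤ n * n := by
      have h1 : j + 1 ≤ n := by have := hdegn u; omega
      calc j * n + n = (j + 1) * n := by ring
        _ ≤ n * n := Nat.mul_le_mul_right _ h1
    have hun := u.isLt
    have b1 : (j * n) % 2 ^ w = j * n := Nat.mod_eq_of_lt (by omega)
    have b2 : (j * n + u) % 2 ^ w = j * n + u := Nat.mod_eq_of_lt (by omega)
    have b3 : (j + 1) % 2 ^ w = j + 1 := Nat.mod_eq_of_lt (by have := hdegn u; omega)
    have b4 : (s.reg 5 - 1) % 2 ^ w = s.reg 5 - 1 := Nat.mod_eq_of_lt (by omega)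
    have b5 : (G.degree v + 1) % 2 ^ w = G.degree v + 1 := Nat.mod_eq_of_lt (by have := hdegn v; omega)
    have b6 : (col u + 1) % 2 ^ w = col u + 1 := Nat.mod_eq_of_lt (hcolW u)
    have b7 : k % 2 ^ w = k := Nat.mod_eq_of_lt hkW
    have b8 : (Q.length + 1) % 2 ^ w = Q.length + 1 := Nat.mod_eq_of_lt (by omega)
    simp only [wp_seq, wp_assign, wp_ite, wp_store, wp_skip, Expr.eval, BinOp.eval, Expr.cost,
      setReg_reg, setReg_arr, setArr_reg, setArr_arr, e0, e8, e9, e10, e11, e13, a2, a3, aca, amo,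
      h1W, b1, b2, b3, b4, b5, b6, b7, b8, hyarr, htab.deg, hcol, bool_mod hW,
      Nat.reduceEqDiff, ↓reduceIte, hca, hmo]
    constructor
    · intro hc1
      rw [eval_scan_condition hW] at hc1
      obtain ⟨c1, c2, c3⟩ := hc1
      have hadv : Advance G col (G.degree v) u y := ⟨hadj, c2, by omega⟩
      -- Queued vertices are the source or have colour below k. A neighbour of the next colour has
      -- colour k or is put into the queue.
      have hcoluk : col y ≤ k := by
        have h1 := (inv.reach u (List.getElem_mem hlt)).mem_reachLayer.1
        rcases h1 with h1 | h1
        · omega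
        · rw [c2, h1, hcolv]; omega
      refine ⟨fun c4 => ⟨fun c5 => ⟨⟨Q, h, j + 1, ?_⟩, by omega⟩, fun c5 => ⟨⟨Q, h, j + 1, ?_⟩, by omega⟩⟩,
        fun c4 => ⟨⟨Q ++ [y], h, j + 1, ?_⟩, by omega⟩⟩
      · have c4 : col y = k := by by_contra hcon; simp [hcon] at c4
        have c5 : s₀.arr mo y = T := by by_contra hcon; simp [hcon] at c5
        refine inv.mark hmk.1 hlt hj hj' hB hy hadv c4 ?_ ?_ ?_ ?_ ?_ ?_ ?_ ?_ <;>
          simp +contextual [c5]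
      · have c4 : col y = k := by by_contra hcon; simp [hcon] at c4
        have c5 : s₀.arr mo y ≠ T := by intro hcon; simp [hcon] at c5
        refine inv.mark hmk.1 hlt hj hj' hB hy hadv c4 ?_ ?_ ?_ ?_ ?_ ?_ ?_ ?_ <;>
          simp +contextual [c5, inv.found_le]
      · have c4 : col y ≠ k := by intro hcon; simp [hcon] at c4
        refine inv.push hcolv hlt hj hj' hB hy hadv (by omega) (by omega) ?_ ?_ ?_ ?_ ?_ ?_ ?_ ?_ <;>
          simp +contextual [hmk.1, hmk.1.symm]
    · intro hc1
      refine ⟨⟨Q, h, j + 1, ?_⟩, by omega⟩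
      refine inv.skip hlt hj hj' hB ?_ ?_ ?_ ?_ ?_ ?_
      · intro hadv
        change Advance G col (G.degree v) u (nbr u)[j] at hadv
        change s.arr mk (nbr u)[j] = T
        rw [← hy] at hadv ⊢
        by_contra hne
        refine (eval_scan_condition hW).2 ⟨?_, ?_, ?_⟩ hc1
        · have := hadv.2.2; omega
        · exact hadv.2.1
        · exact lt_of_le_of_ne (inv.mark_le y) hne
      all_goals simp +contextual
  · have hj : j = G.degree u := by
      by_contra hcon
      have : j < G.degree u := lt_of_le_of_ne hjdeg hcon
      simp [this] at hc
    simp only [wp_seq, wp_assign, Expr.eval, BinOp.eval, Expr.cost,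
      setReg_reg, e10, e11, h1W, hhn, Nat.zero_mod, Nat.reduceEqDiff, ↓reduceIte]
    refine ⟨⟨Q, h + 1, 0, inv.pop hnbr hlt hj ?_ ?_ ?_ ?_ ?_⟩, by omega⟩ <;>
      simp +contextual

/-- What a search from `v` with time stamp `T` achieves: unless the budget is exhausted, exactly the
vertices touched are marked, and those of colour `k` that were already marked in the array `mo`
are reported. -/
structure SearchPost (G : SimpleGraph (Fin n)) [DecidableRel G.Adj] (col : Fin n → ℕ)
    (k mk mo : ℕ) (v : Fin n) (T : ℕ) (s₀ s : State) : Prop where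
  frame_reg : ∀ r, r ≠ 5 → r ≠ 7 → r ≠ 10 → r ≠ 11 → r ≠ 12 → r ≠ 13 → r ≠ 14 →
    s.reg r = s₀.reg r
  frame_arr : ∀ a, a ≠ mk → a ≠ 8 → s.arr a = s₀.arr a
  frame_coins : s.coins = s₀.coins
  mark_le : ∀ y : Fin n, s.arr mk y ≤ T
  found_le : s.reg 7 ≤ 1
  budget_le : s.reg 5 ≤ s₀.reg 5
  budget : s₀.reg 5 ≤ s.reg 5 + scanCost G col k v
  mark_iff : s.reg 5 ≠ 0 → ∀ y : Fin n, s.arr mk y = T ↔ Touched G col k v y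
  found : s.reg 5 ≠ 0 → (s.reg 7 ≠ 0 ↔ s₀.reg 7 ≠ 0 ∨
    ∃ y : Fin n, Touched G col k v y ∧ col y = k ∧ s₀.arr mo y = T)

theorem sum_degrees_le_scanCost (hQ : Q.Nodup) (hreach : ∀ u ∈ Q, Reach G col k v u) :
    (Q.map fun u => G.degree u).sum ≤ scanCost G col k v := by
  classical
  rw [← List.sum_toFinset _ hQ]
  refine Finset.sum_le_sum_of_subset fun u hu => ?_
  simpa using hreach u (by simpa using hu)

/-- With budget left, the loop ended on an empty queue. The vertices removed are then closed under
advancing below colour k, and induction along a path from v shows that nothing reachable is missing.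
The edges paid for belong to distinct reachable vertices, hence number at most `scanCost`. -/
theorem SearchInv.post
    (inv : SearchInv G nbr col k mk mo v T s₀ s Q h j)
    (hend : ¬ (h < Q.length ∧ 0 < s.reg 5)) :
    SearchPost G col k mk mo v T s₀ s := by
  have hmark : s.reg 5 ≠ 0 → ∀ y : Fin n, s.arr mk y = T ↔ Touched G col k v y := by
    intro h5 y
    have hh : h = Q.length := by have := inv.head_le; omega
    have hall : ∀ u ∈ Q, ∀ y, Advance G col (G.degree v) u y → s.arr mk y = T := by
      intro u hu y hadv
      obtain ⟨i, hi, rfl⟩ := List.getElem_of_mem hu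
      exact inv.closed i hi (by omega) y hadv
    refine ⟨inv.touched y, ?_⟩
    rintro ⟨u, hu, hadv⟩
    refine hall u ?_ y hadv
    unfold Reach at hu
    clear hadv
    induction hu with
    | refl => exact inv.source_mem
    | tail _ hbc ih => exact inv.mem_of_mark _ (hall _ ih _ hbc.1) hbc.2
  exact {
    frame_reg := inv.frame_reg
    frame_arr := inv.frame_arr
    frame_coins := inv.frame_coins
    mark_le := inv.mark_le
    found_le := inv.found_le
    budget_le := by have := inv.budget; omega
    budget := by
      refine le_trans ?_ (Nat.add_le_add_left (sum_degrees_le_scanCost inv.nodup inv.reach) _)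
      rw [inv.budget, add_assoc]
      refine Nat.add_le_add_left ?_ _
      rcases inv.head_le.lt_or_eq with h1 | h1
      · have h2 := inv.scanned_le h1
        have h3 : ((Q.take (h + 1)).map fun u => G.degree u).sum =
            ((Q.take h).map fun u => G.degree u).sum + G.degree Q[h] := by
          rw [List.take_add_one, List.getElem?_eq_getElem h1, List.map_append, List.sum_append]; simp
        have h4 : (Q.map fun u => G.degree u).sum = ((Q.take (h + 1)).map fun u => G.degree u).sum +
            ((Q.drop (h + 1)).map fun u => G.degree u).sum := by
          rw [← List.sum_append, ← List.map_append, List.take_append_drop]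
        omega
      · rw [inv.scanned_zero h1, h1, List.take_length]; omega
    mark_iff := hmark
    found := fun h5 => by
      rw [inv.found]
      simp only [hmark h5] }

theorem search_spec {w : ℕ} {ω : ℕ → Bool}
    (hnbr : IsNbrLists G nbr) (htab : HasTables G nbr s₀) (hcol : ∀ u : Fin n, s₀.arr ca u = col u)
    (hv : s₀.reg 8 = v) (hT : s₀.reg 9 = T) (hca : ca ≠ mk ∧ ca ≠ 8) (hmo : mo ≠ mk ∧ mo ≠ 8)
    (hmk : 8 ≠ mk ∧ 2 ≠ mk ∧ 3 ≠ mk) (hW : 1 < 2 ^ w) (hnW : n * n + n < 2 ^ w)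
    (hcolW : ∀ u, col u + 1 < 2 ^ w) (hkW : k < 2 ^ w) (hBW : s₀.reg 5 < 2 ^ w) (hk : 0 < k)
    (hcolv : col v = 0) (hmark : ∀ y : Fin n, s₀.arr mk y < T) (h7 : s₀.reg 7 ≤ 1) :
    WP w ω (search k ca mk mo) s₀ fun t s =>
      SearchPost G col k mk mo v T s₀ s ∧ t + 200 * s.reg 5 ≤ 200 * s₀.reg 5 + 200 := by
  have h1W : 1 % 2 ^ w = 1 := Nat.mod_eq_of_lt hW
  unfold search
  simp only [wp_seq, wp_assign, wp_store, Expr.eval, Expr.cost, h1W, Nat.zero_mod, hv]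
  set s₁ := ((((s₀.setArr 8 0 v).setReg 10 0).setReg 11 1).setReg 13 0) with hs₁
  have r5 : s₁.reg 5 = s₀.reg 5 := by simp [hs₁]
  have r10 : s₁.reg 10 = 0 := by simp [hs₁]
  have r11 : s₁.reg 11 = 1 := by simp [hs₁]
  have hne : ∀ y : Fin n, s₁.arr mk y ≠ T := fun y => by
    have := hmark y
    simp only [hs₁, setReg_arr, setArr_arr, hmk.1.symm, if_false]
    omega
  have hinit : SearchInv G nbr col k mk mo v T s₀ s₁ [v] 0 0 := {
    frame_reg := fun r h1 h2 h3 h4 h5 h6 h7 => by simp [hs₁, h3, h4, h6]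
    frame_arr := fun a h1 h2 => by simp [hs₁, h2]
    frame_coins := by simp [hs₁]
    head_eq := r10
    head_le := Nat.zero_le _
    tail_eq := r11
    j_eq := by simp [hs₁]
    queue := fun i hi => by
      have : i = 0 := by simpa using hi
      subst this
      simp [hs₁]
    nodup := by simp
    source_mem := by simp
    reach := fun u hu => by rw [List.mem_singleton.1 hu]; exact Relation.ReflTransGen.refl
    mark_le := fun y => by
      have := hmark y
      simp only [hs₁, setReg_arr, setArr_arr, hmk.1.symm, if_false]
      omega
    touched := fun y hy => absurd hy (hne y)
    mark_of_mem := fun y hy => Or.inl (List.mem_singleton.1 hy)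
    mem_of_mark := fun y hy => absurd hy (hne y)
    closed := fun i hi h0 => absurd h0 (Nat.not_lt_zero i)
    scanned_le := fun _ => Nat.zero_le _
    scanned := fun _ i hi => absurd hi (Nat.not_lt_zero i)
    scanned_zero := fun _ => rfl
    budget := by simp [r5]
    found_le := by simpa [hs₁] using h7
    found := by
      have h1 : s₁.reg 7 = s₀.reg 7 := by simp [hs₁]
      rw [h1]
      exact ⟨Or.inl, fun h => h.resolve_right fun ⟨y, hy, _⟩ => hne y hy⟩ }
  refine (wp_loop (fun s => ∃ Q h j, SearchInv G nbr col k mk mo v T s₀ s Q h j)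
    (fun s => 100 * (2 * s.reg 5 + (s.reg 11 - s.reg 10))) ⟨_, _, _, hinit⟩ ?_).mono ?_
  · rintro s ⟨Q, h, j, inv⟩ hc
    rw [eval_lt_mul_lt_ne_zero hW] at hc
    simp only [Expr.eval, Nat.zero_mod, inv.head_eq, inv.tail_eq] at hc
    refine (searchStep_spec hnbr htab hcol hv hT hca hmo hmk hW hnW hcolW hkW hBW hk hcolv inv hc.1
      hc.2).mono fun t s' hs' => ⟨hs'.1, ?_⟩
    have := hs'.2
    simp only [Expr.cost]
    omega
  · rintro t s ⟨⟨Q, h, j, inv⟩, hc, ht⟩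
    refine ⟨inv.post ?_, ?_⟩
    · intro h1
      refine (eval_lt_mul_lt_ne_zero hW s _ _ _ _).2 ?_ hc
      simpa only [Expr.eval, Nat.zero_mod, inv.head_eq, inv.tail_eq] using h1
    · simp only [Expr.cost, r5, r10, r11] at ht ⊢
      omega

end Search

/-! ### Random colourings and the searches of one round. -/

/-- The colours in reverse order around a cycle of length `2 k`. -/
def dualColour (k c : ℕ) : ℕ := (2 * k - c) % (2 * k)

theorem dualColour_zero (k : ℕ) : dualColour k 0 = 0 := by simp [dualColour]

theorem dualColour_lt {k : ℕ} (hk : 0 < k) (c : ℕ) : dualColour k c < 2 * k :=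
  Nat.mod_lt _ (by omega)

/-- If the vertex in register `8` has colour `0`, search from it in both directions. -/
def sourceStep (k : ℕ) : Cmd :=
  .ite (.bin .eq (.read 4 (.reg 8)) (.lit 0))
    -- A fresh time stamp replaces clearing the marks. The searches exchange the two mark arrays, so
    -- the second one detects the marks of the first.
    (.assign 9 (.bin .add (.reg 9) (.lit 1)) ;; search k 4 6 7 ;; search k 5 7 6) .skip ;;
  .assign 8 (.bin .add (.reg 8) (.lit 1))

/-- Toss `b` coins and store the number with these binary digits in register `16`. -/
def tossBits : ℕ → Cmd
  | 0 => .assign 16 (.lit 0)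
  | b + 1 => tossBits b ;; .toss 17 ;;
      .assign 16 (.bin .add (.bin .mul (.lit 2) (.reg 16)) (.reg 17))

/-- Colour the vertices at random. -/
def colourVertices (k b : ℕ) : Cmd :=
  .assign 15 (.lit 0) ;;
  .loop (.bin .lt (.reg 15) (.reg 0))
    (tossBits b ;; .store 4 (.reg 15) (.reg 16) ;;
      .store 5 (.reg 15) (.bin .mod (.bin .sub (.lit (2 * k)) (.reg 16)) (.lit (2 * k))) ;;
      .assign 15 (.bin .add (.reg 15) (.lit 1)))

/-- Search from all vertices for one random colouring. -/
def round (k b : ℕ) : Cmd :=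
  colourVertices k b ;; .assign 8 (.lit 0) ;;
  .loop (.bin .lt (.reg 8) (.reg 0)) (sourceStep k) ;;
  .assign 6 (.bin .sub (.reg 6) (.lit 1))

/-- The number whose `b` binary digits are the coin tosses from the `q`-th on. -/
def bitsVal (ω : ℕ → Bool) (q : ℕ) : ℕ → ℕ
  | 0 => 0
  | b + 1 => 2 * bitsVal ω q b + (ω (q + b)).toNat

theorem bitsVal_lt (ω : ℕ → Bool) (q b : ℕ) : bitsVal ω q b < 2 ^ b := by
  induction b with
  | zero => simp [bitsVal]
  | succ b ih =>
    have := (ω (q + b)).toNat_lt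
    simp only [bitsVal, pow_succ]
    omega

theorem eval_lt_ne_zero {w : ℕ} (hw : 1 < 2 ^ w) (s : State) (e₁ e₂ : Expr) :
    (Expr.bin .lt e₁ e₂).eval w s ≠ 0 ↔ e₁.eval w s < e₂.eval w s := by
  by_cases h1 : e₁.eval w s < e₂.eval w s <;>
    simp [Expr.eval, BinOp.eval, h1, Nat.mod_eq_of_lt hw]

theorem tossBits_spec {w : ℕ} {ω : ℕ → Bool} {b : ℕ} (hW : 2 < 2 ^ w) (hb : 2 ^ b ≤ 2 ^ w)
    (s : State) :
    WP w ω (tossBits b) s fun t s' => (∀ r, r ≠ 16 → r ≠ 17 → s'.reg r = s.reg r) ∧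
      s'.arr = s.arr ∧ s'.coins = s.coins + b ∧ s'.reg 16 = bitsVal ω s.coins b ∧
      t ≤ 8 * b + 2 := by
  induction b with
  | zero => simp +contextual [tossBits, wp_assign, Expr.eval, Expr.cost, bitsVal]
  | succ b ih =>
    have hb' : 2 ^ b ≤ 2 ^ w := (Nat.pow_le_pow_right two_pos (Nat.le_succ b)).trans hb
    unfold tossBits
    rw [wp_seq]
    refine (ih hb').mono ?_
    rintro t s₁ ⟨h1, h2, h3, h4, h5⟩
    have h6 := bitsVal_lt ω s.coins (b + 1)
    simp only [bitsVal] at h6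
    have c1 : 2 % 2 ^ w = 2 := Nat.mod_eq_of_lt hW
    have c2 : (2 * bitsVal ω s.coins b) % 2 ^ w = 2 * bitsVal ω s.coins b :=
      Nat.mod_eq_of_lt (by omega)
    have c3 : (2 * bitsVal ω s.coins b + (ω (s.coins + b)).toNat) % 2 ^ w =
      2 * bitsVal ω s.coins b + (ω (s.coins + b)).toNat := Nat.mod_eq_of_lt (by omega)
    simp only [wp_seq, wp_toss, wp_assign, Expr.eval, BinOp.eval, Expr.cost, setReg_reg, setReg_arr,
      setReg_coins, h2, h3, h4, c1, c2, c3, Nat.reduceEqDiff, ↓reduceIte, bitsVal, true_and]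
    refine ⟨fun r hr hr' => ?_, by ring, by omega⟩
    simp [hr, hr', h1 r hr hr']

section Round
variable {n : ℕ} {G : SimpleGraph (Fin n)} [DecidableRel G.Adj]
  {nbr : Fin n → List (Fin n)} {col : Fin n → ℕ} {k b : ℕ}

/-- The colouring given by `b` coin tosses for every vertex, from the `q`-th toss on. -/
def colouring (n : ℕ) (ω : ℕ → Bool) (b q : ℕ) (u : Fin n) : ℕ := bitsVal ω (q + u * b) b

/-- The two searches from `v` meet. -/
def Meets (G : SimpleGraph (Fin n)) [DecidableRel G.Adj] (col : Fin n → ℕ) (k : ℕ) (v : Fin n) :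
    Prop :=
  col v = 0 ∧ ∃ y, Touched G col k v y ∧ Touched G (fun u => dualColour k (col u)) k v y ∧
    dualColour k (col y) = k

/-- The cost of both searches from `v`. -/
noncomputable def pairCost (G : SimpleGraph (Fin n)) [DecidableRel G.Adj] (col : Fin n → ℕ)
    (k : ℕ) (v : Fin n) : ℕ :=
  scanCost G col k v + scanCost G (fun u => dualColour k (col u)) k v

/-- The part of the state that persists between the searches. -/
structure Persistent (G : SimpleGraph (Fin n)) [DecidableRel G.Adj] (nbr : Fin n → List (Fin n))
    (s : State) : Prop where
  tables : HasTables G nbr s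
  mark_le : ∀ y : Fin n, s.arr 6 y ≤ s.reg 9
  mark_le' : ∀ y : Fin n, s.arr 7 y ≤ s.reg 9
  found_le : s.reg 7 ≤ 1

/-- The invariant of the loop over the sources, after the vertices below `i`. -/
structure RoundInv (G : SimpleGraph (Fin n)) [DecidableRel G.Adj] (nbr : Fin n → List (Fin n))
    (col : Fin n → ℕ) (k : ℕ) (s₀ s : State) (i : ℕ) : Prop extends Persistent G nbr s where
  col_eq : ∀ u : Fin n, s.arr 4 u = col u
  dual_eq : ∀ u : Fin n, s.arr 5 u = dualColour k (col u)
  i_eq : s.reg 8 = i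
  i_le : i ≤ n
  stamp_le : s.reg 9 ≤ s₀.reg 9 + i
  r_eq : s.reg 6 = s₀.reg 6
  coins_eq : s.coins = s₀.coins
  budget_le : s.reg 5 ≤ s₀.reg 5
  budget : s₀.reg 5 ≤ s.reg 5 + ∑ v with v.val < i ∧ col v = 0, pairCost G col k v
  found : s.reg 5 ≠ 0 → (s.reg 7 ≠ 0 ↔ s₀.reg 7 ≠ 0 ∨ ∃ v : Fin n, v.val < i ∧ Meets G col k v)

theorem sourceStep_spec {w : ℕ} {ω : ℕ → Bool} {s₀ s : State} {i : ℕ}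
    (hnbr : IsNbrLists G nbr) (hW : 1 < 2 ^ w) (hnW : n * n + n < 2 ^ w)
    (hcolW : ∀ u, col u + 1 < 2 ^ w) (hkW : 2 * k + 1 < 2 ^ w) (hBW : s₀.reg 5 < 2 ^ w)
    (hTW : s₀.reg 9 + n < 2 ^ w) (hk : 0 < k) (inv : RoundInv G nbr col k s₀ s i) (hi : i < n) :
    WP w ω (sourceStep k) s fun t s' => RoundInv G nbr col k s₀ s' (i + 1) ∧
      t + 200 * s'.reg 5 ≤ 200 * s.reg 5 + 450 := by
  obtain ⟨v, hv⟩ : ∃ v : Fin n, v.val = i := ⟨⟨i, hi⟩, rfl⟩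
  have h1W : 1 % 2 ^ w = 1 := Nat.mod_eq_of_lt hW
  have hi1 : (i + 1) % 2 ^ w = i + 1 := Nat.mod_eq_of_lt (by omega)
  have hT1 : (s.reg 9 + 1) % 2 ^ w = s.reg 9 + 1 :=
    Nat.mod_eq_of_lt (by have := inv.stamp_le; omega)
  have h4 : s.arr 4 i = col v := by rw [← hv]; exact inv.col_eq v
  have hset : ∀ p : Fin n → Prop, (∃ x : Fin n, x.val < i + 1 ∧ p x) ↔
      (∃ x : Fin n, x.val < i ∧ p x) ∨ p v := by
    intro p
    constructor
    · rintro ⟨x, hx, hp⟩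
      rcases Nat.lt_succ_iff_lt_or_eq.1 hx with h | h
      · exact Or.inl ⟨x, h, hp⟩
      · have : x = v := Fin.ext (by omega)
        exact Or.inr (this ▸ hp)
    · rintro (⟨x, hx, hp⟩ | hp)
      · exact ⟨x, by omega, hp⟩
      · exact ⟨v, by omega, hp⟩
  unfold sourceStep
  simp only [wp_seq, wp_ite, wp_assign, wp_skip, Expr.eval, BinOp.eval, Expr.cost, inv.i_eq, h4,
    Nat.zero_mod, bool_mod hW, h1W, hT1]
  refine ⟨fun hc => ?_, fun hc => ?_⟩
  · have hcol0 : col v = 0 := by by_contra hcon; simp [hcon] at hc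
    set s₁ := s.setReg 9 (s.reg 9 + 1) with hs₁
    have hsum : ∑ x with x.val < i + 1 ∧ col x = 0, pairCost G col k x =
        ∑ x with x.val < i ∧ col x = 0, pairCost G col k x + pairCost G col k v := by
      have : (univ.filter fun x : Fin n => x.val < i + 1 ∧ col x = 0) =
          insert v (univ.filter fun x : Fin n => x.val < i ∧ col x = 0) := by
        ext x
        simp only [mem_filter, mem_univ, true_and, mem_insert, Fin.ext_iff]
        constructor
        · rintro ⟨h1, h2⟩
          by_cases h3 : x.val < i
          · exact Or.inr ⟨h3, h2⟩
          · exact Or.inl (by omega)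
        · rintro (h1 | ⟨h1, h2⟩)
          · exact ⟨by omega, by rw [Fin.ext h1]; exact hcol0⟩
          · exact ⟨by omega, h2⟩
      rw [this, Finset.sum_insert (by simp [hv]), add_comm]
    have r9 : s₁.reg 9 = s.reg 9 + 1 := by simp [hs₁]
    have rr : ∀ r, r ≠ 9 → s₁.reg r = s.reg r := fun r hr => by simp [hs₁, hr]
    have ra : s₁.arr = s.arr := rfl
    have hB5 := inv.budget_le
    refine (search_spec (ω := ω) (v := v) (T := s.reg 9 + 1) hnbr ⟨?_, ?_, ?_⟩
      (ca := 4) (mk := 6) (mo := 7) (col := col) ?_ ?_ r9 (by decide) (by decide) (by decide) hW hnW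
      hcolW (by omega) ?_ hk hcol0 ?_ ?_).mono ?_
    · rw [rr 0 (by decide)]; exact inv.tables.n_eq
    · exact inv.tables.deg
    · exact inv.tables.adj
    · exact inv.col_eq
    · rw [rr 8 (by decide), hv]; exact inv.i_eq
    · rw [rr 5 (by decide)]; omega
    · intro y; have := inv.mark_le y; rw [ra]; omega
    · rw [rr 7 (by decide)]; exact inv.found_le
    rintro t₂ s₂ ⟨p, ht₂⟩
    have q9 : s₂.reg 9 = s.reg 9 + 1 := by rw [p.frame_reg 9] <;> simp [r9]
    have q8 : s₂.reg 8 = i := by rw [p.frame_reg 8, rr 8] <;> simp [inv.i_eq]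
    have q0 : s₂.reg 0 = n := by rw [p.frame_reg 0, rr 0] <;> simp [inv.tables.n_eq]
    have q6 : s₂.reg 6 = s.reg 6 := by rw [p.frame_reg 6, rr 6] <;> simp
    have qa : ∀ a, a ≠ 6 → a ≠ 8 → s₂.arr a = s.arr a := fun a h1 h2 => by
      rw [p.frame_arr a h1 h2, ra]
    have pb := p.budget_le
    rw [rr 5 (by decide)] at pb
    have hd0 : dualColour k (col v) = 0 := by rw [hcol0, dualColour_zero]
    have hdW : ∀ u, dualColour k (col u) + 1 < 2 ^ w := fun u => by
      have := dualColour_lt hk (col u); omega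
    refine (search_spec (ω := ω) (v := v) (T := s.reg 9 + 1) hnbr ⟨q0, ?_, ?_⟩
      (ca := 5) (mk := 7) (mo := 6) (col := fun u => dualColour k (col u)) ?_ ?_ q9 (by decide)
      (by decide) (by decide) hW hnW hdW (by omega) ?_ hk hd0 ?_ p.found_le).mono ?_
    · rw [qa 2 (by decide) (by decide)]; exact inv.tables.deg
    · rw [qa 3 (by decide) (by decide)]; exact inv.tables.adj
    · rw [qa 5 (by decide) (by decide)]; exact inv.dual_eq
    · rw [q8, hv]
    · omega
    · intro y; have := inv.mark_le' y; rw [qa 7 (by decide) (by decide)]; omega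
    rintro t₃ s₃ ⟨p', ht₃⟩
    have u9 : s₃.reg 9 = s.reg 9 + 1 := by rw [p'.frame_reg 9] <;> simp [q9]
    have u8 : s₃.reg 8 = i := by rw [p'.frame_reg 8] <;> simp [q8]
    have u0 : s₃.reg 0 = n := by rw [p'.frame_reg 0] <;> simp [q0]
    have u6 : s₃.reg 6 = s.reg 6 := by rw [p'.frame_reg 6] <;> simp [q6]
    have ua : ∀ a, a ≠ 6 → a ≠ 7 → a ≠ 8 → s₃.arr a = s.arr a := fun a h1 h2 h3 => by
      rw [p'.frame_arr a h2 h3, qa a h1 h3]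
    have pb' := p'.budget_le
    have r5 := rr 5 (by decide)
    rw [u8, hi1]
    refine ⟨?_, by simp only [setReg_reg]; norm_num; omega⟩
    exact {
      tables := ⟨by simpa using u0,
        by simp only [setReg_arr]; rw [ua 2 (by decide) (by decide) (by decide)]; exact inv.tables.deg,
        by simp only [setReg_arr]; rw [ua 3 (by decide) (by decide) (by decide)]; exact inv.tables.adj⟩
      mark_le := fun y => by
        have := p.mark_le y
        simp only [setReg_arr, setReg_reg]
        rw [p'.frame_arr 6 (by decide) (by decide)]
        norm_num
        omega
      mark_le' := fun y => by
        have := p'.mark_le y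
        simp only [setReg_arr, setReg_reg]
        norm_num
        omega
      found_le := by simpa using p'.found_le
      col_eq := by
        simp only [setReg_arr]; rw [ua 4 (by decide) (by decide) (by decide)]; exact inv.col_eq
      dual_eq := by
        simp only [setReg_arr]; rw [ua 5 (by decide) (by decide) (by decide)]; exact inv.dual_eq
      i_eq := by simp
      i_le := hi
      stamp_le := by have := inv.stamp_le; simp [u9]; omega
      r_eq := by simp [u6, inv.r_eq]
      coins_eq := by
        simp only [setReg_coins]
        rw [p'.frame_coins, p.frame_coins, hs₁, setReg_coins, inv.coins_eq]
      budget_le := by simp; omega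
      budget := by
        have h1 := p.budget
        have h2 := p'.budget
        have h3 := inv.budget
        rw [r5] at h1
        rw [hsum]
        simp [pairCost] at *
        omega
      found := by
        intro h5
        have h5' : s₃.reg 5 ≠ 0 := by simpa using h5
        have h5₂ : s₂.reg 5 ≠ 0 := by omega
        have h5₁ : s.reg 5 ≠ 0 := by omega
        have e1 := p'.found h5'
        have e2 := p.found h5₂
        have e3 := inv.found h5₁
        have e4 := p.mark_iff h5₂
        -- The first search reports nothing new, as array 7 holds no current stamp yet. The second
        -- reports exactly the meetings.
        have e5 : ¬ ∃ y : Fin n, Touched G col k v y ∧ col y = k ∧ s₁.arr 7 y = s.reg 9 + 1 := by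
          rintro ⟨y, -, -, h6⟩
          have := inv.mark_le' y
          rw [ra] at h6
          omega
        rw [rr 7 (by decide), e3] at e2
        rw [hset, ← or_assoc]
        simp only [setReg_reg]
        norm_num only
        simp only [↓reduceIte]
        rw [e1, e2, or_iff_left e5]
        refine or_congr_right ?_
        simp only [e4, Meets, hcol0, true_and]
        constructor
        · rintro ⟨y, h1, h2, h3⟩; exact ⟨y, h3, h1, h2⟩
        · rintro ⟨y, h3, h1, h2⟩; exact ⟨y, h1, h2, h3⟩ }
  · have hcol0 : col v ≠ 0 := by intro hcon; simp [hcon] at hc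
    rw [hi1]
    refine ⟨?_, by simp only [setReg_reg]; norm_num; omega⟩
    have hsum : (univ.filter fun x : Fin n => x.val < i + 1 ∧ col x = 0) =
          (univ.filter fun x : Fin n => x.val < i ∧ col x = 0) := by
      ext x
      simp only [mem_filter, mem_univ, true_and]
      refine ⟨fun ⟨h1, h2⟩ => ⟨?_, h2⟩, fun ⟨h1, h2⟩ => ⟨by omega, h2⟩⟩
      rcases Nat.lt_succ_iff_lt_or_eq.1 h1 with h | h
      · exact h
      · have : x = v := Fin.ext (by omega)
        exact absurd (this ▸ h2) hcol0
    exact {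
      tables := ⟨by simpa using inv.tables.n_eq, inv.tables.deg, inv.tables.adj⟩
      mark_le := fun y => by simpa using inv.mark_le y
      mark_le' := fun y => by simpa using inv.mark_le' y
      found_le := by simpa using inv.found_le
      col_eq := inv.col_eq
      dual_eq := inv.dual_eq
      i_eq := by simp
      i_le := hi
      stamp_le := by have := inv.stamp_le; simp; omega
      r_eq := by simp [inv.r_eq]
      coins_eq := inv.coins_eq
      budget_le := by simpa using inv.budget_le
      budget := by rw [hsum]; simpa using inv.budget
      found := by
        intro h5
        have e3 := inv.found (by simpa using h5)
        have e4 : ¬ Meets G col k v := fun h => hcol0 h.1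
        rw [hset, or_iff_left e4]
        simpa using e3 }

end Round

/-! ### The colouring loop and the main loop. -/

section Rounds
variable {n : ℕ} {G : SimpleGraph (Fin n)} [DecidableRel G.Adj]
  {nbr : Fin n → List (Fin n)} {k b : ℕ}

/-- The invariant of the colouring loop, after the vertices below `i`. -/
structure ColourInv (n k b : ℕ) (ω : ℕ → Bool) (s₀ s : State) (i : ℕ) : Prop where
  frame_reg : ∀ r, r ≠ 15 → r ≠ 16 → r ≠ 17 → s.reg r = s₀.reg r
  frame_arr : ∀ a, a ≠ 4 → a ≠ 5 → s.arr a = s₀.arr a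
  i_eq : s.reg 15 = i
  i_le : i ≤ n
  coins_eq : s.coins = s₀.coins + i * b
  col_eq : ∀ u : Fin n, u.val < i → s.arr 4 u = colouring n ω b s₀.coins u
  dual_eq : ∀ u : Fin n, u.val < i → s.arr 5 u = dualColour k (colouring n ω b s₀.coins u)

theorem colourVertices_spec {w : ℕ} {ω : ℕ → Bool} {s₀ : State} (hW : 2 < 2 ^ w)
    (hb : 2 ^ b ≤ 2 ^ w) (hnW : n < 2 ^ w) (hkW : 2 * k < 2 ^ w) (h0 : s₀.reg 0 = n) :
    WP w ω (colourVertices k b) s₀ fun t s =>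
      ColourInv n k b ω s₀ s n ∧ t ≤ n * (8 * b + 30) + 10 := by
  have h1W : 1 % 2 ^ w = 1 := Nat.mod_eq_of_lt (by omega)
  have hkW' : 2 * k % 2 ^ w = 2 * k := Nat.mod_eq_of_lt hkW
  unfold colourVertices
  rw [wp_seq, wp_assign]
  refine (wp_loop (fun s => ∃ i, ColourInv n k b ω s₀ s i)
    (fun s => (n - s.reg 15) * (8 * b + 30)) ⟨0, ?_⟩ ?_).mono ?_
  · exact {
      frame_reg := fun r h _ _ => by simp [h]
      frame_arr := fun _ _ _ => rfl
      i_eq := by simp [Expr.eval]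
      i_le := Nat.zero_le _
      coins_eq := by simp
      col_eq := fun u hu => absurd hu (Nat.not_lt_zero _)
      dual_eq := fun u hu => absurd hu (Nat.not_lt_zero _) }
  · rintro s ⟨i, inv⟩ hc
    have e0 : s.reg 0 = n := by rw [inv.frame_reg 0] <;> simp [h0]
    rw [eval_lt_ne_zero (by omega)] at hc
    simp only [Expr.eval, inv.i_eq, e0] at hc
    have hi1 : (i + 1) % 2 ^ w = i + 1 := Nat.mod_eq_of_lt (by omega)
    rw [wp_seq]
    refine (tossBits_spec hW hb s).mono ?_
    rintro t s₁ ⟨h1, h2, h3, h4, h5⟩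
    obtain ⟨v, hv⟩ : ∃ v : Fin n, v.val = i := ⟨⟨i, hc⟩, rfl⟩
    have hcv : bitsVal ω s.coins b = colouring n ω b s₀.coins v := by
      rw [colouring, inv.coins_eq, hv]
    have hr15 : s₁.reg 15 = i := by rw [h1 15 (by decide) (by decide)]; exact inv.i_eq
    have hd : ((2 * k - colouring n ω b s₀.coins v) % 2 ^ w % (2 * k)) % 2 ^ w =
        dualColour k (colouring n ω b s₀.coins v) := by
      rw [Nat.mod_eq_of_lt (a := 2 * k - _) (by omega)]
      exact Nat.mod_eq_of_lt (lt_of_le_of_lt (Nat.mod_le _ _) (by omega))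
    simp only [wp_seq, wp_store, wp_assign, Expr.eval, BinOp.eval, Expr.cost, setReg_reg,
      setArr_reg, h4, hr15, hcv, hkW', h1W, hi1, hd, ↓reduceIte]
    have hup : ∀ (f : ℕ → ℕ) (x : Fin n) (z : ℕ), Function.update f i z x =
        if x = v then z else f x := fun f x z => by
      rw [Function.update_apply, ← hv]; simp [Fin.ext_iff]
    refine ⟨⟨i + 1, ?_⟩, ?_⟩
    · exact {
        frame_reg := fun r c1 c2 c3 => by
          simp [c1, h1 r c2 c3, inv.frame_reg r c1 c2 c3]
        frame_arr := fun a c1 c2 => by simp [c1, c2, h2, inv.frame_arr a c1 c2]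
        i_eq := by simp
        i_le := hc
        coins_eq := by simp [h3, inv.coins_eq]; ring
        col_eq := fun u hu => by
          simp only [setReg_arr, setArr_arr, h2]
          norm_num only
          simp only [↓reduceIte, hup]
          split_ifs with huv
          · rw [huv]
          · exact inv.col_eq u (by
              have : u.val ≠ v.val := fun h => huv (Fin.ext h)
              omega)
        dual_eq := fun u hu => by
          simp only [setReg_arr, setArr_arr, h2]
          norm_num only
          simp only [↓reduceIte, hup]
          split_ifs with huv
          · rw [huv]
          · exact inv.dual_eq u (by
              have : u.val ≠ v.val := fun h => huv (Fin.ext h)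
              omega) }
    · obtain ⟨d, hd⟩ : ∃ d, n = i + 1 + d := ⟨n - (i + 1), by omega⟩
      rw [inv.i_eq, show n - (i + 1) = d by omega, show n - i = d + 1 by omega]
      have : (d + 1) * (8 * b + 30) = d * (8 * b + 30) + (8 * b + 30) := by ring
      omega
  · rintro t s ⟨⟨i, inv⟩, hc, ht⟩
    have e0 : s.reg 0 = n := by rw [inv.frame_reg 0] <;> simp [h0]
    have hin : i = n := by
      refine le_antisymm inv.i_le (not_lt.1 fun h => ?_)
      refine (eval_lt_ne_zero (by omega) s _ _).2 ?_ hc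
      simpa only [Expr.eval, inv.i_eq, e0] using h
    refine ⟨hin ▸ inv, ?_⟩
    simp [Expr.eval, Expr.cost] at ht ⊢
    omega

/-- The effect of one round on the persistent part of the state. -/
structure RoundPost (G : SimpleGraph (Fin n)) [DecidableRel G.Adj] (nbr : Fin n → List (Fin n))
    (k b : ℕ) (ω : ℕ → Bool) (s₀ s : State) : Prop extends Persistent G nbr s where
  stamp_le : s.reg 9 ≤ s₀.reg 9 + n
  r_eq : s.reg 6 = s₀.reg 6 - 1
  coins_eq : s.coins = s₀.coins + n * b
  budget_le : s.reg 5 ≤ s₀.reg 5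
  budget : s₀.reg 5 ≤ s.reg 5 + ∑ v with colouring n ω b s₀.coins v = 0,
    pairCost G (colouring n ω b s₀.coins) k v
  found : s.reg 5 ≠ 0 → (s.reg 7 ≠ 0 ↔
    s₀.reg 7 ≠ 0 ∨ ∃ v : Fin n, Meets G (colouring n ω b s₀.coins) k v)

/-- Each vertex costs 8b + 30 steps to colour and 460 as a possible source, apart from the scans,
which are charged at 200 steps per unit of budget. -/
theorem round_spec {w : ℕ} {ω : ℕ → Bool} {s₀ : State}
    (hnbr : IsNbrLists G nbr) (hW : 2 < 2 ^ w) (hnW : n * n + n < 2 ^ w)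
    (hb : 2 ^ b < 2 ^ w) (hkW : 2 * k + 1 < 2 ^ w) (hBW : s₀.reg 5 < 2 ^ w)
    (hTW : s₀.reg 9 + n < 2 ^ w) (hRW : s₀.reg 6 < 2 ^ w) (hk : 0 < k)
    (hp : Persistent G nbr s₀) :
    WP w ω (round k b) s₀ fun t s => RoundPost G nbr k b ω s₀ s ∧
      t + 200 * s.reg 5 ≤ 200 * s₀.reg 5 + (n * (8 * b + 490) + 50) := by
  have h1W : 1 % 2 ^ w = 1 := Nat.mod_eq_of_lt (by omega)
  have hnn : 0 ≤ n * n := Nat.zero_le _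
  unfold round
  rw [wp_seq]
  refine (colourVertices_spec hW hb.le (by omega) (by omega) hp.tables.n_eq).mono ?_
  rintro t₁ s₁ ⟨ci, ht₁⟩
  rw [wp_seq, wp_assign, wp_seq]
  have rr : ∀ r, r ≠ 8 → r ≠ 15 → r ≠ 16 → r ≠ 17 →
      (s₁.setReg 8 ((Expr.lit 0).eval w s₁)).reg r = s₀.reg r := fun r c1 c2 c3 c4 => by
    simp [c1, ci.frame_reg r c2 c3 c4]
  set s₂ := s₁.setReg 8 ((Expr.lit 0).eval w s₁) with hs₂
  have ra : ∀ a, a ≠ 4 → a ≠ 5 → s₂.arr a = s₀.arr a := ci.frame_arr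
  set col := colouring n ω b s₀.coins with hcol
  have hcolW : ∀ u, col u + 1 < 2 ^ w := fun u => by
    have := bitsVal_lt ω (s₀.coins + u * b) b
    simp only [hcol, colouring]
    omega
  have r5 : s₂.reg 5 = s₀.reg 5 := rr 5 (by decide) (by decide) (by decide) (by decide)
  have r9 : s₂.reg 9 = s₀.reg 9 := rr 9 (by decide) (by decide) (by decide) (by decide)
  have r7 : s₂.reg 7 = s₀.reg 7 := rr 7 (by decide) (by decide) (by decide) (by decide)
  have r6 : s₂.reg 6 = s₀.reg 6 := rr 6 (by decide) (by decide) (by decide) (by decide)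
  have r8 : s₂.reg 8 = 0 := by simp [hs₂, Expr.eval]
  refine (wp_loop (fun s => ∃ i, RoundInv G nbr col k s₂ s i)
    (fun s => 200 * s.reg 5 + (n - s.reg 8) * 460) ⟨0, ?_⟩ ?_).mono ?_
  · exact {
      tables := ⟨by rw [rr 0 (by decide) (by decide) (by decide) (by decide)]; exact hp.tables.n_eq,
        by rw [ra 2 (by decide) (by decide)]; exact hp.tables.deg,
        by rw [ra 3 (by decide) (by decide)]; exact hp.tables.adj⟩
      mark_le := by rw [ra 6 (by decide) (by decide), r9]; exact hp.mark_le
      mark_le' := by rw [ra 7 (by decide) (by decide), r9]; exact hp.mark_le'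
      found_le := by rw [r7]; exact hp.found_le
      col_eq := fun u => ci.col_eq u u.isLt
      dual_eq := fun u => ci.dual_eq u u.isLt
      i_eq := r8
      i_le := Nat.zero_le _
      stamp_le := le_rfl
      r_eq := rfl
      coins_eq := rfl
      budget_le := le_rfl
      budget := Nat.le_add_right _ _
      found := fun _ => by simp }
  · rintro s ⟨i, inv⟩ hc
    rw [eval_lt_ne_zero (by omega)] at hc
    simp only [Expr.eval, inv.i_eq, inv.tables.n_eq] at hc
    refine (sourceStep_spec (ω := ω) hnbr (by omega) hnW hcolW hkW (by omega) (by omega) hk inv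
      hc).mono ?_
    rintro t s' ⟨inv', ht⟩
    refine ⟨⟨_, inv'⟩, ?_⟩
    rw [inv.i_eq, inv'.i_eq]
    simp only [Expr.cost]
    omega
  · rintro t s ⟨⟨i, inv⟩, hc, ht⟩
    have hin : i = n := by
      refine le_antisymm inv.i_le (not_lt.1 fun h => ?_)
      refine (eval_lt_ne_zero (by omega) s _ _).2 ?_ hc
      simpa only [Expr.eval, inv.i_eq, inv.tables.n_eq] using h
    subst hin
    have hfil : (univ.filter fun v : Fin i => v.val < i ∧ col v = 0) =
        univ.filter fun v : Fin i => col v = 0 := by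
      ext v; simp
    have hsub : (s.reg 6 - 1) % 2 ^ w = s.reg 6 - 1 := Nat.mod_eq_of_lt (by
      have := inv.r_eq; omega)
    simp only [wp_assign, Expr.eval, BinOp.eval, Expr.cost, h1W, hsub]
    refine ⟨?_, ?_⟩
    · exact {
        tables := ⟨by simpa using inv.tables.n_eq, inv.tables.deg, inv.tables.adj⟩
        mark_le := by simpa using inv.mark_le
        mark_le' := by simpa using inv.mark_le'
        found_le := by simpa using inv.found_le
        stamp_le := by simpa [r9] using inv.stamp_le
        r_eq := by simp [inv.r_eq, r6]
        coins_eq := by simp [inv.coins_eq, hs₂, ci.coins_eq]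
        budget_le := by simpa [r5] using inv.budget_le
        budget := by
          have := inv.budget
          rw [hfil, r5] at this
          simpa using this
        found := fun h5 => by
          have := inv.found (by simpa using h5)
          rw [r7] at this
          simpa using this }
    · simp only [r5, r8, Expr.cost, setReg_reg] at ht ⊢
      norm_num at ht ⊢
      have : i * (8 * b + 490) = i * (8 * b + 30) + i * 460 := by ring
      omega

/-- The main loop: a number of rounds given by register `6`. -/
def rounds (k b : ℕ) : Cmd := .loop (.bin .lt (.lit 0) (.reg 6)) (round k b)

/-- The invariant of the main loop, after `ρ` rounds. -/
structure RoundsInv (G : SimpleGraph (Fin n)) [DecidableRel G.Adj] (nbr : Fin n → List (Fin n))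
    (k b : ℕ) (ω : ℕ → Bool) (s₀ s : State) (ρ : ℕ) : Prop extends Persistent G nbr s where
  stamp_le : s.reg 9 ≤ ρ * n
  r_eq : s.reg 6 + ρ = s₀.reg 6
  coins_eq : s.coins = ρ * (n * b)
  budget_le : s.reg 5 ≤ s₀.reg 5
  budget : s₀.reg 5 ≤ s.reg 5 + ∑ r ∈ range ρ, ∑ v with colouring n ω b (r * (n * b)) v = 0,
    pairCost G (colouring n ω b (r * (n * b))) k v
  found : s.reg 5 ≠ 0 → (s.reg 7 ≠ 0 ↔
    ∃ r < ρ, ∃ v : Fin n, Meets G (colouring n ω b (r * (n * b))) k v)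

/-- The loop does not stop early, not even when the budget is exhausted. Round r therefore always
reads the block of n * b tosses starting at r * (n * b), and distinct rounds are independent. -/
theorem rounds_spec {w : ℕ} {ω : ℕ → Bool} {s₀ : State}
    (hnbr : IsNbrLists G nbr) (hW : 2 < 2 ^ w) (hnW : n * n + n < 2 ^ w)
    (hb : 2 ^ b < 2 ^ w) (hkW : 2 * k + 1 < 2 ^ w) (hBW : s₀.reg 5 < 2 ^ w)
    (hTW : s₀.reg 6 * n < 2 ^ w) (hRW : s₀.reg 6 < 2 ^ w) (hk : 0 < k)
    (hp : Persistent G nbr s₀) (h7 : s₀.reg 7 = 0) (h9 : s₀.reg 9 = 0) (hcoins : s₀.coins = 0) :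
    WP w ω (rounds k b) s₀ fun t s => RoundsInv G nbr k b ω s₀ s (s₀.reg 6) ∧
      t ≤ 200 * s₀.reg 5 + s₀.reg 6 * (n * (8 * b + 490) + 60) + 10 := by
  unfold rounds
  refine (wp_loop (fun s => ∃ ρ, RoundsInv G nbr k b ω s₀ s ρ)
    (fun s => 200 * s.reg 5 + s.reg 6 * (n * (8 * b + 490) + 60)) ⟨0, ?_⟩ ?_).mono ?_
  · exact { hp with
      stamp_le := by simp [h9]
      r_eq := rfl
      coins_eq := by simp [hcoins]
      budget_le := le_rfl
      budget := Nat.le_add_right _ _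
      found := fun _ => by simp [h7] }
  · rintro s ⟨ρ, inv⟩ hc
    rw [eval_lt_ne_zero (by omega)] at hc
    simp only [Expr.eval, Nat.zero_mod] at hc
    have hr := inv.r_eq
    have hst : s.reg 9 + n ≤ s₀.reg 6 * n := by
      have h1 := inv.stamp_le
      calc s.reg 9 + n ≤ ρ * n + n := by omega
        _ = (ρ + 1) * n := by ring
        _ ≤ _ := Nat.mul_le_mul_right _ (by omega)
    have hb5 := inv.budget_le
    refine (round_spec (ω := ω) hnbr hW hnW hb hkW (by omega) (by omega) (by omega) hk
      inv.toPersistent).mono ?_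
    rintro t s' ⟨p, ht⟩
    have hb5' := p.budget_le
    have hpb := p.budget
    have hpf := p.found
    rw [inv.coins_eq] at hpb hpf
    refine ⟨⟨ρ + 1, ?_⟩, ?_⟩
    · exact { p.toPersistent with
        stamp_le := by
          have h1 := inv.stamp_le
          have h2 := p.stamp_le
          have : (ρ + 1) * n = ρ * n + n := by ring
          omega
        r_eq := by have := p.r_eq; omega
        coins_eq := by rw [p.coins_eq, inv.coins_eq]; ring
        budget_le := by omega
        budget := by
          have := inv.budget
          rw [Finset.sum_range_succ]
          omega
        found := fun h5 => by
          rw [hpf h5, inv.found (by omega)]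
          constructor
          · rintro (⟨r, h1, h2⟩ | h1)
            · exact ⟨r, by omega, h2⟩
            · exact ⟨ρ, by omega, h1⟩
          · rintro ⟨r, h1, h2⟩
            rcases Nat.lt_succ_iff_lt_or_eq.1 h1 with h | rfl
            · exact Or.inl ⟨r, h, h2⟩
            · exact Or.inr h2 }
    · obtain ⟨d, hd⟩ : ∃ d, s.reg 6 = d + 1 := ⟨s.reg 6 - 1, by omega⟩
      rw [p.r_eq, hd, Nat.add_sub_cancel]
      have : (d + 1) * (n * (8 * b + 490) + 60) =
        d * (n * (8 * b + 490) + 60) + (n * (8 * b + 490) + 60) := by ring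
      simp only [Expr.cost]
      omega
  · rintro t s ⟨⟨ρ, inv⟩, hc, ht⟩
    have h6 : s.reg 6 = 0 := by
      by_contra h
      refine (eval_lt_ne_zero (by omega) s _ _).2 ?_ hc
      simp only [Expr.eval, Nat.zero_mod]
      omega
    have hr := inv.r_eq
    have : ρ = s₀.reg 6 := by omega
    refine ⟨this ▸ inv, ?_⟩
    simp only [Expr.cost] at ht
    omega

end Rounds

/-! ### Adjacency tables, parameters and the whole program. -/

/-- The list of the second components of the pairs in `H` with first component `u`. -/
def nbrList {n : ℕ} (H : List (Fin n × Fin n)) (u : Fin n) : List (Fin n) :=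
  (H.filter fun p => p.1 = u).map Prod.snd

/-- Both orientations of the pairs in a list. -/
def bothWays {n : ℕ} (L : List (Fin n × Fin n)) : List (Fin n × Fin n) :=
  L.flatMap fun p => [(p.1, p.2), (p.2, p.1)]

/-- Enter the edge in register `15` into the tables, with endpoints in the arrays `a` and `c`. -/
def addHalfEdge (a c : ℕ) : Cmd :=
  .store 3 (.bin .add (.bin .mul (.read 2 (.read a (.reg 15))) (.reg 0)) (.read a (.reg 15)))
    (.read c (.reg 15)) ;;
  .store 2 (.read a (.reg 15)) (.bin .add (.read 2 (.read a (.reg 15))) (.lit 1))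

/-- Compute the tables of the degrees and the neighbours. -/
def buildTables : Cmd :=
  .assign 15 (.lit 0) ;;
  .loop (.bin .lt (.reg 15) (.reg 1))
    (addHalfEdge 0 1 ;; addHalfEdge 1 0 ;; .assign 15 (.bin .add (.reg 15) (.lit 1)))

/-- Compute the logarithm of the number of vertices in register `2`. -/
def computeLog : Cmd :=
  .assign 2 (.lit 0) ;; .assign 3 (.lit 1) ;;
  .loop (.bin .lt (.reg 3) (.reg 0))
    (.assign 3 (.bin .mul (.lit 2) (.reg 3)) ;; .assign 2 (.bin .add (.reg 2) (.lit 1)))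

/-- The expression for a power of a register. -/
def powExpr (x : ℕ) : ℕ → Expr
  | 0 => .lit 1
  | e + 1 => .bin .mul (powExpr x e) (.reg x)

/-- Compute the degree parameter in register `4`. -/
def computeRoot (k : ℕ) : Cmd :=
  .assign 4 (.lit 1) ;;
  .loop (.bin .lt (powExpr 4 (k + 1)) (.reg 1)) (.assign 4 (.bin .add (.reg 4) (.lit 1)))

/-- The detection of cycles of length `2 k`. -/
def detect (k b Kr Kb : ℕ) : Cmd :=
  buildTables ;; computeLog ;; computeRoot k ;;
  .assign 6 (.bin .mul (.lit Kr) (.reg 2)) ;;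
  -- Of the k logarithms, one counts rounds and k - 1 come from the cost of a round. The extra 1
  -- leaves the budget positive when the cost bound holds.
  .assign 5 (.bin .add (.bin .mul (.bin .mul (.bin .mul (.lit Kb) (.reg 1)) (powExpr 4 (k - 1)))
    (powExpr 2 k)) (.lit 1)) ;;
  rounds k b ;;
  -- The answer is yes after a meeting or an exhausted budget.
  .assign 0 (.bin .add (.reg 7) (.bin .eq (.reg 5) (.lit 0)))

theorem powExpr_cost (x e : ℕ) : (powExpr x e).cost = 2 * e + 1 := by
  induction e with
  | zero => rfl
  | succ e ih => simp only [powExpr, Expr.cost, ih]; ring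

theorem powExpr_eval {w : ℕ} {s : State} {x e : ℕ} (hx : 1 ≤ s.reg x)
    (h : s.reg x ^ e < 2 ^ w) : (powExpr x e).eval w s = s.reg x ^ e := by
  induction e with
  | zero => simpa [powExpr, Expr.eval] using Nat.mod_eq_of_lt h
  | succ e ih =>
    have h1 : s.reg x ^ e ≤ s.reg x ^ (e + 1) := Nat.pow_le_pow_right hx (Nat.le_succ e)
    simp only [powExpr, Expr.eval, BinOp.eval, ih (lt_of_le_of_lt h1 h), ← pow_succ]
    exact Nat.mod_eq_of_lt h

section Tables
variable {n : ℕ}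

theorem nbrList_append (H : List (Fin n × Fin n)) (x y u : Fin n) :
    nbrList (H ++ [(x, y)]) u = if u = x then nbrList H u ++ [y] else nbrList H u := by
  by_cases h : u = x
  · subst h; simp [nbrList]
  · have h' : x ≠ u := fun e => h e.symm
    simp [nbrList, h, h']

theorem length_nbrList_le (H : List (Fin n × Fin n)) (u : Fin n) :
    (nbrList H u).length ≤ H.length := by
  simpa [nbrList] using List.length_filter_le _ _

theorem length_bothWays (L : List (Fin n × Fin n)) : (bothWays L).length = 2 * L.length := by
  induction L with
  | nil => rfl
  | cons p L ih => simp [bothWays] at ih ⊢; omega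

theorem mem_nbrList_bothWays (L : List (Fin n × Fin n)) (u y : Fin n) :
    y ∈ nbrList (bothWays L) u ↔ s(u, y) ∈ L.map fun p => s(p.1, p.2) := by
  simp only [nbrList, bothWays, List.mem_map, List.mem_filter, List.mem_flatMap, decide_eq_true_eq]
  constructor
  · rintro ⟨q, ⟨⟨p, hp, hq⟩, h1⟩, rfl⟩
    refine ⟨p, hp, ?_⟩
    simp only [List.mem_cons, List.not_mem_nil, or_false] at hq
    rcases hq with rfl | rfl
    · simp only at h1; rw [h1]
    · simp only at h1; rw [← h1, Sym2.eq_swap]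
  · rintro ⟨p, hp, h⟩
    rw [Sym2.eq_iff] at h
    rcases h with ⟨h1, h2⟩ | ⟨h1, h2⟩
    · exact ⟨(p.1, p.2), ⟨⟨p, hp, by simp⟩, h1⟩, h2⟩
    · exact ⟨(p.2, p.1), ⟨⟨p, hp, by simp⟩, h2⟩, h1⟩

/-- Each edge is listed in one orientation only and is not a loop, so its two directed copies never
repeat a neighbour. -/
theorem nodup_nbrList_bothWays {L : List (Fin n × Fin n)}
    (h : (L.map fun p => s(p.1, p.2)).Nodup) (hloop : ∀ p ∈ L, p.1 ≠ p.2) (u : Fin n) :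
    (nbrList (bothWays L) u).Nodup := by
  induction L with
  | nil => simp [nbrList, bothWays]
  | cons p L ih =>
    have hcons : nbrList (bothWays (p :: L)) u =
        nbrList [(p.1, p.2), (p.2, p.1)] u ++ nbrList (bothWays L) u := by
      change List.map _ (List.filter _ ([(p.1, p.2), (p.2, p.1)] ++ bothWays L)) = _
      rw [List.filter_append, List.map_append]
      rfl
    rw [List.map_cons, List.nodup_cons] at h
    rw [hcons, List.nodup_append]
    refine ⟨?_, ih h.2 fun q hq => hloop q (List.mem_cons_of_mem _ hq), ?_⟩
    · have hp := hloop p List.mem_cons_self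
      by_cases h1 : p.1 = u
      · have h2 : p.2 ≠ u := fun e => hp (h1.trans e.symm)
        simp [nbrList, h1, h2]
      · by_cases h2 : p.2 = u <;> simp [nbrList, h1, h2]
    · rintro a ha c hc rfl
      refine h.1 ?_
      have h1 : s(u, a) = s(p.1, p.2) := by
        have := (mem_nbrList_bothWays [p] u a).1 (by simpa [bothWays] using ha)
        simpa using this
      exact h1 ▸ (mem_nbrList_bothWays L u a).1 hc

theorem isNbrLists_of_isEdgeList {G : SimpleGraph (Fin n)} [DecidableRel G.Adj]
    {L : List (Fin n × Fin n)} (hL : IsEdgeList G L) : IsNbrLists G (nbrList (bothWays L)) := by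
  have hmem : ∀ u y, y ∈ nbrList (bothWays L) u ↔ G.Adj u y := fun u y => by
    rw [mem_nbrList_bothWays, hL.2, SimpleGraph.mem_edgeSet]
  refine ⟨fun u => ?_, hmem⟩
  have hloop : ∀ p ∈ L, p.1 ≠ p.2 := fun p hp => by
    have : s(p.1, p.2) ∈ G.edgeSet := (hL.2 _).1 (List.mem_map.2 ⟨p, hp, rfl⟩)
    exact ((SimpleGraph.mem_edgeSet G).1 this).ne
  rw [← List.toFinset_card_of_nodup (nodup_nbrList_bothWays hL.1 hloop u), SimpleGraph.degree]
  congr 1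
  ext y
  simp [hmem]

/-- The tables represent the pairs in the list `H`. -/
structure TablesFor (H : List (Fin n × Fin n)) (s : State) : Prop where
  deg : ∀ u : Fin n, s.arr 2 u = (nbrList H u).length
  adj : ∀ (u : Fin n) (j : ℕ) (h : j < (nbrList H u).length), s.arr 3 (j * n + u) = (nbrList H u)[j]

theorem addHalfEdge_spec {w : ℕ} {ω : ℕ → Bool} {a c : ℕ} {s : State}
    {H : List (Fin n × Fin n)} {x y : Fin n} (ha : a ≠ 2 ∧ a ≠ 3)
    (h0 : s.reg 0 = n) (hx : s.arr a (s.reg 15) = x) (hy : s.arr c (s.reg 15) = y)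
    (hW : (H.length + 2) * n < 2 ^ w) (hW' : H.length + 2 < 2 ^ w) (htab : TablesFor H s) :
    WP w ω (addHalfEdge a c) s fun t s' => TablesFor (H ++ [(x, y)]) s' ∧ s'.reg = s.reg ∧
      (∀ e, e ≠ 2 → e ≠ 3 → s'.arr e = s.arr e) ∧ s'.coins = s.coins ∧ t ≤ 30 := by
  have hlen := length_nbrList_le H x
  have hxn := x.isLt
  have hmul : (nbrList H x).length * n + n ≤ (H.length + 2) * n := by
    calc (nbrList H x).length * n + n = ((nbrList H x).length + 1) * n := by ring
      _ ≤ _ := Nat.mul_le_mul_right _ (by omega)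
  have c1 : ((nbrList H x).length * n) % 2 ^ w = (nbrList H x).length * n :=
    Nat.mod_eq_of_lt (by omega)
  have c2 : ((nbrList H x).length * n + x) % 2 ^ w = (nbrList H x).length * n + x :=
    Nat.mod_eq_of_lt (by omega)
  have c3 : ((nbrList H x).length + 1) % 2 ^ w = (nbrList H x).length + 1 :=
    Nat.mod_eq_of_lt (by omega)
  have c4 : 1 % 2 ^ w = 1 := Nat.mod_eq_of_lt (by omega)
  unfold addHalfEdge
  simp only [wp_seq, wp_store, Expr.eval, BinOp.eval, Expr.cost, setArr_reg, setArr_arr, h0, hx, hy,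
    ha, htab.deg x, c1, c2, c3, c4, Nat.reduceEqDiff, ↓reduceIte]
  refine ⟨⟨fun u => ?_, fun u j hj => ?_⟩, trivial, fun e h2 h3 => ?_, rfl, by omega⟩
  · simp only [setArr_arr]
    norm_num only
    simp only [↓reduceIte, Function.update_apply, nbrList_append, ← Fin.ext_iff]
    split_ifs with h
    · simp [h]
    · exact htab.deg u
  · simp only [setArr_arr]
    norm_num only
    simp only [↓reduceIte, Function.update_apply]
    have hun := u.isLt
    have hn : 0 < n := by omega
    -- Since u < n, the cell number determines both j and u, so the write changes just the new
    -- entry.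
    by_cases h : j * n + u = (nbrList H x).length * n + x
    · have hj' : j = (nbrList H x).length := by
        have h1 := congrArg (· / n) h
        simpa [Nat.add_div_of_dvd_right, mul_comm _ n, Nat.mul_add_div hn, Nat.div_eq_of_lt hun,
          Nat.div_eq_of_lt hxn] using h1
      have hux : u = x := Fin.ext (by rw [hj'] at h; omega)
      subst hux
      rw [if_pos h]
      simp only [nbrList_append, if_true]
      subst hj'
      simp
    · rw [if_neg h]
      have hj1 : j < (nbrList H u).length := by
        rw [nbrList_append] at hj
        split_ifs at hj with hux
        · subst hux
          simp only [List.length_append, List.length_singleton] at hj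
          have : j ≠ (nbrList H u).length := fun e => h (by rw [e])
          omega
        · exact hj
      rw [htab.adj u j hj1]
      congr 1
      simp only [nbrList_append]
      split_ifs
      · exact (List.getElem_append_left hj1).symm
      · rfl
  · simp [h2, h3]

theorem buildTables_spec {w : ℕ} {ω : ℕ → Bool} (L : List (Fin n × Fin n))
    (hW : (2 * L.length + 2) * n < 2 ^ w) (hW' : 2 * L.length + 2 < 2 ^ w) :
    WP w ω buildTables (input L) fun t s => TablesFor (bothWays L) s ∧
      (∀ r, r ≠ 15 → s.reg r = (input L).reg r) ∧
      (∀ e, e ≠ 2 → e ≠ 3 → s.arr e = (input L).arr e) ∧ s.coins = 0 ∧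
      t ≤ 80 * L.length + 10 := by
  have h1W : 1 % 2 ^ w = 1 := Nat.mod_eq_of_lt (by omega)
  unfold buildTables
  rw [wp_seq, wp_assign]
  refine (wp_loop (fun s => ∃ i, i ≤ L.length ∧ s.reg 15 = i ∧ TablesFor (bothWays (L.take i)) s ∧
      (∀ r, r ≠ 15 → s.reg r = (input L).reg r) ∧
      (∀ e, e ≠ 2 → e ≠ 3 → s.arr e = (input L).arr e) ∧ s.coins = 0)
    (fun s => (L.length - s.reg 15) * 80) ⟨0, ?_⟩ ?_).mono ?_
  · refine ⟨Nat.zero_le _, by simp [Expr.eval], ⟨?_, ?_⟩, ?_, fun _ _ _ => rfl, rfl⟩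
    · intro u; simp [bothWays, nbrList, input]
    · intro u j hj; simp [bothWays, nbrList] at hj
    · intro r hr; simp [hr]
  · rintro s ⟨i, hi, h15, htab, hreg, harr, hcoins⟩ hc
    have e1 : s.reg 1 = L.length := by rw [hreg 1 (by decide)]; simp [input]
    have e0 : s.reg 0 = n := by rw [hreg 0 (by decide)]; simp [input]
    rw [eval_lt_ne_zero (by omega)] at hc
    simp only [Expr.eval, h15, e1] at hc
    have hi1 : (i + 1) % 2 ^ w = i + 1 := Nat.mod_eq_of_lt (by omega)
    have hlen : (bothWays (L.take i)).length = 2 * i := by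
      rw [length_bothWays, List.length_take, Nat.min_eq_left hi]
    have a0 : s.arr 0 i = (L[i]).1 := by
      rw [harr 0 (by decide) (by decide)]; simp [input, hc]
    have a1 : s.arr 1 i = (L[i]).2 := by
      rw [harr 1 (by decide) (by decide)]; simp [input, hc]
    have hmul : (2 * i + 1 + 2) * n ≤ (2 * L.length + 2) * n := Nat.mul_le_mul_right _ (by omega)
    have hmul' : (2 * i + 2) * n ≤ (2 * L.length + 2) * n := Nat.mul_le_mul_right _ (by omega)
    rw [wp_seq]
    refine (addHalfEdge_spec (by decide) e0 (by rw [h15]; exact a0) (by rw [h15]; exact a1)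
      (by rw [hlen]; omega) (by rw [hlen]; omega) htab).mono ?_
    rintro t₁ s₁ ⟨tab₁, reg₁, arr₁, coins₁, ht₁⟩
    have hlen₁ : (bothWays (L.take i) ++ [((L[i]).1, (L[i]).2)]).length = 2 * i + 1 := by
      simp [hlen]
    rw [wp_seq]
    refine (addHalfEdge_spec (x := (L[i]).2) (y := (L[i]).1) (by decide) (by rw [reg₁, e0])
      (by rw [reg₁, h15, arr₁ 1 (by decide) (by decide)]; exact a1)
      (by rw [reg₁, h15, arr₁ 0 (by decide) (by decide)]; exact a0)
      (by rw [hlen₁]; omega) (by rw [hlen₁]; omega) tab₁).mono ?_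
    rintro t₂ s₂ ⟨tab₂, reg₂, arr₂, coins₂, ht₂⟩
    have g15 : s₂.reg 15 = i := by rw [reg₂, reg₁, h15]
    simp only [wp_assign, Expr.eval, BinOp.eval, Expr.cost, g15, h1W, hi1]
    refine ⟨⟨i + 1, hc, by simp, ?_, ?_, ?_, ?_⟩, ?_⟩
    · have : bothWays (L.take (i + 1)) =
          bothWays (L.take i) ++ [((L[i]).1, (L[i]).2)] ++ [((L[i]).2, (L[i]).1)] := by
        rw [List.take_add_one, List.getElem?_eq_getElem hc, bothWays, List.flatMap_append,
          List.append_assoc]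
        rfl
      rw [this]
      exact ⟨tab₂.deg, tab₂.adj⟩
    · intro r hr; simp [hr, reg₂, reg₁, hreg r hr]
    · intro e h2 h3
      rw [setReg_arr, arr₂ e h2 h3, arr₁ e h2 h3, harr e h2 h3]
    · rw [setReg_coins, coins₂, coins₁, hcoins]
    · simp only [setReg_reg, if_true, h15]
      omega
  · rintro t s ⟨⟨i, hi, h15, htab, hreg, harr, hcoins⟩, hc, ht⟩
    have e1 : s.reg 1 = L.length := by rw [hreg 1 (by decide)]; simp [input]
    have hin : i = L.length := by
      refine le_antisymm hi (not_lt.1 fun h => ?_)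
      refine (eval_lt_ne_zero (by omega) s _ _).2 ?_ hc
      simpa only [Expr.eval, h15, e1] using h
    rw [hin, List.take_length] at htab
    refine ⟨htab, hreg, harr, hcoins, ?_⟩
    simp [Expr.eval, Expr.cost] at ht ⊢
    omega

end Tables

theorem computeLog_spec {w : ℕ} {ω : ℕ → Bool} {n : ℕ} {s : State} (hn : 2 ≤ n)
    (hW : 2 * n < 2 ^ w) (h0 : s.reg 0 = n) :
    WP w ω computeLog s fun t s' => s'.reg 2 = Nat.clog 2 n ∧
      (∀ r, r ≠ 2 → r ≠ 3 → s'.reg r = s.reg r) ∧ s'.arr = s.arr ∧ s'.coins = s.coins ∧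
      t ≤ 20 * n + 10 := by
  have h1W : 1 % 2 ^ w = 1 := Nat.mod_eq_of_lt (by omega)
  have h2W : 2 % 2 ^ w = 2 := Nat.mod_eq_of_lt (by omega)
  unfold computeLog
  rw [wp_seq, wp_assign, wp_seq, wp_assign]
  refine (wp_loop (fun s' => ∃ l, s'.reg 2 = l ∧ s'.reg 3 = 2 ^ l ∧ (l = 0 ∨ 2 ^ (l - 1) < n) ∧
      (∀ r, r ≠ 2 → r ≠ 3 → s'.reg r = s.reg r) ∧ s'.arr = s.arr ∧ s'.coins = s.coins)
    (fun s => 20 * (n - s.reg 3)) ⟨0, ?_⟩ ?_).mono ?_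
  · refine ⟨by simp [Expr.eval], by simp [Expr.eval, h1W], Or.inl rfl, ?_, rfl, rfl⟩
    intro r h2 h3
    simp [h2, h3]
  · rintro s₁ ⟨l, h2, h3, hl, hreg, harr, hcoins⟩ hc
    have e0 : s₁.reg 0 = n := by rw [hreg 0 (by decide) (by decide), h0]
    rw [eval_lt_ne_zero (by omega)] at hc
    simp only [Expr.eval, h3, e0] at hc
    have hl1 : l < 2 ^ l := Nat.lt_two_pow_self
    have c1 : (2 * 2 ^ l) % 2 ^ w = 2 * 2 ^ l := Nat.mod_eq_of_lt (by omega)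
    have c2 : (l + 1) % 2 ^ w = l + 1 := Nat.mod_eq_of_lt (by omega)
    simp only [wp_seq, wp_assign, Expr.eval, BinOp.eval, Expr.cost, setReg_reg, h2, h3, h1W, h2W,
      c1, c2, Nat.reduceEqDiff, ↓reduceIte]
    refine ⟨⟨l + 1, rfl, by rw [pow_succ, mul_comm], Or.inr (by simpa using hc), ?_, ?_, ?_⟩, ?_⟩
    · intro r c2 c3; simp [c2, c3, hreg r c2 c3]
    · simpa using harr
    · simpa using hcoins
    · omega
  · rintro t s₁ ⟨⟨l, h2, h3, hl, hreg, harr, hcoins⟩, hc, ht⟩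
    have e0 : s₁.reg 0 = n := by rw [hreg 0 (by decide) (by decide), h0]
    have hnl : n ≤ 2 ^ l := by
      by_contra h
      refine (eval_lt_ne_zero (by omega) s₁ _ _).2 ?_ hc
      simp only [Expr.eval, h3, e0]
      omega
    refine ⟨?_, hreg, harr, hcoins, ?_⟩
    · rw [h2]
      refine le_antisymm ?_ ((Nat.clog_le_iff_le_pow one_lt_two).2 hnl)
      rcases hl with rfl | hl
      · exact Nat.zero_le _
      · have := (Nat.lt_clog_iff_pow_lt one_lt_two).2 hl
        omega
    · simp [Expr.cost, Expr.eval, h1W] at ht ⊢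
      omega

/-- A linear search is affordable, as O(m) steps are within the time bound. The candidate never
exceeds m, which keeps its powers below the word size. -/
theorem computeRoot_spec {w : ℕ} {ω : ℕ → Bool} {m k : ℕ} {s : State} (hm : 1 ≤ m)
    (hW : m ^ (k + 1) < 2 ^ w) (hW' : m + 1 < 2 ^ w) (h1 : s.reg 1 = m) :
    WP w ω (computeRoot k) s fun t s' =>
      (1 ≤ s'.reg 4 ∧ s'.reg 4 ≤ m ∧ m ≤ s'.reg 4 ^ (k + 1) ∧
        (s'.reg 4 = 1 ∨ (s'.reg 4 - 1) ^ (k + 1) < m)) ∧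
      (∀ r, r ≠ 4 → s'.reg r = s.reg r) ∧ s'.arr = s.arr ∧ s'.coins = s.coins ∧
      t ≤ (2 * k + 20) * m + 2 * k + 20 := by
  have h1W : 1 % 2 ^ w = 1 := Nat.mod_eq_of_lt (by omega)
  unfold computeRoot
  rw [wp_seq, wp_assign]
  refine (wp_loop (fun s' => (1 ≤ s'.reg 4 ∧ s'.reg 4 ≤ m ∧
        (s'.reg 4 = 1 ∨ (s'.reg 4 - 1) ^ (k + 1) < m)) ∧
      (∀ r, r ≠ 4 → s'.reg r = s.reg r) ∧ s'.arr = s.arr ∧ s'.coins = s.coins)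
    (fun s => (2 * k + 20) * (m - s.reg 4)) ?_ ?_).mono ?_
  · simp +contextual [Expr.eval, h1W, hm]
  · rintro s₁ ⟨⟨d1, d2, d3⟩, hreg, harr, hcoins⟩ hc
    have e1 : s₁.reg 1 = m := by rw [hreg 1 (by decide), h1]
    rw [eval_lt_ne_zero (by omega), powExpr_eval d1
      (lt_of_le_of_lt (Nat.pow_le_pow_left d2 _) hW)] at hc
    simp only [Expr.eval, e1] at hc
    have hlt : s₁.reg 4 < m := lt_of_le_of_lt (Nat.le_self_pow (by omega) _) hc
    have c1 : (s₁.reg 4 + 1) % 2 ^ w = s₁.reg 4 + 1 := Nat.mod_eq_of_lt (by omega)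
    simp only [wp_assign, Expr.eval, BinOp.eval, Expr.cost, setReg_reg, h1W, c1, powExpr_cost,
      ↓reduceIte]
    refine ⟨⟨⟨by omega, hlt, Or.inr (by simpa using hc)⟩, ?_, by simpa using harr,
      by simpa using hcoins⟩, ?_⟩
    · intro r hr; simp [hr, hreg r hr]
    · obtain ⟨d, hd⟩ : ∃ d, m - s₁.reg 4 = d + 1 := ⟨m - s₁.reg 4 - 1, by omega⟩
      rw [show m - (s₁.reg 4 + 1) = d by omega, hd]
      have : (2 * k + 20) * (d + 1) = (2 * k + 20) * d + (2 * k + 20) := by ring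
      omega
  · rintro t s₁ ⟨⟨⟨d1, d2, d3⟩, hreg, harr, hcoins⟩, hc, ht⟩
    have e1 : s₁.reg 1 = m := by rw [hreg 1 (by decide), h1]
    refine ⟨⟨d1, d2, ?_, d3⟩, hreg, harr, hcoins, ?_⟩
    · by_contra h
      refine (eval_lt_ne_zero (by omega) s₁ _ _).2 ?_ hc
      rw [powExpr_eval d1 (lt_of_le_of_lt (Nat.pow_le_pow_left d2 _) hW)]
      simp only [Expr.eval, e1]
      omega
    · have h4 : (2 * k + 20) * (m - (s.setReg 4 ((Expr.lit 1).eval w s)).reg 4) ≤ (2 * k + 20) * m :=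
        Nat.mul_le_mul_left _ (Nat.sub_le _ _)
      simp only [Expr.cost, powExpr_cost] at ht ⊢
      omega

/-- The main specification of the program: it accepts if and only if its budget is exhausted or
one of the rounds finds two searches that meet. -/
theorem detect_spec {n : ℕ} {G : SimpleGraph (Fin n)} [DecidableRel G.Adj] {L : List (Fin n × Fin n)}
    {w k b Kr Kb m : ℕ} {ω : ℕ → Bool} (hL : IsEdgeList G L) (hm : m = L.length) (hn : 2 ≤ n)
    (hnm : n ≤ m) (hk : 1 ≤ k) (hKb : 1 ≤ Kb)
    (hW1 : (2 * m + 2) * n < 2 ^ w) (hW2 : m ^ (k + 1) < 2 ^ w) (hW3 : Kr * n * n < 2 ^ w)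
    (hW4 : Kb * m * m ^ (k - 1) * n ^ k + 1 < 2 ^ w) (hW5 : 2 ^ b < 2 ^ w)
    (hW6 : 2 * k + 1 < 2 ^ w) :
    WP w ω (detect k b Kr Kb) (input L) fun t s =>
      ∃ D B₀ B, 1 ≤ D ∧ m ≤ D ^ (k + 1) ∧ (D = 1 ∨ (D - 1) ^ (k + 1) < m) ∧
        B₀ = Kb * m * D ^ (k - 1) * Nat.clog 2 n ^ k + 1 ∧
        B₀ ≤ B + ∑ r ∈ range (Kr * Nat.clog 2 n),
          ∑ v with colouring n ω b (r * (n * b)) v = 0,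
            pairCost G (colouring n ω b (r * (n * b))) k v ∧
        (s.Accepts ↔ B = 0 ∨ ∃ r < Kr * Nat.clog 2 n, ∃ v : Fin n,
          Meets G (colouring n ω b (r * (n * b))) k v) ∧
        t ≤ 200 * B₀ + Kr * Nat.clog 2 n * (n * (8 * b + 490) + 60) +
          (2 * k + 200) * m + 20 * k + 200 := by
  set len := Nat.clog 2 n with hlen_def
  have hlen1 : 1 ≤ len := Nat.clog_pos one_lt_two hn
  have hlenn : len ≤ n := by
    rw [hlen_def, Nat.clog_le_iff_le_pow one_lt_two]
    exact Nat.lt_two_pow_self.le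
  have hmm : 2 * m + 2 < 2 ^ w := by nlinarith
  have h2n : (2 * m + 2) * 2 ≤ (2 * m + 2) * n := Nat.mul_le_mul_left _ hn
  have hnn : n * n + n < 2 ^ w := by nlinarith
  have h1W : 1 % 2 ^ w = 1 := Nat.mod_eq_of_lt (by omega)
  unfold detect
  rw [wp_seq]
  refine (buildTables_spec L (by rw [← hm]; exact hW1) (by rw [← hm]; exact hmm)).mono ?_
  rintro t₁ s₁ ⟨tab₁, reg₁, arr₁, coins₁, ht₁⟩
  rw [wp_seq]
  refine (computeLog_spec hn (by omega) (by rw [reg₁ 0 (by decide)]; simp [input])).mono ?_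
  rintro t₂ s₂ ⟨len₂, reg₂, arr₂, coins₂, ht₂⟩
  rw [wp_seq]
  refine (computeRoot_spec (m := m) (by omega) hW2 (by omega) (by
    rw [reg₂ 1 (by decide) (by decide), reg₁ 1 (by decide)]; simp [input, hm])).mono ?_
  rintro t₃ s₃ ⟨⟨hD1, hDm, hmD, hDlt⟩, reg₃, arr₃, coins₃, ht₃⟩
  have rr : ∀ r, r ≠ 2 → r ≠ 3 → r ≠ 4 → r ≠ 15 → s₃.reg r = (input L).reg r :=
    fun r c1 c2 c3 c4 => by rw [reg₃ r c3, reg₂ r c1 c2, reg₁ r c4]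
  have e2 : s₃.reg 2 = len := by rw [reg₃ 2 (by decide), len₂]
  have e1 : s₃.reg 1 = m := by
    rw [rr 1 (by decide) (by decide) (by decide) (by decide)]; simp [input, hm]
  have e0 : s₃.reg 0 = n := by
    rw [rr 0 (by decide) (by decide) (by decide) (by decide)]; simp [input]
  have e7 : s₃.reg 7 = 0 := by
    rw [rr 7 (by decide) (by decide) (by decide) (by decide)]; simp [input]
  have e9 : s₃.reg 9 = 0 := by
    rw [rr 9 (by decide) (by decide) (by decide) (by decide)]; simp [input]
  have harr : s₃.arr = s₁.arr := by rw [arr₃, arr₂]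
  set D := s₃.reg 4 with hD_def
  have hRn : Kr * len * n ≤ Kr * n * n := Nat.mul_le_mul_right _ (Nat.mul_le_mul_left _ hlenn)
  have hRW : Kr * len < 2 ^ w := by nlinarith
  have hKr : Kr < 2 ^ w := lt_of_le_of_lt (Nat.le_mul_of_pos_right _ hlen1) hRW
  have hB : Kb * m * D ^ (k - 1) * len ^ k + 1 < 2 ^ w := by
    refine lt_of_le_of_lt ?_ hW4
    exact Nat.add_le_add_right (Nat.mul_le_mul (Nat.mul_le_mul_left _ (Nat.pow_le_pow_left hDm _))
      (Nat.pow_le_pow_left hlenn _)) _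
  have hlk : 1 ≤ len ^ k := Nat.one_le_pow _ _ hlen1
  have hDk : 1 ≤ D ^ (k - 1) := Nat.one_le_pow _ _ hD1
  have hB3 : Kb * m * D ^ (k - 1) ≤ Kb * m * D ^ (k - 1) * len ^ k := Nat.le_mul_of_pos_right _ hlk
  have hB2 : Kb * m ≤ Kb * m * D ^ (k - 1) := Nat.le_mul_of_pos_right _ hDk
  have hB1 : Kb ≤ Kb * m := Nat.le_mul_of_pos_right _ (by omega)
  have hKm : 1 ≤ Kb * m := Nat.mul_pos hKb (by omega)
  have hDkW : D ^ (k - 1) ≤ Kb * m * D ^ (k - 1) := Nat.le_mul_of_pos_left _ hKm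
  have hlkW : len ^ k ≤ Kb * m * D ^ (k - 1) * len ^ k :=
    Nat.le_mul_of_pos_left _ (Nat.mul_pos hKm hDk)
  have c1 : Kr % 2 ^ w = Kr := Nat.mod_eq_of_lt hKr
  have c2 : (Kr * len) % 2 ^ w = Kr * len := Nat.mod_eq_of_lt hRW
  have c3 : Kb % 2 ^ w = Kb := Nat.mod_eq_of_lt (by omega)
  have c4 : (Kb * m) % 2 ^ w = Kb * m := Nat.mod_eq_of_lt (by omega)
  have c5 : (Kb * m * D ^ (k - 1)) % 2 ^ w = Kb * m * D ^ (k - 1) := Nat.mod_eq_of_lt (by omega)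
  have c6 : (Kb * m * D ^ (k - 1) * len ^ k) % 2 ^ w = Kb * m * D ^ (k - 1) * len ^ k :=
    Nat.mod_eq_of_lt (by omega)
  have c7 := Nat.mod_eq_of_lt hB
  rw [wp_seq, wp_assign]
  simp only [Expr.eval, BinOp.eval, Expr.cost, e2, c1, c2]
  rw [wp_seq, wp_assign]
  have p4 : (powExpr 4 (k - 1)).eval w (s₃.setReg 6 (Kr * len)) = D ^ (k - 1) := by
    rw [powExpr_eval] <;> simp only [setReg_reg] <;> norm_num <;> rw [← hD_def] <;> omega
  have p2 : (powExpr 2 k).eval w (s₃.setReg 6 (Kr * len)) = len ^ k := by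
    rw [powExpr_eval] <;> simp only [setReg_reg] <;> norm_num <;> rw [e2] <;> omega
  simp only [Expr.eval, BinOp.eval, Expr.cost, powExpr_cost, p4, p2, setReg_reg, e1,
    c3, c4, c5, c6, c7, h1W, Nat.reduceEqDiff, ↓reduceIte]
  set B₀ := Kb * m * D ^ (k - 1) * len ^ k + 1 with hB₀
  set s₅ := (s₃.setReg 6 (Kr * len)).setReg 5 B₀ with hs₅
  have f5 : s₅.reg 5 = B₀ := by simp [hs₅]
  have f6 : s₅.reg 6 = Kr * len := by simp [hs₅]
  have farr : s₅.arr = s₁.arr := by simp [hs₅, harr]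
  have f9 : s₅.reg 9 = 0 := by simp [hs₅, e9]
  have hnbr := isNbrLists_of_isEdgeList hL
  -- The mark arrays are still zero, below the first stamp used, which is 1.
  have hzero : ∀ e, e ≠ 0 → e ≠ 1 → e ≠ 2 → e ≠ 3 → ∀ x, s₅.arr e x = 0 :=
    fun e c0 c1 c2 c3 x => by rw [farr, arr₁ e c2 c3]; simp [input, c0, c1]
  have hpers : Persistent G (nbrList (bothWays L)) s₅ := {
    tables := ⟨by simp [hs₅, e0], by
      intro u; rw [farr, tab₁.deg, hnbr.length_eq], by rw [farr]; exact tab₁.adj⟩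
    mark_le := fun y => by rw [hzero 6 (by decide) (by decide) (by decide) (by decide)]; omega
    mark_le' := fun y => by rw [hzero 7 (by decide) (by decide) (by decide) (by decide)]; omega
    found_le := by simp [hs₅, e7] }
  rw [wp_seq]
  refine (rounds_spec (ω := ω) (b := b) hnbr (by omega) hnn hW5 hW6 (by omega) (by rw [f6]; omega)
    (by omega) hk hpers (by simp [hs₅, e7]) f9 (by
      simp [hs₅, coins₃, coins₂, coins₁])).mono ?_
  rintro t₆ s₆ ⟨inv, ht₆⟩
  rw [f6] at inv ht₆
  rw [f5] at ht₆
  rw [wp_assign]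
  refine ⟨D, B₀, s₆.reg 5, hD1, hmD, hDlt, rfl, ?_, ?_, ?_⟩
  · have := inv.budget
    rwa [f5] at this
  · have h7 := inv.found_le
    have hf := inv.found
    by_cases h5 : s₆.reg 5 = 0
    · have c8 : (s₆.reg 7 + 1) % 2 ^ w = s₆.reg 7 + 1 := Nat.mod_eq_of_lt (by omega)
      simp [State.Accepts, Expr.eval, BinOp.eval, h5, h1W, c8]
    · have c8 : s₆.reg 7 % 2 ^ w = s₆.reg 7 := Nat.mod_eq_of_lt (by omega)
      have hf' := hf h5
      simp [State.Accepts, Expr.eval, BinOp.eval, h5, c8, hf']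
  · have hnm' : 20 * n ≤ 20 * m := by omega
    have : (2 * k + 200) * m = (2 * k + 20) * m + 180 * m := by ring
    simp only [Expr.cost]
    rw [← hm] at ht₁
    omega

/-! ### Meetings of searches and cycles. -/

section Meeting
variable {n : ℕ} {G : SimpleGraph (Fin n)} [DecidableRel G.Adj]

/-- A walk from `v` to `u` whose `i`-th vertex has colour `i`. -/
structure IsColourChain (G : SimpleGraph (Fin n)) (col : Fin n → ℕ) (f : ℕ → Fin n)
    (v u : Fin n) : Prop where
  start : f 0 = v
  finish : f (col u) = u
  col_eq : ∀ i ≤ col u, col (f i) = i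
  adj : ∀ i < col u, G.Adj (f i) (f (i + 1))

theorem IsColourChain.extend {col : Fin n → ℕ} {f : ℕ → Fin n} {v b c : Fin n}
    (h : IsColourChain G col f v b) (hbc : G.Adj b c) (hc : col c = col b + 1) :
    IsColourChain G col (Function.update f (col c) c) v c where
  start := by rw [Function.update_of_ne (by omega), h.start]
  finish := by simp
  col_eq i hi := by
    rcases hi.lt_or_eq with hlt | rfl
    · rw [Function.update_of_ne (by omega)]
      exact h.col_eq i (by omega)
    · simp
  adj i hi := by
    rw [Function.update_of_ne (by omega)]
    rcases (Nat.lt_succ_iff.1 (hc ▸ hi)).lt_or_eq with hlt | rfl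
    · rw [Function.update_of_ne (by omega)]
      exact h.adj i hlt
    · rw [← hc, Function.update_self, h.finish]
      exact hbc

theorem Touched.exists_chain {col : Fin n → ℕ} {k : ℕ} {v y : Fin n} (hv : col v = 0)
    (h : Touched G col k v y) : ∃ f, IsColourChain G col f v y := by
  obtain ⟨u, hu, hadj, hcol, -⟩ := h
  suffices h : ∃ f, IsColourChain G col f v u by
    obtain ⟨f, hf⟩ := h
    exact ⟨_, hf.extend hadj hcol⟩
  clear hadj hcol
  induction hu with
  | refl => exact ⟨fun _ => v, rfl, rfl, fun i hi => by omega, fun i hi => by omega⟩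
  | tail _ hbc ih =>
    obtain ⟨f, hf⟩ := ih
    exact ⟨_, hf.extend hbc.1.1 hbc.1.2.1⟩

/-- By truncated subtraction, all colours from 2k on have dual colour 0, as does 0 itself. A
positive dual colour thus determines the colour. -/
theorem eq_of_dualColour_eq {k c i : ℕ} (hi : 0 < i) (hik : i < 2 * k)
    (h : dualColour k c = i) : c = 2 * k - i := by
  unfold dualColour at h
  rcases Nat.eq_zero_or_pos c with rfl | hc
  · simp at h; omega
  · rw [Nat.mod_eq_of_lt (by omega)] at h
    omega

/-- Two searches that meet find a cycle. -/
theorem Meets.isContained {col : Fin n → ℕ} {k : ℕ} {v : Fin n} (hk : 2 ≤ k)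
    (h : Meets G col k v) : (SimpleGraph.cycleGraph (2 * k)).IsContained G := by
  obtain ⟨hv, y, hup, hdown, hy⟩ := h
  obtain ⟨f, hf⟩ := hup.exists_chain hv
  obtain ⟨g, hg⟩ := hdown.exists_chain (by simp [hv, dualColour_zero])
  have hcy : col y = k := by rw [eq_of_dualColour_eq (by omega) (by omega) hy]; omega
  obtain ⟨f0, fk, fcol, fadj⟩ := hf
  obtain ⟨g0, gk, gcol, gadj⟩ := hg
  rw [hcy] at fk fcol fadj
  simp only [hy] at gk gcol gadj
  -- The ascending chain up to colour k, then the dual chain backwards. Position j has colour j, so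
  -- the vertices are distinct.
  set F : ℕ → Fin n := fun j => if j ≤ k then f j else g (2 * k - j) with hF
  have F1 : ∀ j, j ≤ k → F j = f j := fun j hj => if_pos hj
  have F2 : ∀ j, k ≤ j → F j = g (2 * k - j) := fun j hj => by
    rcases hj.eq_or_lt with rfl | hlt
    · rw [F1 _ le_rfl, fk, show 2 * k - k = k by omega, gk]
    · exact if_neg (by omega)
  have hcol : ∀ j, j < 2 * k → col (F j) = j := fun j hj => by
    rcases le_total j k with hjk | hjk
    · rw [F1 j hjk, fcol j hjk]
    · rw [F2 j hjk, eq_of_dualColour_eq (by omega) (by omega) (gcol (2 * k - j) (by omega))]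
      omega
  refine cycle_of_seq (by omega) F (fun i hi j hj hij => ?_) (fun i hi => ?_) ?_
  · rw [← hcol i hi, ← hcol j hj, hij]
  · rcases lt_or_ge i k with hik | hik
    · rw [F1 i hik.le, F1 _ hik]
      exact fadj i hik
    · rw [F2 i hik, F2 _ (by omega)]
      have := gadj (2 * k - (i + 1)) (by omega)
      rw [show 2 * k - (i + 1) + 1 = 2 * k - i by omega] at this
      exact this.symm
  · rw [F2 _ (by omega), F1 0 (by omega), show 2 * k - (2 * k - 1) = 0 + 1 by omega, f0, ← g0]
    exact (gadj 0 (by omega)).symm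

theorem touched_of_path {col : Fin n → ℕ} {k : ℕ} (hk : 1 ≤ k) (g : ℕ → Fin n)
    (hadj : ∀ i < k, G.Adj (g i) (g (i + 1))) (hcol : ∀ i ≤ k, col (g i) = i)
    (hdeg : ∀ i ≤ k, G.degree (g i) ≤ G.degree (g 0)) : Touched G col k (g 0) (g k) := by
  have hadv : ∀ i < k, Advance G col (G.degree (g 0)) (g i) (g (i + 1)) := fun i hi =>
    ⟨hadj i hi, by rw [hcol i hi.le, hcol _ hi], hdeg _ hi⟩
  have hreach : ∀ i < k, Reach G col k (g 0) (g i) := fun i => by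
    induction i with
    | zero => exact fun _ => Relation.ReflTransGen.refl
    | succ i ih =>
      exact fun hi => (ih (by omega)).tail ⟨hadv i (by omega), by rw [hcol _ hi.le]; exact hi⟩
  obtain ⟨l, rfl⟩ : ∃ l, k = l + 1 := ⟨k - 1, by omega⟩
  exact ⟨g l, hreach l (by omega), hadv l (by omega)⟩

/-- On a cycle that is coloured in order, starting at a vertex of maximum degree, the two searches
meet. -/
theorem meets_of_coloured_cycle {col : Fin n → ℕ} {k : ℕ} (hk : 1 ≤ k) (f : ℕ → Fin n)
    (hadj : ∀ i, G.Adj (f i) (f (i + 1))) (hper : f (2 * k) = f 0)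
    (hdeg : ∀ i, G.degree (f i) ≤ G.degree (f 0)) (hcol : ∀ i < 2 * k, col (f i) = i) :
    Meets G col k (f 0) := by
  refine ⟨hcol 0 (by omega), f k, touched_of_path hk f (fun i _ => hadj i)
    (fun i hi => hcol i (by omega)) fun i _ => hdeg i, ?_, ?_⟩
  · have h := touched_of_path (G := G) (col := fun u => dualColour k (col u)) hk
      (fun i => f (2 * k - i)) (fun i hi => ?_) (fun i hi => ?_) (fun i _ => ?_)
    · simpa [hper, show 2 * k - k = k by omega] using h
    · have := hadj (2 * k - (i + 1))
      rw [show 2 * k - (i + 1) + 1 = 2 * k - i by omega] at this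
      exact this.symm
    · rcases Nat.eq_zero_or_pos i with rfl | hi'
      · simp [hper, hcol 0 (by omega), dualColour_zero]
      · rw [hcol _ (by omega), dualColour, Nat.mod_eq_of_lt (by omega)]
        omega
    · exact (hdeg _).trans_eq (congrArg (fun x => G.degree x) hper.symm)
  · rw [hcol k (by omega), dualColour, Nat.mod_eq_of_lt (by omega)]
    omega

end Meeting
-- The success probability.
open MeasureTheory ProbabilityTheory

theorem bitsVal_congr {ω τ : ℕ → Bool} {q p b : ℕ} (h : ∀ l < b, ω (q + l) = τ (p + l)) :
    bitsVal ω q b = bitsVal τ p b := by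
  induction b with
  | zero => rfl
  | succ b ih => rw [bitsVal, bitsVal, ih fun l hl => h l (by omega), h b (by omega)]

theorem exists_bitsVal_eq (b : ℕ) : ∀ x < 2 ^ b, ∃ τ : ℕ → Bool, bitsVal τ 0 b = x := by
  induction b with
  | zero => exact fun x hx => ⟨fun _ => false, by simp [bitsVal]; omega⟩
  | succ b ih =>
    intro x hx
    obtain ⟨τ, hτ⟩ := ih (x / 2) (by omega)
    refine ⟨Function.update τ b (decide (x % 2 = 1)), ?_⟩
    have h1 : bitsVal (Function.update τ b (decide (x % 2 = 1))) 0 b = bitsVal τ 0 b :=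
      bitsVal_congr fun l hl => by simp [Function.update_of_ne hl.ne]
    rw [bitsVal, h1, hτ, Nat.zero_add, Function.update_self]
    rcases Nat.mod_two_eq_zero_or_one x with h | h <;> simp [h] <;> omega

instance : IsProbabilityMeasure coinMeasure := by
  unfold coinMeasure
  infer_instance

theorem coinMeasure_cylinder (S : Finset ℕ) (σ : ℕ → Bool) :
    coinMeasure {ω | ∀ i ∈ S, ω i = σ i} = (2 : ENNReal)⁻¹ ^ #S := by
  have h1 : {ω : ℕ → Bool | ∀ i ∈ S, ω i = σ i} = (S : Set ℕ).pi fun i => {σ i} := by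
    ext ω; simp [Set.mem_pi]
  rw [h1, coinMeasure, Measure.infinitePi_pi _ fun i _ => measurableSet_singleton _]
  rw [Finset.prod_congr rfl fun i _ => by
    rw [PMF.toMeasure_apply_singleton _ _ (measurableSet_singleton _),
      PMF.uniformOfFintype_apply, Fintype.card_bool], Finset.prod_const]
  rfl

theorem measurableSet_cylinder (S : Finset ℕ) (σ : ℕ → Bool) :
    MeasurableSet {ω : ℕ → Bool | ∀ i ∈ S, ω i = σ i} := by
  have h1 : {ω : ℕ → Bool | ∀ i ∈ S, ω i = σ i} = (S : Set ℕ).pi fun i => {σ i} := by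
    ext ω; simp [Set.mem_pi]
  rw [h1]
  exact MeasurableSet.pi (Finset.countable_toSet S) fun i _ => measurableSet_singleton _

/-- Prescribed outcomes on many disjoint sets of coin tosses are unlikely to be missed by all of
them. -/
theorem coinMeasure_iInter_compl_le (S : ℕ → Finset ℕ) (σ : ℕ → Bool) {K : ℕ}
    (hS : ∀ r, #(S r) ≤ K) (hdisj : ∀ r r', r ≠ r' → Disjoint (S r) (S r')) (R : ℕ) :
    coinMeasure.real (⋂ r ∈ range R, {ω | ∀ i ∈ S r, ω i = σ i}ᶜ) ≤ (1 - (1 / 2 : ℝ) ^ K) ^ R := by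
  -- An intersection of cylinders over disjoint sets of tosses is the cylinder over their union, so
  -- the measures multiply.
  have hindep : iIndepSet (fun r => {ω : ℕ → Bool | ∀ i ∈ S r, ω i = σ i}) coinMeasure := by
    rw [iIndepSet_iff_meas_biInter fun r => measurableSet_cylinder _ _]
    intro s
    have h1 : (⋂ r ∈ s, {ω : ℕ → Bool | ∀ i ∈ S r, ω i = σ i}) =
        {ω | ∀ i ∈ s.biUnion S, ω i = σ i} := by
      ext ω
      simp only [Set.mem_iInter, Set.mem_ofPred_eq, Finset.mem_biUnion]
      exact ⟨fun h i ⟨r, hr, hi⟩ => h r hr i hi, fun h r hr i hi => h i ⟨r, hr, hi⟩⟩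
    rw [h1, coinMeasure_cylinder, Finset.card_biUnion fun r _ r' _ h => hdisj r r' h,
      Finset.prod_congr rfl fun r _ => coinMeasure_cylinder (S r) σ, Finset.prod_pow_eq_pow_sum]
  rw [iIndepSet] at hindep
  have h2 := (iIndepSet_iff _ _).1 hindep (range R)
    (f := fun r => {ω | ∀ i ∈ S r, ω i = σ i}ᶜ) fun r _ =>
      (MeasurableSpace.measurableSet_generateFrom (Set.mem_singleton _)).compl
  rw [Measure.real, h2, ENNReal.toReal_prod]
  refine (Finset.prod_le_prod (fun _ _ => ENNReal.toReal_nonneg) (fun r _ => ?_)).trans_eq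
    (by rw [Finset.prod_const, card_range])
  rw [← Measure.real, probReal_compl_eq_one_sub (measurableSet_cylinder _ _), Measure.real,
    coinMeasure_cylinder, ENNReal.toReal_pow, ENNReal.toReal_inv, ENNReal.toReal_ofNat]
  have := pow_le_pow_of_le_one (show (0 : ℝ) ≤ 1 / 2 by norm_num) (by norm_num) (hS r)
  rw [one_div] at this ⊢
  linarith

/-- It is unlikely that no round gives the vertices of `T` the prescribed colours. -/
theorem coinMeasure_forall_round_le {n b : ℕ} (hn : 0 < n) (hb : 0 < b) (c : Fin n → ℕ)
    (hc : ∀ u, c u < 2 ^ b) (T : Finset (Fin n)) (R : ℕ) :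
    coinMeasure.real {ω | ∀ r < R, ¬ ∀ u ∈ T, colouring n ω b (r * (n * b)) u = c u} ≤
      (1 - (1 / 2 : ℝ) ^ (#T * b)) ^ R := by
  choose τ hτ using fun u => exists_bitsVal_eq b (c u) (hc u)
  -- Toss i decides digit i % b of vertex i / b % n, so one pattern prescribes the colours in all
  -- rounds.
  set σ : ℕ → Bool := fun i => τ ⟨i / b % n, Nat.mod_lt _ hn⟩ (i % b) with hσ
  set S : ℕ → Finset ℕ := fun r =>
    (T ×ˢ range b).image fun p => r * (n * b) + p.1 * b + p.2 with hS
  have hdiv : ∀ (r l : ℕ) (u : Fin n), l < b →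
      (r * (n * b) + u * b + l) / b = r * n + u ∧ (r * (n * b) + u * b + l) % b = l := by
    intro r l u hl
    have : r * (n * b) + u * b + l = l + b * (r * n + u) := by ring
    rw [this, Nat.add_mul_div_left _ _ hb, Nat.add_mul_mod_self_left, Nat.div_eq_of_lt hl,
      Nat.mod_eq_of_lt hl, Nat.zero_add]
    exact ⟨rfl, rfl⟩
  have hrn : ∀ (r : ℕ) (u : Fin n), (r * n + u) / n = r ∧ (r * n + u) % n = u := by
    intro r u
    have : r * n + u = u + n * r := by ring
    rw [this, Nat.add_mul_div_left _ _ hn, Nat.add_mul_mod_self_left, Nat.div_eq_of_lt u.isLt,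
      Nat.mod_eq_of_lt u.isLt, Nat.zero_add]
    exact ⟨rfl, rfl⟩
  refine (measureReal_mono ?_).trans (coinMeasure_iInter_compl_le S σ (K := #T * b)
    (fun r => ?_) (fun r r' hrr => ?_) R)
  · intro ω hω
    simp only [Set.mem_iInter, Set.mem_compl_iff, Set.mem_ofPred_eq, mem_range] at hω ⊢
    intro r hr h
    refine hω r hr fun u hu => ?_
    rw [colouring, ← hτ u]
    refine bitsVal_congr fun l hl => ?_
    rw [h _ (Finset.mem_image.2 ⟨(u, l), Finset.mem_product.2 ⟨hu, mem_range.2 hl⟩, rfl⟩), hσ]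
    simp only [hdiv r l u hl, hrn, Nat.zero_add, Fin.eta]
  · exact Finset.card_image_le.trans_eq (by rw [Finset.card_product, card_range])
  · rw [Finset.disjoint_left]
    intro i hi hi'
    simp only [hS, Finset.mem_image, Finset.mem_product, mem_range] at hi hi'
    obtain ⟨⟨u, l⟩, ⟨-, hl⟩, rfl⟩ := hi
    obtain ⟨⟨u', l'⟩, ⟨-, hl'⟩, h⟩ := hi'
    refine hrr ?_
    have h1 := congrArg (fun x => x / b / n) h
    simp only [(hdiv _ _ _ hl).1, (hdiv _ _ _ hl').1, (hrn _ _).1] at h1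
    exact h1.symm

/-- With p = 2^(-K), (1 - p)^(1/p) ≤ 1/e ≤ 1/2. Each block of 2^K rounds halves the failure
probability, and a * len blocks bring it down to n^(-a). -/
theorem one_sub_pow_le {K a n len : ℕ} (hn : 0 < n) (hlen : n ≤ 2 ^ len) {R : ℕ}
    (hR : a * 2 ^ K * len ≤ R) : (1 - (1 / 2 : ℝ) ^ K) ^ R ≤ 1 / (n : ℝ) ^ a := by
  have hp : (1 / 2 : ℝ) ^ K ≤ 1 := pow_le_one₀ (by norm_num) (by norm_num)
  have h2 : (1 - (1 / 2 : ℝ) ^ K) ^ 2 ^ K ≤ 1 / 2 := by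
    have h3 : (1 - (1 / 2 : ℝ) ^ K) ^ 2 ^ K ≤ Real.exp (-(1 / 2 : ℝ) ^ K) ^ 2 ^ K :=
      pow_le_pow_left₀ (by linarith) (Real.one_sub_le_exp_neg _) _
    rw [← Real.exp_nat_mul] at h3
    have h4 : ((2 ^ K : ℕ) : ℝ) * -(1 / 2 : ℝ) ^ K = -1 := by
      push_cast
      rw [mul_neg, ← mul_pow]
      norm_num
    rw [h4, Real.exp_neg] at h3
    have h5 : (2 : ℝ) ≤ Real.exp 1 := by
      have := Real.add_one_le_exp 1
      linarith
    refine h3.trans ?_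
    rw [one_div]
    exact inv_anti₀ (by norm_num) h5
  calc (1 - (1 / 2 : ℝ) ^ K) ^ R ≤ (1 - (1 / 2 : ℝ) ^ K) ^ (a * 2 ^ K * len) :=
        pow_le_pow_of_le_one (by linarith) (by linarith [pow_pos (show (0 : ℝ) < 1 / 2 by norm_num) K]) hR
    _ = ((1 - (1 / 2 : ℝ) ^ K) ^ 2 ^ K) ^ (len * a) := by rw [← pow_mul]; ring_nf
    _ ≤ (1 / 2) ^ (len * a) := pow_le_pow_left₀ (pow_nonneg (by linarith) _) h2 _
    _ = 1 / ((2 : ℝ) ^ len) ^ a := by rw [one_div, inv_pow, pow_mul, one_div]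
    _ ≤ 1 / (n : ℝ) ^ a := by
        have h6 : (n : ℝ) ≤ 2 ^ len := by exact_mod_cast hlen
        have h7 : (0 : ℝ) < n := by exact_mod_cast hn
        exact one_div_le_one_div_of_le (by positivity) (pow_le_pow_left₀ h7.le h6 _)

/-! ### Running time and error bounds. -/

section Final
variable {n : ℕ} {G : SimpleGraph (Fin n)} [DecidableRel G.Adj] {L : List (Fin n × Fin n)}

theorem card_edgeFinset_of_isEdgeList (hL : IsEdgeList G L) : #G.edgeFinset = L.length := by
  have h : G.edgeFinset = (L.map fun p => s(p.1, p.2)).toFinset := by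
    ext e; rw [SimpleGraph.mem_edgeFinset, List.mem_toFinset, hL.2]
  rw [h, List.toFinset_card_of_nodup hL.1, List.length_map]

/-- The constant in the bound for the cost of one family of searches. -/
def scanConst (k : ℕ) : ℕ := 4 + 6 * k * (64 * (k + 2) * (2 * k + 4)) ^ (k - 1)

/-- The cost bound holds for every colouring, in particular the dual one, and sources of colour 0
also have dual colour 0. -/
theorem sum_pairCost_le {k D len : ℕ} (hk : 1 ≤ k) (hD : 1 ≤ D) (hlen : 1 ≤ len)
    (hfree : ¬ (SimpleGraph.cycleGraph (2 * k)).IsContained G) (hn : n ≤ 2 ^ len)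
    (hnm : n ≤ #G.edgeFinset) (hm : #G.edgeFinset ≤ D ^ (k + 1)) (col : Fin n → ℕ) :
    ∑ v with col v = 0, pairCost G col k v ≤
      2 * scanConst k * (#G.edgeFinset * D ^ (k - 1) * len ^ (k - 1)) := by
  have hn' : Fintype.card (Fin n) ≤ 2 ^ len := by rwa [Fintype.card_fin]
  have hnm' : Fintype.card (Fin n) ≤ #G.edgeFinset := by rwa [Fintype.card_fin]
  have h1 := sum_scanCost_le hk hD hlen hfree hn' hnm' hm col
  have h2 := sum_scanCost_le hk hD hlen hfree hn' hnm' hm fun u => dualColour k (col u)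
  have h3 : ∑ v with col v = 0, scanCost G (fun u => dualColour k (col u)) k v ≤
      ∑ v with dualColour k (col v) = 0, scanCost G (fun u => dualColour k (col u)) k v := by
    refine Finset.sum_le_sum_of_subset fun v hv => ?_
    rw [Finset.mem_filter] at hv ⊢
    exact ⟨hv.1, by rw [hv.2, dualColour_zero]⟩
  simp only [pairCost, Finset.sum_add_distrib]
  rw [scanConst, mul_assoc 2, two_mul]
  exact Nat.add_le_add h1 (h3.trans h2)

/-- The number of steps allowed to the program. -/
def timeConst (k b Kr Kb : ℕ) : ℕ :=
  200 * (Kb * 2 ^ (2 * k) + 1) + 2 * Kr * (8 * b + 550) + (2 * k + 200) + (20 * k + 200)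

/-- With x = m^(1/(k+1)), minimality gives D ≤ 2x, and so m D^(k-1) is at most a constant times
x^(2k) = m^(2k/(k+1)). The rounded logarithm costs another factor 2 for each power, and all other
terms are of lower order. -/
theorem time_le {k b Kr Kb n m D t : ℕ} (hk : 1 ≤ k) (hn : 2 ≤ n) (hnm : n ≤ m)
    (hD : D = 1 ∨ (D - 1) ^ (k + 1) < m)
    (ht : t ≤ 200 * (Kb * m * D ^ (k - 1) * Nat.clog 2 n ^ k + 1) +
      Kr * Nat.clog 2 n * (n * (8 * b + 490) + 60) + (2 * k + 200) * m + 20 * k + 200) :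
    (t : ℝ) ≤ timeConst k b Kr Kb * (m : ℝ) ^ ((2 * k : ℝ) / ((k : ℝ) + 1)) *
      Real.logb 2 (m : ℝ) ^ k := by
  have hm1 : (1 : ℝ) ≤ m := by exact_mod_cast (by omega : 1 ≤ m)
  have hk1 : (k : ℝ) + 1 ≠ 0 := by positivity
  set x : ℝ := (m : ℝ) ^ (1 / ((k : ℝ) + 1)) with hx
  have hx1 : 1 ≤ x := Real.one_le_rpow hm1 (by positivity)
  have hxm : x ^ (k + 1) = m := by
    rw [hx, ← Real.rpow_natCast, ← Real.rpow_mul (by positivity)]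
    push_cast
    rw [one_div_mul_cancel hk1, Real.rpow_one]
  have hxM : (m : ℝ) ^ ((2 * k : ℝ) / ((k : ℝ) + 1)) = x ^ (2 * k) := by
    rw [hx, ← Real.rpow_natCast, ← Real.rpow_mul (by positivity)]
    push_cast
    congr 1
    ring
  set l : ℝ := Real.logb 2 (m : ℝ) with hl
  have hl1 : 1 ≤ l := by
    rw [hl, Real.le_logb_iff_rpow_le one_lt_two (by positivity), Real.rpow_one]
    exact_mod_cast hn.trans hnm
  have hlen : (Nat.clog 2 n : ℝ) ≤ 2 * l := by
    have h1 : 2 ^ (Nat.clog 2 n).pred < n := Nat.pow_pred_clog_lt_self one_lt_two hn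
    have h2 : (((Nat.clog 2 n).pred : ℕ) : ℝ) ≤ l := by
      rw [hl, Real.le_logb_iff_rpow_le one_lt_two (by positivity), Real.rpow_natCast]
      exact_mod_cast h1.le.trans hnm
    have h3 : (Nat.clog 2 n : ℝ) ≤ ((Nat.clog 2 n).pred : ℕ) + 1 := by
      exact_mod_cast (show Nat.clog 2 n ≤ (Nat.clog 2 n).pred + 1 by rw [Nat.pred_eq_sub_one]; omega)
    linarith
  have hDx : (D : ℝ) ≤ 2 * x := by
    rcases hD with rfl | hD
    · push_cast; linarith
    · have h1 : ((D - 1 : ℕ) : ℝ) < x := by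
        refine lt_of_pow_lt_pow_left₀ (k + 1) (by linarith) ?_
        rw [hxm]
        exact_mod_cast hD
      have h2 : (D : ℝ) ≤ (D - 1 : ℕ) + 1 := by exact_mod_cast (show D ≤ D - 1 + 1 by omega)
      linarith
  set X : ℝ := x ^ (2 * k) * l ^ k with hX
  have hlk : 1 ≤ l ^ k := one_le_pow₀ hl1
  have hllk : l ≤ l ^ k := le_self_pow₀ hl1 (by omega)
  have hmM : (m : ℝ) ≤ x ^ (2 * k) := by
    rw [← hxm]; exact pow_le_pow_right₀ hx1 (by omega)
  have hX1 : 1 ≤ X := one_le_mul_of_one_le_of_one_le (one_le_pow₀ hx1) hlk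
  have hmX : (m : ℝ) ≤ X := hmM.trans (le_mul_of_one_le_right (by positivity) hlk)
  have hlm : (Nat.clog 2 n : ℝ) * m ≤ 2 * X := by
    calc (Nat.clog 2 n : ℝ) * m ≤ (2 * l ^ k) * x ^ (2 * k) :=
          mul_le_mul (hlen.trans (by linarith)) hmM (by positivity) (by positivity)
      _ = 2 * X := by rw [hX]; ring
  have hB : (m : ℝ) * D ^ (k - 1) * Nat.clog 2 n ^ k ≤ 2 ^ (2 * k) * X := by
    obtain ⟨j, rfl⟩ : ∃ j, k = j + 1 := ⟨k - 1, by omega⟩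
    calc (m : ℝ) * D ^ (j + 1 - 1) * Nat.clog 2 n ^ (j + 1)
        ≤ x ^ (j + 1 + 1) * (2 * x) ^ j * (2 * l) ^ (j + 1) := by
          rw [hxm, Nat.add_sub_cancel]
          gcongr
      _ = 2 ^ (2 * j + 1) * X := by rw [hX]; ring
      _ ≤ 2 ^ (2 * (j + 1)) * X := by
          gcongr
          · norm_num
          · omega
  have ht' : (t : ℝ) ≤ 200 * (Kb * m * D ^ (k - 1) * Nat.clog 2 n ^ k + 1) +
      Kr * Nat.clog 2 n * (n * (8 * b + 490) + 60) + (2 * k + 200) * m + 20 * k + 200 := by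
    exact_mod_cast ht
  have hnm' : (n : ℝ) ≤ m := by exact_mod_cast hnm
  have h1 : (Kb : ℝ) * m * D ^ (k - 1) * Nat.clog 2 n ^ k ≤ Kb * (2 ^ (2 * k) * X) := by
    rw [mul_assoc (Kb : ℝ), mul_assoc (Kb : ℝ)]
    exact mul_le_mul_of_nonneg_left hB (by positivity)
  have h2 : (Kr : ℝ) * Nat.clog 2 n * (n * (8 * b + 490) + 60) ≤ Kr * (8 * b + 550) * (2 * X) := by
    calc (Kr : ℝ) * Nat.clog 2 n * (n * (8 * b + 490) + 60)
        ≤ Kr * Nat.clog 2 n * (m * (8 * b + 490) + 60 * m) := by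
          gcongr
          linarith
      _ = Kr * (8 * b + 550) * (Nat.clog 2 n * m) := by ring
      _ ≤ _ := mul_le_mul_of_nonneg_left hlm (by positivity)
  have h3 : (2 * k + 200 : ℝ) * m ≤ (2 * k + 200) * X :=
    mul_le_mul_of_nonneg_left hmX (by positivity)
  have h4 : (20 * k + 200 : ℝ) * 1 ≤ (20 * k + 200) * X :=
    mul_le_mul_of_nonneg_left hX1 (by positivity)
  rw [hxM, mul_assoc, ← hX, timeConst]
  push_cast
  linarith

theorem lt_two_pow_of_le_pow {n c e w x : ℕ} (hn : 2 ≤ n) (hw : n ^ c ≤ 2 ^ w) (hx : x ≤ n ^ e)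
    (he : e < c) : x < 2 ^ w :=
  hx.trans_lt ((Nat.pow_lt_pow_right hn he).trans_le hw)

/-- The exponent in the bound for the word length. -/
def wordConst (k b Kr Kb : ℕ) : ℕ := Kr + Kb + b + 5 * k + 10

/-- The error is one-sided: without a 2k-cycle every outcome is rejected, and with one, a meeting in
any round suffices. As m ≤ n^2, all numbers computed are bounded by a fixed power of n and fit into
a word. -/
theorem detect_run {k b Kr Kb w : ℕ} (hL : IsEdgeList G L) (hn : 2 ≤ n) (hnm : n ≤ L.length)
    (hk : 2 ≤ k) (hKb : Kb = 2 * Kr * scanConst k + 1)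
    (hw : n ^ wordConst k b Kr Kb ≤ 2 ^ w) (ω : ℕ → Bool) :
    ∃ t s, Exec w ω (detect k b Kr Kb) (input L) t s ∧
      (t : ℝ) ≤ timeConst k b Kr Kb * (L.length : ℝ) ^ ((2 * k : ℝ) / ((k : ℝ) + 1)) *
        Real.logb 2 (L.length : ℝ) ^ k ∧
      (¬ (SimpleGraph.cycleGraph (2 * k)).IsContained G → ¬ s.Accepts) ∧
      ((∃ r < Kr * Nat.clog 2 n, ∃ v : Fin n, Meets G (colouring n ω b (r * (n * b))) k v) →
        s.Accepts) := by
  have hcard := card_edgeFinset_of_isEdgeList hL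
  set m := L.length with hm
  have hmn : m ≤ n ^ 2 := by
    have h1 := G.card_edgeFinset_le_card_choose_two
    rw [Fintype.card_fin, hcard] at h1
    exact h1.trans (Nat.choose_le_pow n 2)
  have hpow : ∀ x, x ≤ n ^ x := fun x => (Nat.lt_pow_self hn).le
  have h2n : ∀ x, 2 ^ x ≤ n ^ x := fun x => Nat.pow_le_pow_left hn x
  obtain ⟨t, s, hex, D, B₀, B, hD1, hmD, hDm, rfl, hB, hacc, ht⟩ :=
    detect_spec (w := w) (k := k) (b := b) (Kr := Kr) (Kb := Kb) (ω := ω) hL hm hn hnm (by omega)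
    (by omega)
    (lt_two_pow_of_le_pow (e := 5) hn hw (by
      calc (2 * m + 2) * n ≤ (2 ^ 2 * n ^ 2) * n := Nat.mul_le_mul_right _ (by omega)
        _ ≤ (n ^ 2 * n ^ 2) * n := Nat.mul_le_mul_right _ (Nat.mul_le_mul_right _ (h2n 2))
        _ = n ^ 5 := by ring) (by unfold wordConst; omega))
    (lt_two_pow_of_le_pow (e := 2 * (k + 1)) hn hw (by
      rw [pow_mul]; exact Nat.pow_le_pow_left hmn _) (by unfold wordConst; omega))
    (lt_two_pow_of_le_pow (e := Kr + 1 + 1) hn hw (by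
      rw [pow_succ, pow_succ]
      exact Nat.mul_le_mul_right _ (Nat.mul_le_mul_right _ (hpow _))) (by unfold wordConst; omega))
    (lt_two_pow_of_le_pow (e := Kb + 2 + 2 * (k - 1) + k + 1) hn hw (by
      have h1 : Kb * m * m ^ (k - 1) * n ^ k ≤ n ^ (Kb + 2 + 2 * (k - 1) + k) := by
        rw [pow_add, pow_add, pow_add, pow_mul]
        exact Nat.mul_le_mul_right _ (Nat.mul_le_mul (Nat.mul_le_mul (hpow _) hmn)
          (Nat.pow_le_pow_left hmn _))
      have h2 : 1 ≤ n ^ (Kb + 2 + 2 * (k - 1) + k) := Nat.one_le_pow _ _ (by omega)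
      have h3 := Nat.mul_le_mul_left (n ^ (Kb + 2 + 2 * (k - 1) + k)) hn
      rw [pow_succ]
      omega) (by unfold wordConst; omega))
    (lt_two_pow_of_le_pow (e := b) hn hw (h2n b) (by unfold wordConst; omega))
    (lt_two_pow_of_le_pow (e := 2 * k + 1) hn hw (hpow _) (by unfold wordConst; omega))
  refine ⟨t, s, hex, time_le (by omega) hn hnm hDm ht, fun hfree => ?_, fun h => hacc.2 (Or.inr h)⟩
  rw [hacc, not_or]
  refine ⟨?_, fun ⟨_, _, _, h⟩ => hfree (h.isContained hk)⟩
  -- An exhausted budget would mean that the total cost of all rounds is at least the budget, but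
  -- the choice of `Kb` and the extra 1 make the budget larger.
  rintro rfl
  have hlen : 1 ≤ Nat.clog 2 n := Nat.clog_pos one_lt_two hn
  have h1 := Finset.sum_le_card_nsmul (range (Kr * Nat.clog 2 n)) _ _ fun r _ =>
    sum_pairCost_le (by omega) hD1 hlen hfree (Nat.le_pow_clog one_lt_two n) (by omega)
      (hcard.trans_le hmD) (colouring n ω b (r * (n * b)))
  rw [card_range, smul_eq_mul, hcard] at h1
  have h2 : Kr * Nat.clog 2 n * (2 * scanConst k * (m * D ^ (k - 1) * Nat.clog 2 n ^ (k - 1))) =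
      2 * Kr * scanConst k * m * D ^ (k - 1) * Nat.clog 2 n ^ k := by
    obtain ⟨j, rfl⟩ : ∃ j, k = j + 1 := ⟨k - 1, by omega⟩
    rw [Nat.add_sub_cancel]
    ring
  have h3 : 2 * Kr * scanConst k * m * D ^ (k - 1) * Nat.clog 2 n ^ k ≤
      Kb * m * D ^ (k - 1) * Nat.clog 2 n ^ k := by
    rw [hKb]
    gcongr
    omega
  omega

/-- The probability that no round colours a given cycle in order. -/
theorem exists_bad_event {k b a R : ℕ} (hk : 2 ≤ k) (hb : 2 * k ≤ 2 ^ b) (hn : 0 < n)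
    (hR : a * 2 ^ (2 * k * b) * Nat.clog 2 n ≤ R)
    (hG : (SimpleGraph.cycleGraph (2 * k)).IsContained G) :
    ∃ bad : Set (ℕ → Bool), coinMeasure.real bad ≤ 1 / (n : ℝ) ^ a ∧
      ∀ ω ∉ bad, ∃ r < R, ∃ v : Fin n, Meets G (colouring n ω b (r * (n * b))) k v := by
  classical
  obtain ⟨f, hinj, hadj, hper, hdeg⟩ := seq_of_cycle (by omega) hG fun v => G.degree v
  have hb0 : 0 < b := by
    rcases Nat.eq_zero_or_pos b with rfl | h
    · simp at hb; omega
    · exact h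
  -- The prescribed colours matter only on the cycle; elsewhere 0 is a dummy value.
  obtain ⟨c, hc, hcf⟩ : ∃ c : Fin n → ℕ, (∀ u, c u < 2 ^ b) ∧ ∀ j < 2 * k, c (f j) = j := by
    refine ⟨fun u => if h : ∃ j < 2 * k, f j = u then h.choose else 0, fun u => ?_, fun j hj => ?_⟩
    · dsimp only
      split_ifs with h
      · exact h.choose_spec.1.trans_le hb
      · positivity
    · have h : ∃ i < 2 * k, f i = f j := ⟨j, hj, rfl⟩
      dsimp only
      rw [dif_pos h]
      exact hinj _ h.choose_spec.1 _ hj h.choose_spec.2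
  set T : Finset (Fin n) := (range (2 * k)).image f with hT
  have hTk : #T ≤ 2 * k := card_image_le.trans_eq (card_range _)
  refine ⟨_, (coinMeasure_forall_round_le hn hb0 c hc T R).trans
    (one_sub_pow_le hn (Nat.le_pow_clog one_lt_two n) (le_trans ?_ hR)), fun ω hω => ?_⟩
  · gcongr
    norm_num
  · by_contra hcon
    refine hω fun r hr h => hcon ⟨r, hr, f 0, ?_⟩
    refine meets_of_coloured_cycle (by omega) f hadj hper hdeg fun i hi => ?_
    rw [h _ (mem_image_of_mem _ (mem_range.2 hi)), hcf i hi]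

end Final
end EvenCycle

theorem mainTheorem6 (k : ℕ) (hk : 2 ≤ k) (a : ℕ) :
    ∃ (P : WordRAM.Cmd) (C : ℝ) (c c₀ : ℕ),
      ∀ (n : ℕ) (G : SimpleGraph (Fin n)) (L : List (Fin n × Fin n)) (w : ℕ),
        0 < n → n ≤ G.edgeSet.ncard → WordRAM.IsEdgeList G L → n ^ c₀ ≤ 2 ^ w →
          (∀ ω : ℕ → Bool, ∃ (t : ℕ) (s : WordRAM.State),
            WordRAM.Exec w ω P (WordRAM.input L) t s ∧
            (t : ℝ) ≤ C * (G.edgeSet.ncard : ℝ) ^ ((2 * k : ℝ) / ((k : ℝ) + 1)) *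
              Real.logb 2 (G.edgeSet.ncard : ℝ) ^ c) ∧
          1 - 1 / (n : ℝ) ^ a ≤
            WordRAM.coinMeasure.real
              {ω | ∃ (t : ℕ) (s : WordRAM.State),
                WordRAM.Exec w ω P (WordRAM.input L) t s ∧
                (s.Accepts ↔ (SimpleGraph.cycleGraph (2 * k)).IsContained G)} := by
  classical
  -- Any constant b with 2k ≤ 2^b would do.
  set b := 2 * k with hb
  set Kr := a * 2 ^ (2 * k * b) with hKr
  set Kb := 2 * Kr * EvenCycle.scanConst k + 1 with hKb
  refine ⟨EvenCycle.detect k b Kr Kb, EvenCycle.timeConst k b Kr Kb, k,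
    EvenCycle.wordConst k b Kr Kb, fun n G L w hn hnm hL hw => ?_⟩
  have hcard : G.edgeSet.ncard = L.length := by
    rw [← EvenCycle.card_edgeFinset_of_isEdgeList hL, ← SimpleGraph.coe_edgeFinset,
      Set.ncard_coe_finset]
  rw [hcard] at hnm ⊢
  -- A single vertex has no edges, contradicting n ≤ m.
  have hn2 : 2 ≤ n := by
    by_contra h
    have h1 := G.card_edgeFinset_le_card_choose_two
    rw [EvenCycle.card_edgeFinset_of_isEdgeList hL, Fintype.card_fin,
      Nat.choose_eq_zero_of_lt (by omega)] at h1
    omega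
  have hrun := EvenCycle.detect_run hL hn2 hnm hk hKb hw
  refine ⟨fun ω => ?_, ?_⟩
  · obtain ⟨t, s, hex, ht, -⟩ := hrun ω
    exact ⟨t, s, hex, ht⟩
  by_cases hG : (SimpleGraph.cycleGraph (2 * k)).IsContained G
  · obtain ⟨bad, hbad, hgood⟩ := EvenCycle.exists_bad_event hk (b := b) (a := a)
      (Nat.lt_two_pow_self).le hn (R := Kr * Nat.clog 2 n) le_rfl hG
    have hsub : badᶜ ⊆ {ω | ∃ (t : ℕ) (s : WordRAM.State),
        WordRAM.Exec w ω (EvenCycle.detect k b Kr Kb) (WordRAM.input L) t s ∧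
        (s.Accepts ↔ (SimpleGraph.cycleGraph (2 * k)).IsContained G)} := fun ω hω => by
      obtain ⟨t, s, hex, -, -, hacc⟩ := hrun ω
      exact ⟨t, s, hex, iff_of_true (hacc (hgood ω hω)) hG⟩
    have h1 := MeasureTheory.measureReal_mono (μ := WordRAM.coinMeasure) hsub
    -- Subadditivity on the bad set and its complement avoids any measurability of these sets.
    have h2 := MeasureTheory.measureReal_union_le (μ := WordRAM.coinMeasure) bad badᶜ
    rw [Set.union_compl_self, MeasureTheory.probReal_univ] at h2
    linarith
  · have hall : {ω | ∃ (t : ℕ) (s : WordRAM.State),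
        WordRAM.Exec w ω (EvenCycle.detect k b Kr Kb) (WordRAM.input L) t s ∧
        (s.Accepts ↔ (SimpleGraph.cycleGraph (2 * k)).IsContained G)} = Set.univ := by
      refine Set.eq_univ_of_forall fun ω => ?_
      obtain ⟨t, s, hex, -, hacc, -⟩ := hrun ω
      exact ⟨t, s, hex, iff_of_false (hacc hG) hG⟩
    rw [hall, MeasureTheory.probReal_univ]
    have : (0 : ℝ) ≤ 1 / (n : ℝ) ^ a := by positivity
    linarith
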